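/- Fix a commutative ring $\Bbbk$; all categories and functors are $\Bbbk$-linear. A functor $G\colon \mathcal S\to\mathcal S'$ between triangulated categories is \emph{exact} if there is a natural isomorphism $\eta\colon G\circ[1]\cong[1]\circ G$ such that for every distinguished triangle $X\xrightarrow{f}Y\xrightarrow{g}Z\xrightarrow{h}X[1]$ the triangle $(G(f),G(g),\eta_X\circ G(h))$ is distinguished; an exact equivalence is an exact functor which is an equivalence. A \emph{Frobenius category} is an exact category (in the sense of Quillen) with enough injectives and enough projectives, in which an object is injective if and only if it is projective. Its \emph{stable category} $\underline{\mathcal F}$ has the same objects, and morphisms are identified when their difference factors through an injective object. The shift is defined by choosing for each $A$ an exact sequence $0\to A\to I\to A[1]\to 0$ with $I$ injective. The distinguished triangles are those isomorphic to images of sequences $(i,p,e)$, where $0\to A\xrightarrow{i}B\xrightarrow{p}C\to0$ is exact and $e\colon C\to A[1]$ is part of a morphism of exact sequences, equal to $\mathrm{id}_A$ on $A$, from it to $0\to A\to I\to A[1]\to0$. For a dg category $\mathcal C$ (with differentials of degree $1$), $H^0(\mathcal C)$ has the same objects as $\mathcal C$ and morphism spaces $H^0(\mathcal C(A,B))$.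 Right dg $\mathcal C$-modules are the dg functors from $\mathcal C^{\mathrm{op}}$ to the dg category of complexes of $\Bbbk$-modules; they form a dg category $\mathrm{dgMod}(\mathcal C)$, and $H^0(\mathrm{dgMod}(\mathcal C))$ is triangulated by the objectwise shift and the objectwise mapping cones. One says that $\mathcal C$ is \emph{pretriangulated} if the essential image of the (fully faithful) Yoneda functor $H^0(\mathcal C)\to H^0(\mathrm{dgMod}(\mathcal C))$ is a triangulated subcategory; then $H^0(\mathcal C)$ inherits a triangulated structure. A \emph{dg enhancement} of a triangulated category $\mathcal T$ is a pair $(\mathcal C,E)$ of a pretriangulated dg category $\mathcal C$ and an exact equivalence $E\colon H^0(\mathcal C)\to\mathcal T$. One says that $\mathcal T$ is \emph{algebraic} if it has a dg enhancement. \textbf{Proposition.} For a triangulated category $\mathcal T$ the following conditions are equivalent: (1) there is an exact and fully faithful functor $\mathcal T\to\underline{\mathcal F}$ for some Frobenius category $\mathcal F$; (2) there is an exact equivalence $\mathcal T\to\underline{\mathcal F}$ for some Frobenius category $\mathcal F$; (3) there is an exact and fully faithful functor $\mathcal T\to K(\mathcal A)$, where $K(\mathcal A)$ is the homotopy category of complexes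 in some additive category $\mathcal A$; (4) $\mathcal T$ is algebraic. -/

import Mathlib

open CategoryTheory

universe w v v' v'' u u' u''

/-- A (`K`-linear) differential graded category, with differentials of degree `1`.
`Hom A B n` is the degree `n` component of the complex of morphisms from `A` to `B`;
`comp h g f` is the composition `g ∘ f`, where `g` has degree `n` and `f` has degree `m`. -/
class DGCategory (K : Type w) [CommRing K] (C : Type u) : Type (max w u (v + 1)) where
  Hom : C → C → ℤ → Type v
  [addCommGroup : ∀ (A B : C) (n : ℤ), AddCommGroup (Hom A B n)]
  [module : ∀ (A B : C) (n : ℤ), Module K (Hom A B n)]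
  d : ∀ {A B : C} {n m : ℤ}, n + 1 = m → (Hom A B n →ₗ[K] Hom A B m)
  id : ∀ A : C, Hom A A 0
  comp : ∀ {X Y Z : C} {n m p : ℤ}, n + m = p →
    (Hom Y Z n →ₗ[K] Hom X Y m →ₗ[K] Hom X Z p)
  d_d : ∀ {A B : C} {n m p : ℤ} (h : n + 1 = m) (h' : m + 1 = p) (f : Hom A B n),
    d h' (d h f) = 0
  id_comp : ∀ {A B : C} {n : ℤ} (f : Hom A B n), comp (zero_add n) (id B) f = f
  comp_id : ∀ {A B : C} {n : ℤ} (f : Hom A B n), comp (add_zero n) f (id A) = f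
  assoc : ∀ {W X Y Z : C} {n m p nm mp nmp : ℤ} (h₁ : n + m = nm) (h₂ : m + p = mp)
    (h₃ : nm + p = nmp) (h₄ : n + mp = nmp) (f : Hom Y Z n) (g : Hom X Y m) (k : Hom W X p),
    comp h₃ (comp h₁ f g) k = comp h₄ f (comp h₂ g k)
  d_comp : ∀ {X Y Z : C} {n m p n' m' p' : ℤ} (h : n + m = p) (hp : p + 1 = p')
    (hn : n + 1 = n') (hm : m + 1 = m') (h₁ : n' + m = p') (h₂ : n + m' = p')
    (g : Hom Y Z n) (f : Hom X Y m),
    d hp (comp h g f) = comp h₁ (d hn g) f + n.negOnePow • comp h₂ g (d hm f)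

attribute [reducible, instance] DGCategory.addCommGroup DGCategory.module

namespace DGCategory

variable (K : Type w) [CommRing K]

/-- The degree `n` morphisms of a dg category. -/
abbrev DGHom {C : Type u} [DGCategory.{w, v} K C] (A B : C) (n : ℤ) : Type v :=
  DGCategory.Hom (K := K) A B n

section

variable {K} {C : Type u} [DGCategory.{w, v} K C]

lemma comp_units_smul {A B D : C} {n m p : ℤ} (h : n + m = p) (e : ℤˣ) (g : DGHom K B D n)
    (f : DGHom K A B m) : comp h g (e • f) = e • comp h g f := by
  rw [Units.smul_def, Units.smul_def, map_zsmul]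

lemma units_smul_comp {A B D : C} {n m p : ℤ} (h : n + m = p) (e : ℤˣ) (g : DGHom K B D n)
    (f : DGHom K A B m) : comp h (e • g) f = e • comp h g f := by
  rw [Units.smul_def, Units.smul_def, map_zsmul, LinearMap.smul_apply]

lemma d_units_smul {A B : C} {n m : ℤ} (h : n + 1 = m) (e : ℤˣ) (f : DGHom K A B n) :
    d h (e • f) = e • d h f := by
  rw [Units.smul_def, Units.smul_def, map_zsmul]

lemma d_id (A : C) {n : ℤ} (h : 0 + 1 = n) : d h (id (K := K) A) = 0 := by
  have := d_comp (K := K) (zero_add 0) h h h (by lia) (by lia) (id (K := K) A) (id A)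
  obtain rfl : n = 1 := by lia
  rw [comp_id, Int.negOnePow_zero, one_smul] at this
  erw [id_comp, comp_id] at this
  simpa using this

end

section Opposite

variable {K} {C : Type u} [DGCategory.{w, v} K C]

/-- The opposite dg category: the composition of `g` and `f` in `Cᵒᵖ` is
`(-1) ^ (deg f * deg g)` times the composition of `f` and `g` in `C`. -/
instance opposite : DGCategory.{w, v} K Cᵒᵖ where
  Hom A B n := DGHom K B.unop A.unop n
  d h := d h
  id A := id A.unop
  comp {A B D n m p} h := LinearMap.mk₂ K
    (fun g f => (n * m).negOnePow • comp (K := K) (C := C) (by lia : m + n = p) f g)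
    (fun _ _ _ => by rw [map_add, smul_add])
    (fun _ _ _ => by rw [map_smul, smul_comm])
    (fun _ _ _ => by rw [map_add, LinearMap.add_apply, smul_add])
    (fun _ _ _ => by rw [map_smul, LinearMap.smul_apply, smul_comm])
  d_d h h' f := d_d h h' f
  id_comp f := by simp [comp_id]
  comp_id f := by simp [id_comp]
  assoc {A B D E n m p nm mp nmp} h₁ h₂ h₃ h₄ f g k := by
    simp only [LinearMap.mk₂_apply, comp_units_smul, units_smul_comp, smul_smul]
    rw [assoc (K := K) (C := C) (by lia : p + m = mp) (by lia : m + n = nm) (by lia) (by lia)]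
    congr 1
    rw [← Int.negOnePow_add, ← Int.negOnePow_add]
    congr 1
    subst h₁ h₂
    ring
  d_comp {A B D n m p n' m' p'} h hp hn hm h₁ h₂ g f := by
    simp only [LinearMap.mk₂_apply, d_units_smul]
    rw [d_comp (K := K) (C := C) (by lia : m + n = p) hp hm hn (by lia) (by lia),
      smul_add, add_comm, smul_smul, smul_smul, ← Int.negOnePow_add, ← Int.negOnePow_add]
    subst hn hm
    congr 1
    · rw [add_mul, one_mul]
    · congr 1
      rw [Int.negOnePow_eq_iff]
      exact ⟨-n, by ring⟩

end Opposite


section HomotopyCategory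

variable (C : Type u) [DGCategory.{w, v} K C]

/-- The underlying category of a dg category: same objects, with the closed
morphisms of degree `0` as morphisms. -/
structure Z0 (K : Type w) [CommRing K] (C : Type u) [DGCategory.{w, v} K C] where
  obj : C

variable {K C} in
/-- The module of closed morphisms of degree `0`. -/
def closedHom (A B : C) : Submodule K (DGHom K A B 0) :=
  LinearMap.ker (d (zero_add 1))

variable {K C} in
/-- Composition of closed morphisms of degree `0`. -/
def closedComp {X Y Z : C} (g : closedHom (K := K) Y Z) (f : closedHom (K := K) X Y) :
    closedHom (K := K) X Z :=
  ⟨comp (add_zero 0) g.1 f.1, by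
    have hg : d (zero_add 1) g.1 = 0 := g.2
    have hf : d (zero_add 1) f.1 = 0 := f.2
    change d (zero_add 1) _ = 0
    rw [d_comp (add_zero 0) (zero_add 1) (zero_add 1) (zero_add 1) (by lia) (by lia), hf, hg]
    simp⟩

instance : Category (Z0 K C) where
  Hom X Y := closedHom (K := K) X.obj Y.obj
  id X := ⟨id X.obj, d_id _ _⟩
  comp f g := closedComp g f
  id_comp f := Subtype.ext (comp_id (K := K) f.1)
  comp_id f := Subtype.ext (id_comp (K := K) f.1)
  assoc f g h := Subtype.ext (assoc (K := K) _ _ _ _ h.1 g.1 f.1).symm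

instance : Preadditive (Z0 K C) where
  homGroup X Y := inferInstanceAs (AddCommGroup (closedHom (K := K) X.obj Y.obj))
  add_comp _ _ _ f f' g := Subtype.ext (map_add (comp (add_zero 0) g.1) f.1 f'.1)
  comp_add _ _ _ f g g' := Subtype.ext (LinearMap.map_add₂ (comp (add_zero 0)) g.1 g'.1 f.1)

instance : Linear K (Z0 K C) where
  homModule X Y := inferInstanceAs (Module K (closedHom (K := K) X.obj Y.obj))
  smul_comp _ _ _ r f g := Subtype.ext (map_smul (comp (add_zero 0) g.1) r f.1)
  comp_smul _ _ _ f r g := Subtype.ext (LinearMap.map_smul₂ (comp (add_zero 0)) r g.1 f.1)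

/-- Two closed morphisms of degree `0` are homotopic if their difference is a coboundary. -/
def homotopyRel : HomRel (Z0 K C) := fun X Y f g =>
  ∃ h : DGHom K X.obj Y.obj (-1), f.1 - g.1 = d (neg_add_cancel 1) h

instance : Congruence (homotopyRel K C) where
  equivalence {X Y} :=
    { refl := fun f => ⟨0, by simp⟩
      symm := by
        rintro f g ⟨h, hh⟩
        exact ⟨-h, by rw [map_neg, ← hh, neg_sub]⟩
      trans := by
        rintro f g k ⟨h, hh⟩ ⟨h', hh'⟩
        exact ⟨h + h', by rw [map_add, ← hh, ← hh', sub_add_sub_cancel]⟩ }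
  comp_left := by
    rintro X Y Z f g g' ⟨h, hh⟩
    have hf : d (zero_add 1) f.1 = 0 := f.2
    refine ⟨comp (add_zero (-1)) h f.1, ?_⟩
    rw [d_comp (add_zero (-1)) (neg_add_cancel 1) (neg_add_cancel 1) (zero_add 1) (add_zero 0)
      (by lia), hf, ← hh, map_zero, smul_zero, add_zero, map_sub, LinearMap.sub_apply]
    rfl
  comp_right := by
    rintro X Y Z f f' g ⟨h, hh⟩
    have hg : d (zero_add 1) g.1 = 0 := g.2
    refine ⟨comp (zero_add (-1)) g.1 h, ?_⟩
    rw [d_comp (zero_add (-1)) (neg_add_cancel 1) (zero_add 1) (neg_add_cancel 1) (by lia)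
      (add_zero 0), hg, ← hh, map_zero, LinearMap.zero_apply, zero_add, Int.negOnePow_zero,
      one_smul, map_sub]
    rfl

/-- The homotopy category `H⁰(C)` of a dg category `C`: same objects, with
morphisms `H⁰(C(A, B))`. -/
abbrev H0 := Quotient (homotopyRel K C)

lemma homotopyRel_add ⦃X Y : Z0 K C⦄ (f₁ f₂ g₁ g₂ : X ⟶ Y) (hf : homotopyRel K C f₁ f₂)
    (hg : homotopyRel K C g₁ g₂) : homotopyRel K C (f₁ + g₁) (f₂ + g₂) := by
  obtain ⟨h, hh⟩ := hf
  obtain ⟨h', hh'⟩ := hg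
  refine ⟨h + h', ?_⟩
  rw [map_add, ← hh, ← hh']
  exact add_sub_add_comm _ _ _ _

lemma homotopyRel_smul (a : K) ⦃X Y : Z0 K C⦄ (f g : X ⟶ Y) (hf : homotopyRel K C f g) :
    homotopyRel K C (a • f) (a • g) := by
  obtain ⟨h, hh⟩ := hf
  refine ⟨a • h, ?_⟩
  rw [map_smul, ← hh, smul_sub]
  rfl

instance : Preadditive (H0 K C) := Quotient.preadditive _ (homotopyRel_add K C)

instance : (Quotient.functor (homotopyRel K C)).Additive :=
  Quotient.functor_additive _ (homotopyRel_add K C)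

instance : Linear K (H0 K C) := Quotient.linear K _ (homotopyRel_smul K C)

end HomotopyCategory

end DGCategory

section DGFunctors

open DGCategory

/-- A dg functor between dg categories. -/
structure DGFunctor (K : Type w) [CommRing K] (C : Type u) [DGCategory.{w, v} K C]
    (D : Type u') [DGCategory.{w, v'} K D] where
  obj : C → D
  map : ∀ {A B : C} (n : ℤ), DGHom K A B n →ₗ[K] DGHom K (obj A) (obj B) n
  map_d : ∀ {A B : C} {n m : ℤ} (h : n + 1 = m) (f : DGHom K A B n),
    map m (d h f) = d h (map n f)
  map_id : ∀ A : C, map 0 (id (K := K) A) = id (K := K) (obj A)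
  map_comp : ∀ {X Y Z : C} {n m p : ℤ} (h : n + m = p) (g : DGHom K Y Z n) (f : DGHom K X Y m),
    map p (comp h g f) = comp h (map n g) (map m f)

namespace DGFunctor

variable {K : Type w} [CommRing K] {C : Type u} [DGCategory.{w, v} K C]
  {D : Type u'} [DGCategory.{w, v'} K D] {E : Type u''} [DGCategory.{w, v''} K E]

/-- Composition of dg functors. -/
def compose (F : DGFunctor K C D) (G : DGFunctor K D E) : DGFunctor K C E where
  obj A := G.obj (F.obj A)
  map n := (G.map n).comp (F.map n)
  map_d h f := by simp [F.map_d, G.map_d]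
  map_id A := by simp [F.map_id, G.map_id]
  map_comp h g f := by simp [F.map_comp, G.map_comp]

/-- The functor induced by a dg functor on underlying categories. -/
def mapZ0 (F : DGFunctor K C D) : Z0 K C ⥤ Z0 K D where
  obj X := ⟨F.obj X.obj⟩
  map f := ⟨F.map 0 f.1, by
    have hf : d (zero_add 1) f.1 = 0 := f.2
    change d (zero_add 1) _ = 0
    rw [← F.map_d, hf, map_zero]⟩
  map_id X := Subtype.ext (F.map_id X.obj)
  map_comp f g := Subtype.ext (F.map_comp (add_zero 0) g.1 f.1)

/-- The functor induced by a dg functor on homotopy categories. -/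
def mapH0 (F : DGFunctor K C D) : H0 K C ⥤ H0 K D :=
  CategoryTheory.Quotient.lift _ (F.mapZ0 ⋙ Quotient.functor _) (by
    rintro X Y f g ⟨h, hh⟩
    refine CategoryTheory.Quotient.sound _ ⟨F.map (-1) h, ?_⟩
    have key := F.map_d (neg_add_cancel 1) h
    rw [← hh, map_sub] at key
    exact key)

/-- The degree `n` natural transformations from `F` to `G`. -/
def natTrans (F G : DGFunctor K C D) (n : ℤ) :
    Submodule K (∀ A : C, DGHom K (F.obj A) (G.obj A) n) where
  carrier := {φ | ∀ (A B : C) (m p : ℤ) (h : n + m = p) (h' : m + n = p) (f : DGHom K A B m),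
    comp h (φ B) (F.map m f) = (n * m).negOnePow • comp h' (G.map m f) (φ A)}
  zero_mem' A B m p h h' f := by simp
  add_mem' {φ ψ} hφ hψ A B m p h h' f := by
    simp only [Pi.add_apply, map_add, LinearMap.add_apply, smul_add]
    rw [hφ A B m p h h' f, hψ A B m p h h' f]
  smul_mem' a φ hφ A B m p h h' f := by
    simp only [Pi.smul_apply, map_smul, LinearMap.smul_apply]
    rw [hφ A B m p h h' f, smul_comm]

lemma natTrans_comm {F G : DGFunctor K C D} {n : ℤ} (φ : natTrans F G n) {A B : C} {m p : ℤ}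
    (h : n + m = p) (h' : m + n = p) (f : DGHom K A B m) :
    comp h (φ.1 B) (F.map m f) = (n * m).negOnePow • comp h' (G.map m f) (φ.1 A) :=
  φ.2 A B m p h h' f

/-- The dg category of dg functors: the differential and the composition of
natural transformations are computed objectwise. -/
instance dgFun : DGCategory.{w, max u v'} K (DGFunctor K C D) where
  Hom F G n := natTrans F G n
  d {F G n m} h :=
    { toFun := fun φ => ⟨fun A => d h (φ.1 A), by
        intro A B i p hp hp' f
        have key := congrArg (d (rfl : n + i + 1 = n + i + 1))
          (natTrans_comm φ rfl (add_comm i n) f)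
        rw [d_units_smul, d_comp rfl rfl h rfl (by lia) (by lia),
          d_comp (add_comm i n) rfl rfl h (by lia) (by lia), ← F.map_d, ← G.map_d,
          natTrans_comm φ (by lia : n + (i + 1) = n + i + 1) (by lia), smul_smul, smul_add,
          smul_smul, ← Int.negOnePow_add, ← Int.negOnePow_add] at key
        have e : (n + n * (i + 1)).negOnePow = (n * i).negOnePow := by
          rw [Int.negOnePow_eq_iff]
          exact ⟨n, by ring⟩
        rw [e] at key
        replace key := add_right_cancel (key.trans (add_comm _ _))
        have e' : m * i = n * i + i := by rw [← h]; ring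
        rw [e']
        obtain rfl : n + i + 1 = p := by lia
        exact key⟩
      map_add' := fun φ ψ => Subtype.ext (funext fun A => map_add _ _ _)
      map_smul' := fun a φ => Subtype.ext (funext fun A => map_smul _ _ _) }
  id F := ⟨fun A => id (F.obj A), by
    intro A B m p hp hp' f
    obtain rfl : m = p := by lia
    rw [zero_mul, Int.negOnePow_zero, one_smul, id_comp, comp_id]⟩
  comp {F G H n m p} h := LinearMap.mk₂ K
    (fun ψ φ => ⟨fun A => comp h (ψ.1 A) (φ.1 A), by
      intro A B i q hq hq' f
      rw [assoc h (rfl : m + i = m + i) hq (by lia), natTrans_comm φ rfl (by lia) f,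
        comp_units_smul,
        ← assoc (rfl : n + i = n + i) (by lia : i + m = m + i) (by lia) (by lia),
        natTrans_comm ψ rfl (by lia) f, units_smul_comp, smul_smul,
        assoc (by lia : i + n = n + i) h (by lia) hq', ← Int.negOnePow_add]
      congr 2
      rw [← h]
      ring⟩)
    (fun _ _ _ => Subtype.ext (funext fun A => LinearMap.map_add₂ (comp h) _ _ _))
    (fun _ _ _ => Subtype.ext (funext fun A => LinearMap.map_smul₂ (comp h) _ _ _))
    (fun _ _ _ => Subtype.ext (funext fun A => map_add (comp h _) _ _))
    (fun _ _ _ => Subtype.ext (funext fun A => map_smul (comp h _) _ _))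
  d_d h h' φ := Subtype.ext (funext fun A => d_d h h' (φ.1 A))
  id_comp φ := Subtype.ext (funext fun A => id_comp (φ.1 A))
  comp_id φ := Subtype.ext (funext fun A => comp_id (φ.1 A))
  assoc h₁ h₂ h₃ h₄ φ ψ χ := Subtype.ext (funext fun A =>
    assoc h₁ h₂ h₃ h₄ (φ.1 A) (ψ.1 A) (χ.1 A))
  d_comp h hp hn hm h₁ h₂ ψ φ := Subtype.ext (funext fun A =>
    d_comp h hp hn hm h₁ h₂ (ψ.1 A) (φ.1 A))

/-- Postcomposition with a dg functor, as a dg functor between dg categories of dg functors. -/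
def postcompose (Φ : DGFunctor K D E) : DGFunctor K (DGFunctor K C D) (DGFunctor K C E) where
  obj F := F.compose Φ
  map {F G} n :=
    { toFun := fun φ => ⟨fun A => Φ.map n (φ.1 A), by
        intro A B m p h h' f
        have key := congrArg (Φ.map p) (natTrans_comm φ h h' f)
        rw [Units.smul_def, map_zsmul, ← Units.smul_def, Φ.map_comp, Φ.map_comp] at key
        exact key⟩
      map_add' := fun φ ψ => Subtype.ext (funext fun A => map_add _ _ _)
      map_smul' := fun a φ => Subtype.ext (funext fun A => map_smul _ _ _) }
  map_d h φ := Subtype.ext (funext fun A => Φ.map_d h (φ.1 A))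
  map_id F := Subtype.ext (funext fun A => Φ.map_id (F.obj A))
  map_comp h ψ φ := Subtype.ext (funext fun A => Φ.map_comp h (ψ.1 A) (φ.1 A))

end DGFunctor

section Complexes

open CochainComplex CochainComplex.HomComplex

variable (K : Type w) [CommRing K] (A : Type u) [Category.{v} A] [Preadditive A] [Linear K A]

/-- The dg category of complexes in a `K`-linear category. -/
instance complexesDG : DGCategory.{w, v} K (CochainComplex A ℤ) where
  Hom X Y n := Cochain X Y n
  d {X Y n m} _ := δ_hom K X Y n m
  id X := Cochain.ofHom (𝟙 X)
  comp {X Y Z n m p} h := LinearMap.mk₂ K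
    (fun g f => Cochain.comp f g (by lia : m + n = p))
    (fun _ _ _ => Cochain.comp_add _ _ _ _)
    (fun _ _ _ => Cochain.comp_smul _ _ _ _)
    (fun _ _ _ => Cochain.add_comp _ _ _ _)
    (fun _ _ _ => Cochain.smul_comp _ _ _ _)
  d_d {X Y n m p} h h' f := δ_δ n m p f
  id_comp f := Cochain.comp_id f
  comp_id f := Cochain.id_comp f
  assoc {X Y Z W n m p nm mp nmp} h₁ h₂ h₃ h₄ f g k :=
    (Cochain.comp_assoc k g f (by lia) (by lia) (by lia)).symm
  d_comp {X Y Z n m p n' m' p'} h hp hn hm h₁ h₂ g f :=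
    δ_comp f g (by lia) m' n' p' hp hm hn

/-- The shift `X ↦ X[1]` of complexes, as a dg functor; it sends a morphism `f` of
degree `n` to `(-1) ^ n` times the shifted family of morphisms. -/
def shiftDG : DGFunctor K (CochainComplex A ℤ) (CochainComplex A ℤ) where
  obj X := (CategoryTheory.shiftFunctor (CochainComplex A ℤ) (1 : ℤ)).obj X
  map {X Y} n := (n.negOnePow : ℤˣ) • (Cochain.shiftLinearMap K X Y n 1)
  map_d {X Y n m} h f := by
    change m.negOnePow • (δ n m f).shift 1 = δ n m (n.negOnePow • f.shift 1)
    rw [δ_units_smul, Cochain.δ_shift, smul_smul, ← h, Int.negOnePow_add]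
  map_id X := by
    change (0 : ℤ).negOnePow • (Cochain.ofHom (𝟙 X)).shift 1 = Cochain.ofHom (𝟙 _)
    rw [Int.negOnePow_zero, one_smul]
    ext p
    simp [Cochain.shift_v']
  map_comp {X Y Z n m p} h g f := by
    have h' : m + n = p := by lia
    change p.negOnePow • (Cochain.comp f g h').shift 1 =
      Cochain.comp (m.negOnePow • f.shift 1) (n.negOnePow • g.shift 1) h'
    rw [Cochain.comp_units_smul, Cochain.units_smul_comp, smul_smul, ← Int.negOnePow_add, h]
    congr 1
    ext i j hij
    rw [Cochain.shift_v', Cochain.comp_v _ _ h' (i + 1) (i + m + 1) (j + 1) (by lia) (by lia),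
      Cochain.comp_v _ _ h' i (i + m) j (by lia) (by lia), Cochain.shift_v', Cochain.shift_v']
    rfl

end Complexes

section Cone

open CochainComplex CochainComplex.HomComplex

variable {K : Type w} [CommRing K] {C : Type u} [DGCategory.{w, v} K C]
  {A : Type u'} [Category.{v'} A] [Preadditive A] [Linear K A]
  {F G : DGFunctor K C (CochainComplex A ℤ)}

/-- The morphism of complexes `F X ⟶ G X` which is a component of a closed natural
transformation of degree `0`. -/
def componentHom (φ : closedHom (K := K) F G) (X : C) : F.obj X ⟶ G.obj X :=
  Cocycle.homOf (Cocycle.mk (φ.1.1 X) 1 (zero_add 1) (by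
    have h : d (K := K) (zero_add 1) φ.1 = 0 := φ.2
    exact congrFun (congrArg Subtype.val h) X))

lemma ofHom_componentHom (φ : closedHom (K := K) F G) (X : C) :
    Cochain.ofHom (componentHom φ X) = φ.1.1 X :=
  Cocycle.cochain_ofHom_homOf_eq_coe _

lemma componentHom_naturality (φ : closedHom (K := K) F G) {X Y : C} {n : ℤ}
    (f : DGHom K X Y n) :
    Cochain.comp (F.map n f) (Cochain.ofHom (componentHom φ Y)) (add_zero n) =
      Cochain.comp (Cochain.ofHom (componentHom φ X)) (G.map n f) (zero_add n) := by
  have h := DGFunctor.natTrans_comm φ.1 (zero_add n) (add_zero n) f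
  rw [zero_mul, Int.negOnePow_zero, one_smul] at h
  rw [ofHom_componentHom, ofHom_componentHom]
  exact h

lemma rightShift_comp_shift {X Y : CochainComplex A ℤ} {n k : ℤ} (f : Cochain X Y n)
    (h : n + -1 = k) (h' : -1 + n = k) :
    f.comp ((Cochain.ofHom (𝟙 Y)).rightShift 1 (-1) (neg_add_cancel 1)) h =
      ((Cochain.ofHom (𝟙 X)).rightShift 1 (-1) (neg_add_cancel 1)).comp (f.shift 1) h' := by
  ext p q hpq
  rw [Cochain.comp_v _ _ h p (p + n) q rfl (by lia),
    Cochain.comp_v _ _ h' p (p - 1) q (by lia) (by lia),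
    Cochain.rightShift_v _ _ _ _ (p + n) q _ (p + n) (by lia),
    Cochain.rightShift_v _ _ _ _ p (p - 1) _ p (by lia),
    Cochain.shift_v _ _ _ _ _ p (p + n) (by lia) (by lia), Cochain.ofHom_v, Cochain.ofHom_v,
    HomologicalComplex.id_f, HomologicalComplex.id_f, Category.id_comp, Category.id_comp]
  exact (Iso.inv_hom_id_assoc _ _).symm

variable [Limits.HasBinaryBiproducts A]

/-- The map induced by `f` on mapping cones: it is `(-1) ^ n • F.map f` on the component `F[1]`
and `G.map f` on the component `G`, where `n` is the degree of `f`. -/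
noncomputable def coneMap (φ : closedHom (K := K) F G) {X Y : C} (n : ℤ) (f : DGHom K X Y n) :
    Cochain (mappingCone (componentHom φ X)) (mappingCone (componentHom φ Y)) n :=
  mappingCone.descCochain _
    (n.negOnePow • Cochain.comp (F.map n f) (mappingCone.inl (componentHom φ Y))
      (rfl : n + (-1) = n + (-1)))
    (Cochain.comp (G.map n f) (Cochain.ofHom (mappingCone.inr (componentHom φ Y))) (add_zero n))
    (by lia)

lemma inl_coneMap (φ : closedHom (K := K) F G) {X Y : C} {n k : ℤ} (f : DGHom K X Y n)
    (h : -1 + n = k) (h' : n + -1 = k) :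
    (mappingCone.inl (componentHom φ X)).comp (coneMap φ n f) h =
      n.negOnePow • Cochain.comp (F.map n f) (mappingCone.inl (componentHom φ Y)) h' := by
  subst h'
  exact mappingCone.inl_descCochain _ _ _ _

lemma inr_coneMap (φ : closedHom (K := K) F G) {X Y : C} {n : ℤ} (f : DGHom K X Y n) :
    (Cochain.ofHom (mappingCone.inr (componentHom φ X))).comp (coneMap φ n f) (zero_add n) =
      Cochain.comp (G.map n f) (Cochain.ofHom (mappingCone.inr (componentHom φ Y)))
        (add_zero n) :=
  mappingCone.inr_descCochain _ _ _ _

lemma cone_ext {X Y : CochainComplex A ℤ} {φ : X ⟶ Y} {Z : CochainComplex A ℤ} {n k : ℤ}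
    (h : -1 + n = k) {α β : Cochain (mappingCone φ) Z n}
    (h₁ : (mappingCone.inl φ).comp α h = (mappingCone.inl φ).comp β h)
    (h₂ : (Cochain.ofHom (mappingCone.inr φ)).comp α (zero_add n) =
      (Cochain.ofHom (mappingCone.inr φ)).comp β (zero_add n)) : α = β :=
  (mappingCone.ext_cochain_from_iff φ k n (by lia)).2 ⟨h₁, h₂⟩

/-- The cone of a closed natural transformation of degree `0` between dg functors with values in
complexes: its value on objects is the mapping cone. -/
noncomputable def coneDG (φ : closedHom (K := K) F G) : DGFunctor K C (CochainComplex A ℤ) where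
  obj X := mappingCone (componentHom φ X)
  map {X Y} n :=
    { toFun := coneMap φ n
      map_add' := fun f g => by
        have h : -1 + n = -1 + n := rfl
        refine cone_ext h ?_ ?_
        · rw [Cochain.comp_add, inl_coneMap φ _ h (add_comm _ _), inl_coneMap φ _ h (add_comm _ _),
            inl_coneMap φ _ h (add_comm _ _), map_add, ← smul_add]
          exact congrArg _ (Cochain.add_comp _ _ _ _)
        · rw [Cochain.comp_add, inr_coneMap, inr_coneMap, inr_coneMap, map_add]
          exact Cochain.add_comp _ _ _ _
      map_smul' := fun a f => by
        have h : -1 + n = -1 + n := rfl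
        refine cone_ext h ?_ ?_
        · rw [RingHom.id_apply, Cochain.comp_smul, inl_coneMap φ _ h (add_comm _ _),
            inl_coneMap φ _ h (add_comm _ _), map_smul, smul_comm]
          exact congrArg _ (Cochain.smul_comp _ _ _ _)
        · rw [RingHom.id_apply, Cochain.comp_smul, inr_coneMap, inr_coneMap, map_smul]
          exact Cochain.smul_comp _ _ _ _ }
  map_d {X Y n m} h f := by
    change coneMap φ m (d h f) = δ n m (coneMap φ n f)
    have e₁ : δ n m (F.map n f) = F.map m (d h f) := (F.map_d h f).symm
    have e₂ : δ n m (G.map n f) = G.map m (d h f) := (G.map_d h f).symm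
    have hm : m.negOnePow = -n.negOnePow := by rw [← h, Int.negOnePow_succ]
    unfold coneMap
    rw [mappingCone.δ_descCochain _ _ _ _ m h]
    unfold mappingCone.descCochain
    rw [δ_units_smul, δ_comp _ _ _ m 0 n (by lia) h (neg_add_cancel 1), mappingCone.δ_inl,
      δ_comp_zero_cochain _ _ m h, δ_ofHom, Cochain.comp_zero, zero_add, e₁, e₂,
      Cochain.ofHom_comp, ← Cochain.comp_assoc_of_third_is_zero_cochain,
      ← Cochain.comp_assoc_of_third_is_zero_cochain, componentHom_naturality, hm, smul_add]
    simp
    rfl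
  map_id X := by
    have e₁ : F.map 0 (id X) = Cochain.ofHom (𝟙 (F.obj X)) := F.map_id X
    have e₂ : G.map 0 (id X) = Cochain.ofHom (𝟙 (G.obj X)) := G.map_id X
    change coneMap φ 0 (id X) = Cochain.ofHom (𝟙 (mappingCone (componentHom φ X)))
    refine cone_ext (n := 0) (k := -1) (add_zero (-1)) ?_ ?_
    · rw [inl_coneMap φ _ _ (zero_add (-1)), e₁, Cochain.comp_id, Cochain.id_comp,
        Int.negOnePow_zero, one_smul]
    · rw [inr_coneMap, e₂, Cochain.comp_id, Cochain.id_comp]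
  map_comp {X Y Z n m p} h g f := by
    have h' : m + n = p := by lia
    change coneMap φ p _ = Cochain.comp (coneMap φ m f) (coneMap φ n g) h'
    have e₁ : F.map p (comp h g f) = Cochain.comp (F.map m f) (F.map n g) h' := F.map_comp h g f
    have e₂ : G.map p (comp h g f) = Cochain.comp (G.map m f) (G.map n g) h' := G.map_comp h g f
    refine cone_ext (rfl : -1 + p = -1 + p) ?_ ?_
    · rw [inl_coneMap φ _ _ (by lia), e₁,
        ← Cochain.comp_assoc _ _ _ (rfl : -1 + m = -1 + m) h' (by lia),
        inl_coneMap φ _ _ (by lia), Cochain.units_smul_comp,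
        Cochain.comp_assoc _ _ _ (by lia : m + -1 = -1 + m) (rfl : -1 + n = -1 + n) (by lia),
        inl_coneMap φ _ _ (by lia), Cochain.comp_units_smul, smul_smul, ← Int.negOnePow_add, h',
        Cochain.comp_assoc _ _ _ h' (by lia : n + -1 = -1 + n) (by lia)]
    · rw [inr_coneMap, e₂, ← Cochain.comp_assoc_of_first_is_zero_cochain, inr_coneMap,
        Cochain.comp_assoc_of_second_is_zero_cochain, inr_coneMap,
        Cochain.comp_assoc_of_third_is_zero_cochain]

/-- The inclusion of `G` in the cone of `φ : F ⟶ G`. -/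
noncomputable def coneInr (φ : closedHom (K := K) F G) : closedHom (K := K) G (coneDG φ) :=
  ⟨⟨fun X => Cochain.ofHom (mappingCone.inr (componentHom φ X)), by
    intro X Y m p h h' f
    obtain rfl : m = p := by lia
    rw [zero_mul, Int.negOnePow_zero, one_smul]
    exact (inr_coneMap φ f).symm⟩, by
    change d (zero_add 1) _ = 0
    exact Subtype.ext (funext fun X => δ_ofHom _)⟩

/-- The projection of a mapping cone onto the shift of the source, with the same sign as in the
mapping cone triangles in the homotopy category of complexes. -/
noncomputable def coneProj {X Y : CochainComplex A ℤ} (φ : X ⟶ Y) :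
    mappingCone φ ⟶ (CategoryTheory.shiftFunctor (CochainComplex A ℤ) (1 : ℤ)).obj X :=
  (mappingCone.triangle φ).mor₃

lemma inl_coneProj {X Y : CochainComplex A ℤ} (φ : X ⟶ Y) :
    (mappingCone.inl φ).comp (Cochain.ofHom (coneProj φ)) (add_zero (-1)) =
      -(Cochain.ofHom (𝟙 X)).rightShift 1 (-1) (neg_add_cancel 1) := by
  ext p q hpq
  rw [Cochain.comp_zero_cochain_v, Cochain.ofHom_v]
  refine (mappingCone.inl_v_triangle_mor₃_f φ p q hpq).trans ?_
  rw [Cochain.neg_v, Cochain.rightShift_v _ _ _ _ p q hpq p (by lia), Cochain.ofHom_v]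
  simp
  rfl

lemma inr_coneProj {X Y : CochainComplex A ℤ} (φ : X ⟶ Y) :
    (Cochain.ofHom (mappingCone.inr φ)).comp (Cochain.ofHom (coneProj φ))
      (add_zero 0) = 0 := by
  rw [← Cochain.ofHom_comp, coneProj]
  exact (congrArg _ (mappingCone.inr_triangleδ φ)).trans (Cochain.ofHom_zero _ _)

/-- The morphism from the cone of `φ : F ⟶ G` to `F[1]`, with the same sign as in the mapping
cone triangles in the homotopy category of complexes. -/
noncomputable def coneDelta (φ : closedHom (K := K) F G) :
    closedHom (K := K) (coneDG φ) (F.compose (shiftDG K A)) :=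
  ⟨⟨fun X => Cochain.ofHom (coneProj (componentHom φ X)), by
    intro X Y m p h h' f
    obtain rfl : m = p := by lia
    rw [zero_mul, Int.negOnePow_zero, one_smul]
    change Cochain.comp (coneMap φ m f) (Cochain.ofHom (coneProj _)) (add_zero m)
      = Cochain.comp (Cochain.ofHom (coneProj _))
        (m.negOnePow • Cochain.shift (F.map m f) 1) (zero_add m)
    refine cone_ext (rfl : -1 + m = -1 + m) ?_ ?_
    · rw [← Cochain.comp_assoc_of_third_is_zero_cochain, inl_coneMap φ _ _ (by lia),
        Cochain.units_smul_comp, Cochain.comp_assoc_of_third_is_zero_cochain,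
        inl_coneProj, ← Cochain.comp_assoc_of_second_is_zero_cochain, inl_coneProj,
        Cochain.comp_units_smul, Cochain.neg_comp, Cochain.comp_neg, rightShift_comp_shift]
    · rw [← Cochain.comp_assoc_of_third_is_zero_cochain, inr_coneMap,
        Cochain.comp_assoc_of_third_is_zero_cochain, inr_coneProj,
        ← Cochain.comp_assoc_of_second_is_zero_cochain, inr_coneProj,
        Cochain.comp_zero, Cochain.zero_comp]⟩, by
    change d (zero_add 1) _ = 0
    exact Subtype.ext (funext fun X => δ_ofHom _)⟩

end Cone

section Yoneda

open CochainComplex CochainComplex.HomComplex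

variable (K : Type w) [CommRing K] (C : Type u) [DGCategory.{w, v} K C]

/-- The dg category of right dg modules over `C`, i.e. dg functors from `Cᵒᵖ` to the
dg category of complexes of `K`-modules. -/
abbrev DGMod := DGFunctor K Cᵒᵖ (CochainComplex (ModuleCat.{v} K) ℤ)

variable {C} in
/-- The complex of morphisms between two objects of a dg category. -/
def homComplex (B A : C) : CochainComplex (ModuleCat.{v} K) ℤ where
  X n := ModuleCat.of K (DGHom K B A n)
  d i j := if h : i + 1 = j then ModuleCat.ofHom (d h) else 0
  shape i j h := dif_neg h
  d_comp_d' i j k hij hjk := by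
    rw [dif_pos (show i + 1 = j from hij), dif_pos (show j + 1 = k from hjk)]
    ext f
    exact d_d _ _ f

section

variable {K C} {B A B' A' B'' A'' : C} {n m p q : ℤ}

/-- The linear map which is a component of a cochain between complexes of morphisms. -/
def evalCochain (α : Cochain (homComplex K B A) (homComplex K B' A') n) (h : p + n = q) :
    DGHom K B A p →ₗ[K] DGHom K B' A' q :=
  (α.v p q h).hom

/-- A family of linear maps, as a cochain between complexes of morphisms. -/
def mkCochain (α : ∀ p q : ℤ, p + n = q → (DGHom K B A p →ₗ[K] DGHom K B' A' q)) :
    Cochain (homComplex K B A) (homComplex K B' A') n :=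
  Cochain.mk fun p q h => ModuleCat.ofHom (α p q h)

lemma evalCochain_mkCochain
    (α : ∀ p q : ℤ, p + n = q → (DGHom K B A p →ₗ[K] DGHom K B' A' q)) (h : p + n = q)
    (x : DGHom K B A p) : evalCochain (mkCochain α) h x = α p q h x := rfl

lemma cochain_ext {α β : Cochain (homComplex K B A) (homComplex K B' A') n}
    (h : ∀ (p q : ℤ) (h : p + n = q) (x : DGHom K B A p),
      evalCochain α h x = evalCochain β h x) : α = β := by
  ext p q hpq x
  exact h p q hpq x

lemma evalCochain_add (α β : Cochain (homComplex K B A) (homComplex K B' A') n) (h : p + n = q)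
    (x : DGHom K B A p) :
    evalCochain (α + β) h x = evalCochain α h x + evalCochain β h x := rfl

lemma evalCochain_smul (a : K) (α : Cochain (homComplex K B A) (homComplex K B' A') n)
    (h : p + n = q) (x : DGHom K B A p) :
    evalCochain (a • α) h x = a • evalCochain α h x := rfl

lemma evalCochain_units_smul (a : ℤˣ) (α : Cochain (homComplex K B A) (homComplex K B' A') n)
    (h : p + n = q) (x : DGHom K B A p) :
    evalCochain (a • α) h x = a • evalCochain α h x := by
  rcases Int.units_eq_one_or a with rfl | rfl
  · rw [one_smul, one_smul]
  · rw [Units.neg_smul, Units.neg_smul, one_smul, one_smul]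
    rfl

lemma evalCochain_id (x : DGHom K B A p) (h : p + 0 = p) :
    evalCochain (Cochain.ofHom (𝟙 (homComplex K B A))) h x = x := by
  unfold evalCochain
  rw [Cochain.ofHom_v]
  rfl

lemma evalCochain_comp (α : Cochain (homComplex K B A) (homComplex K B' A') n)
    (β : Cochain (homComplex K B' A') (homComplex K B'' A'') m) {k r : ℤ} (h : n + m = k)
    (h₁ : p + n = q) (h₂ : q + m = r) (h₃ : p + k = r) (x : DGHom K B A p) :
    evalCochain (α.comp β h) h₃ x = evalCochain β h₂ (evalCochain α h₁ x) := by
  unfold evalCochain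
  rw [Cochain.comp_v _ _ h p q r h₁ h₂]
  rfl

lemma evalCochain_δ (α : Cochain (homComplex K B A) (homComplex K B' A') n) (hn : n + 1 = m)
    {p' q' : ℤ} (h : p + m = q) (h₁ : p + n = q') (h₂ : q' + 1 = q) (h₃ : p + 1 = p')
    (h₄ : p' + n = q) (x : DGHom K B A p) :
    evalCochain (δ n m α) h x =
      d h₂ (evalCochain α h₁ x) - n.negOnePow • evalCochain α h₄ (d h₃ x) := by
  have e₁ : (homComplex K B A).d p p' = ModuleCat.ofHom (d h₃) := dif_pos h₃
  have e₂ : (homComplex K B' A').d q' q = ModuleCat.ofHom (d h₂) := dif_pos h₂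
  have e : (δ n m α).v p q h = α.v p q' h₁ ≫ (homComplex K B' A').d q' q -
      n.negOnePow • (homComplex K B A).d p p' ≫ α.v p' q h₄ := by
    have hm : m.negOnePow = -n.negOnePow := by rw [← hn, Int.negOnePow_succ]
    rw [δ_v n m hn α p q h q' p' (by lia) h₃, hm, Units.neg_smul, sub_eq_add_neg]
  unfold evalCochain
  rw [e, e₁, e₂]
  rcases Int.units_eq_one_or n.negOnePow with h | h <;> rw [h]
  · rw [one_smul, one_smul]
    rfl
  · rw [Units.neg_smul, Units.neg_smul, one_smul, one_smul]
    rfl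

variable (A) in
/-- The action of `f : B' ⟶ B` on the represented dg module `C(-, A)`. -/
def yonedaAct (f : DGHom K B' B n) : Cochain (homComplex K B A) (homComplex K B' A) n :=
  mkCochain fun p _ h => (p * n).negOnePow • (comp (n := p) (m := n) h).flip f

lemma eval_yonedaAct (f : DGHom K B' B n) (h : p + n = q) (x : DGHom K B A p) :
    evalCochain (yonedaAct A f) h x = (p * n).negOnePow • comp h x f := by
  unfold yonedaAct
  rw [evalCochain_mkCochain]
  rcases Int.units_eq_one_or (p * n).negOnePow with h | h <;> rw [h]
  · rw [one_smul, one_smul]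
    rfl
  · rw [Units.neg_smul, Units.neg_smul, one_smul, one_smul]
    rfl

variable (B) in
/-- Composition with `f : A ⟶ A'`, as a cochain from `C(B, A)` to `C(B, A')`. -/
def postcomp (f : DGHom K A A' n) : Cochain (homComplex K B A) (homComplex K B A') n :=
  mkCochain fun p _ h => comp (n := n) (m := p) ((add_comm n p).trans h) f

lemma eval_postcomp (f : DGHom K A A' n) (h : p + n = q) (h' : n + p = q) (x : DGHom K B A p) :
    evalCochain (postcomp B f) h x = comp h' f x := rfl

end

variable {C} in
/-- The right dg module `C(-, A)` represented by `A`: a morphism `f : B' ⟶ B` of degree `n` in `C`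
acts by sending `g : B ⟶ A` of degree `p` to `(-1) ^ (p * n)` times the composition of
`g` and `f`. -/
def yonedaObj (A : C) : DGMod K C where
  obj B := homComplex K B.unop A
  map {B B'} n :=
    { toFun := fun f => yonedaAct A (B := B.unop) (B' := B'.unop) f
      map_add' := fun f f' => by
        refine cochain_ext fun p q h x => ?_
        rw [evalCochain_add, eval_yonedaAct, eval_yonedaAct, eval_yonedaAct]
        erw [map_add (comp h x)]
        rw [smul_add]
      map_smul' := fun a f => by
        refine cochain_ext fun p q h x => ?_
        rw [RingHom.id_apply, evalCochain_smul, eval_yonedaAct, eval_yonedaAct]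
        erw [map_smul (comp h x)]
        rw [smul_comm] }
  map_d {B B' n m} h f := by
    change yonedaAct A _ = δ n m (yonedaAct A _)
    refine cochain_ext fun p q hpq x => ?_
    rw [evalCochain_δ _ h hpq rfl (by lia) rfl (by lia), eval_yonedaAct, eval_yonedaAct,
      eval_yonedaAct, d_units_smul, d_comp rfl (by lia) rfl h (by lia) hpq, smul_add, smul_smul,
      smul_smul, ← Int.negOnePow_add, ← Int.negOnePow_add]
    have e₁ : (n + (p + 1) * n).negOnePow = (p * n).negOnePow := by
      rw [Int.negOnePow_eq_iff]
      exact ⟨n, by ring⟩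
    have e₂ : p * n + p = p * m := by
      rw [← h]
      ring
    rw [e₁, e₂, add_sub_cancel_left]
    rfl
  map_id B := by
    change yonedaAct A (DGCategory.id B.unop) = Cochain.ofHom (𝟙 (homComplex K B.unop A))
    refine cochain_ext fun p q hpq x => ?_
    obtain rfl : p = q := by lia
    rw [evalCochain_id, eval_yonedaAct, mul_zero, Int.negOnePow_zero, one_smul, comp_id]
  map_comp {X Y Z n m p} h g f := by
    have h' : m + n = p := by lia
    change yonedaAct A ((n * m).negOnePow • comp (K := K) (C := C) h' f g) =
      Cochain.comp (yonedaAct A _) (yonedaAct A _) h'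
    refine cochain_ext fun i j hij x => ?_
    rw [evalCochain_comp _ _ h' rfl (by lia) hij, eval_yonedaAct, eval_yonedaAct, eval_yonedaAct,
      comp_units_smul, units_smul_comp, smul_smul, smul_smul, ← Int.negOnePow_add,
      ← Int.negOnePow_add, assoc rfl h' (by lia) hij]
    congr 1
    rw [Int.negOnePow_eq_iff, ← h]
    exact ⟨0, by ring⟩

/-- The dg Yoneda embedding. -/
def yonedaDG : DGFunctor K C (DGMod K C) where
  obj A := yonedaObj K A
  map {A A'} n :=
    { toFun := fun f => ⟨fun B => postcomp B.unop f, by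
        intro B B' m p h h' g
        change Cochain.comp (yonedaAct A (B := B.unop) (B' := B'.unop) g) (postcomp B'.unop f) h' =
          (n * m).negOnePow • Cochain.comp (postcomp B.unop f)
            (yonedaAct A' (B := B.unop) (B' := B'.unop) g) h
        refine cochain_ext fun i j hij x => ?_
        rw [evalCochain_units_smul, evalCochain_comp _ _ h' rfl (by lia) hij,
          evalCochain_comp _ _ h rfl (by lia) hij, eval_yonedaAct, eval_yonedaAct,
          eval_postcomp _ _ (by lia), eval_postcomp _ _ (add_comm n i), comp_units_smul, smul_smul,
          ← Int.negOnePow_add, assoc (add_comm n i) rfl (by lia) (by lia)]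
        congr 1
        rw [Int.negOnePow_eq_iff]
        exact ⟨-(n * m), by ring⟩⟩
      map_add' := fun f f' => Subtype.ext (funext fun B => cochain_ext fun p q h x =>
        LinearMap.map_add₂ (comp (by lia)) f f' x)
      map_smul' := fun a f => Subtype.ext (funext fun B => cochain_ext fun p q h x =>
        LinearMap.map_smul₂ (comp (by lia)) a f x) }
  map_d {A A' n m} h f := by
    refine Subtype.ext (funext fun B => ?_)
    change postcomp B.unop (d h f) = δ n m (postcomp B.unop f)
    refine cochain_ext fun p q hpq x => ?_
    rw [evalCochain_δ _ h hpq rfl (by lia) rfl (by lia), eval_postcomp _ _ (by lia),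
      eval_postcomp _ _ (by lia), eval_postcomp _ _ (by lia),
      d_comp (by lia) (by lia) h rfl (by lia) (by lia), add_sub_cancel_right]
  map_id A := by
    refine Subtype.ext (funext fun B => ?_)
    change postcomp B.unop (DGCategory.id A) = Cochain.ofHom (𝟙 (homComplex K B.unop A))
    refine cochain_ext fun p q hpq x => ?_
    obtain rfl : p = q := by lia
    rw [evalCochain_id, eval_postcomp _ _ (by lia), id_comp]
  map_comp {X Y Z n m p} h g f := by
    refine Subtype.ext (funext fun B => ?_)
    have h' : m + n = p := by lia
    change postcomp B.unop (comp h g f) = Cochain.comp (postcomp B.unop f) (postcomp B.unop g) h'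
    refine cochain_ext fun i j hij x => ?_
    rw [evalCochain_comp _ _ h' rfl (by lia) hij, eval_postcomp _ _ (by lia),
      eval_postcomp _ _ (by lia), eval_postcomp _ _ (by lia), assoc h (add_comm m i) (by lia) (by lia)]

/-- The Yoneda embedding is bijective on morphisms of every degree. -/
lemma yonedaDG_bijective (A A' : C) (n : ℤ) :
    Function.Bijective ((yonedaDG K C).map (A := A) (B := A') n) := by
  constructor
  · intro f f' hff'
    have h : postcomp A f = postcomp A f' := congrFun (congrArg Subtype.val hff') (Opposite.op A)
    have h' := congrArg (fun α => evalCochain α (zero_add n) (DGCategory.id A)) h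
    simp only [eval_postcomp _ _ (add_zero n), comp_id] at h'
    exact h'
  · intro φ
    let φ' (B : C) : Cochain (homComplex K B A) (homComplex K B A') n := φ.1 (Opposite.op B)
    refine ⟨evalCochain (φ' A) (zero_add n) (DGCategory.id A), Subtype.ext (funext fun B => ?_)⟩
    change postcomp B.unop _ = φ' B.unop
    refine cochain_ext fun p q hpq x => ?_
    have key : Cochain.comp (yonedaAct A x) (φ' B.unop) hpq =
        (n * p).negOnePow • Cochain.comp (φ' A) (yonedaAct A' x) (by lia) :=
      DGFunctor.natTrans_comm φ (by lia : n + p = q) hpq (A := Opposite.op A) (B := B) x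
    replace key := congrArg (fun α => evalCochain α (zero_add q) (DGCategory.id A)) key
    simp only [evalCochain_units_smul] at key
    rw [evalCochain_comp _ _ hpq (zero_add p) hpq, evalCochain_comp _ _ (by lia) (zero_add n)
      (by lia), eval_yonedaAct, eval_yonedaAct, smul_smul, ← Int.negOnePow_add, zero_mul,
      Int.negOnePow_zero, one_smul, id_comp, Int.negOnePow_even _ ⟨n * p, rfl⟩, one_smul] at key
    rw [eval_postcomp _ _ (by lia), key]

end Yoneda

section MapH0

variable {K : Type w} [CommRing K] {C : Type u} [DGCategory.{w, v} K C]
  {D : Type u'} [DGCategory.{w, v'} K D]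

variable (K) in
/-- An object of a dg category, as an object of its homotopy category. -/
def DGCategory.toH0 (A : C) : H0 K C := ⟨⟨A⟩⟩

/-- The morphism in the homotopy category given by a closed morphism of degree `0`. -/
def DGCategory.homToH0 {A B : C} (f : closedHom (K := K) A B) : toH0 K A ⟶ toH0 K B :=
  (Quotient.functor (homotopyRel K C)).map (X := (⟨A⟩ : Z0 K C)) (Y := ⟨B⟩) f

lemma DGFunctor.mapH0_full (F : DGFunctor K C D)
    (hF : ∀ (A B : C) (n : ℤ), Function.Bijective (F.map (A := A) (B := B) n)) :
    F.mapH0.Full where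
  map_surjective {X Y} f := by
    obtain ⟨φ, rfl⟩ := (Quotient.functor (homotopyRel K D)).map_surjective
      (X := (⟨F.obj X.as.obj⟩ : Z0 K D)) (Y := ⟨F.obj Y.as.obj⟩) f
    obtain ⟨g, hg⟩ := (hF X.as.obj Y.as.obj 0).2 φ.1
    have hφ : d (zero_add 1) φ.1 = 0 := φ.2
    have hg' : d (zero_add 1) g = 0 := (hF _ _ 1).1 (by rw [F.map_d, hg, hφ, map_zero])
    refine ⟨(Quotient.functor (homotopyRel K C)).map (X := X.as) (Y := Y.as) ⟨g, hg'⟩, ?_⟩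
    exact congrArg _ (Subtype.ext hg)

lemma DGFunctor.mapH0_faithful (F : DGFunctor K C D)
    (hF : ∀ (A B : C) (n : ℤ), Function.Bijective (F.map (A := A) (B := B) n)) :
    F.mapH0.Faithful where
  map_injective {X Y} f g hfg := by
    obtain ⟨f, rfl⟩ := (Quotient.functor (homotopyRel K C)).map_surjective f
    obtain ⟨g, rfl⟩ := (Quotient.functor (homotopyRel K C)).map_surjective g
    have h : homotopyRel K D (F.mapZ0.map f) (F.mapZ0.map g) :=
      (Quotient.functor_map_eq_iff (homotopyRel K D) _ _).1 hfg
    obtain ⟨k, hk⟩ := h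
    obtain ⟨l, rfl⟩ := (hF X.as.obj Y.as.obj (-1)).2 k
    refine CategoryTheory.Quotient.sound _ ⟨l, (hF _ _ 0).1 ?_⟩
    rw [map_sub, F.map_d]
    exact hk

end MapH0

/-- A shift functor together with a class of triangles `X ⟶ Y ⟶ Z ⟶ X[1]`: the data of the
triangulated structure of a category. -/
structure TriangleStructure (S : Type u) [Category.{v} S] where
  shift : S ⥤ S
  distinguished : ∀ {X Y Z : S}, (X ⟶ Y) → (Y ⟶ Z) → (Z ⟶ shift.obj X) → Prop

namespace TriangleStructure

/-- The triangulated structure of a (pre)triangulated category in the sense of Mathlib. -/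
def ofPretriangulated (T : Type u) [Category.{v} T] [Preadditive T] [Limits.HasZeroObject T]
    [HasShift T ℤ] [∀ n : ℤ, (shiftFunctor T n).Additive] [Pretriangulated T] :
    TriangleStructure T where
  shift := shiftFunctor T (1 : ℤ)
  distinguished f g h := Pretriangulated.Triangle.mk f g h ∈ Pretriangulated.distinguishedTriangles

variable {S : Type u} [Category.{v} S] {S' : Type u'} [Category.{v'} S']

/-- A functor is exact if it commutes with the shifts up to a natural isomorphism such that
distinguished triangles are sent to distinguished triangles. -/
def IsExact (𝒮 : TriangleStructure S) (𝒮' : TriangleStructure S') (G : S ⥤ S') : Prop :=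
  ∃ η : 𝒮.shift ⋙ G ≅ G ⋙ 𝒮'.shift, ∀ {X Y Z : S} (f : X ⟶ Y) (g : Y ⟶ Z)
    (h : Z ⟶ 𝒮.shift.obj X), 𝒮.distinguished f g h →
      𝒮'.distinguished (G.map f) (G.map g) (G.map h ≫ η.hom.app X)

/-- The objects satisfying `P` form a (strictly full) triangulated subcategory. -/
structure IsTriangulatedSubcategory (𝒮 : TriangleStructure S) (P : ObjectProperty S) : Prop where
  exists_zero : ∃ Z : S, Limits.IsZero Z ∧ P Z
  of_iso : ∀ {X Y : S}, (X ≅ Y) → P X → P Y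
  shift_iff : ∀ X : S, P (𝒮.shift.obj X) ↔ P X
  of_distinguished : ∀ {X Y Z : S} (f : X ⟶ Y) (g : Y ⟶ Z) (h : Z ⟶ 𝒮.shift.obj X),
    𝒮.distinguished f g h → P X → P Y → P Z

/-- The triangulated structure induced along a fully faithful functor whose essential image is a
triangulated subcategory. -/
noncomputable def induced (𝒮' : TriangleStructure S') (Φ : S ⥤ S') [Φ.Full] [Φ.Faithful]
    (h : 𝒮'.IsTriangulatedSubcategory Φ.essImage) : TriangleStructure S :=
  have hΦ : ∀ X : S, Φ.essImage ((Φ ⋙ 𝒮'.shift).obj X) := fun X =>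
    (h.shift_iff (Φ.obj X)).2 (Φ.obj_mem_essImage X)
  { shift := Functor.essImage.liftFunctor (Φ ⋙ 𝒮'.shift) Φ hΦ
    distinguished := fun {X _ _} f g k => 𝒮'.distinguished (Φ.map f) (Φ.map g)
      (Φ.map k ≫ (Functor.essImage.liftFunctorCompIso (Φ ⋙ 𝒮'.shift) Φ hΦ).hom.app X) }

end TriangleStructure

section Enhancement

variable (K : Type w) [CommRing K] (C : Type u) [DGCategory.{w, v} K C]

/-- The triangulated structure on the homotopy category of dg functors with values in complexes:
the shift is computed objectwise, and the distinguished triangles are those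
isomorphic to `F ⟶ G ⟶ cone φ ⟶ F[1]` for a closed `φ : F ⟶ G` of degree `0`. -/
noncomputable def dgFunTriangles (A : Type u') [Category.{v'} A] [Preadditive A] [Linear K A]
    [Limits.HasBinaryBiproducts A] :
    TriangleStructure (H0 K (DGFunctor K C (CochainComplex A ℤ))) where
  shift := (DGFunctor.postcompose (shiftDG K A)).mapH0
  distinguished {X Y Z} f g h :=
    ∃ (F G : DGFunctor K C (CochainComplex A ℤ)) (φ : closedHom (K := K) F G)
      (a : X ≅ toH0 K F) (b : Y ≅ toH0 K G) (c : Z ≅ toH0 K (coneDG φ)),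
      f ≫ b.hom = a.hom ≫ homToH0 φ ∧ g ≫ c.hom = b.hom ≫ homToH0 (coneInr φ) ∧
      h ≫ (DGFunctor.postcompose (shiftDG K A)).mapH0.map a.hom = c.hom ≫ homToH0 (coneDelta φ)

/-- The triangulated structure on the homotopy category of right dg modules. -/
noncomputable def dgModTriangles : TriangleStructure (H0 K (DGMod K C)) :=
  dgFunTriangles K Cᵒᵖ (ModuleCat.{v} K)

/-- The functor induced by the dg Yoneda embedding on homotopy categories. -/
def yonedaH0 : H0 K C ⥤ H0 K (DGMod K C) := (yonedaDG K C).mapH0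

instance : (yonedaH0 K C).Full := DGFunctor.mapH0_full _ (yonedaDG_bijective K C)

instance : (yonedaH0 K C).Faithful := DGFunctor.mapH0_faithful _ (yonedaDG_bijective K C)

/-- A dg category is pretriangulated if the essential image of its homotopy category in the
homotopy category of dg modules is a triangulated subcategory. -/
def IsDGPretriangulated : Prop :=
  (dgModTriangles K C).IsTriangulatedSubcategory (yonedaH0 K C).essImage

variable {C} in
/-- The triangulated structure on the homotopy category of a pretriangulated dg category. -/
noncomputable def h0Triangles (h : IsDGPretriangulated K C) : TriangleStructure (H0 K C) :=
  (dgModTriangles K C).induced (yonedaH0 K C) h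

/-- A dg enhancement of a `K`-linear category `T` equipped with a triangulated structure `𝒯`:
a pretriangulated dg category `C` with an exact equivalence `H⁰(C) ⥤ T`. -/
structure DGEnhancement (T : Type u') [Category.{v'} T] [Preadditive T] [Linear K T]
    (𝒯 : TriangleStructure T) where
  C : Type u
  [dg : DGCategory.{w, v} K C]
  pretriangulated : IsDGPretriangulated K C
  E : H0 K C ⥤ T
  [additive : E.Additive]
  [linear : E.Linear K]
  [isEquivalence : E.IsEquivalence]
  exact : (h0Triangles K pretriangulated).IsExact 𝒯 E

end Enhancement

end DGFunctors

section Exact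

open Limits

variable {F : Type u} [Category.{v} F] [Preadditive F]

/-- A morphism which is the first morphism of a sequence in `conf`. -/
def IsInflation (conf : ObjectProperty (ShortComplex F)) {X Y : F} (i : X ⟶ Y) : Prop :=
  ∃ (Z : F) (p : Y ⟶ Z) (h : i ≫ p = 0), conf (ShortComplex.mk i p h)

/-- A morphism which is the second morphism of a sequence in `conf`. -/
def IsDeflation (conf : ObjectProperty (ShortComplex F)) {Y Z : F} (p : Y ⟶ Z) : Prop :=
  ∃ (X : F) (i : X ⟶ Y) (h : i ≫ p = 0), conf (ShortComplex.mk i p h)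

variable (F) in
/-- A Quillen exact structure: a class of kernel-cokernel pairs (called exact sequences)
closed under isomorphisms, such that inflations and deflations contain the identities, are closed
under composition, and are stable under pushouts and pullbacks respectively. An exact category is
an additive category equipped with an exact structure. -/
structure ExactStructure where
  exactSeq : ObjectProperty (ShortComplex F)
  of_iso : ∀ {S S' : ShortComplex F}, (S ≅ S') → exactSeq S → exactSeq S'
  isKernel : ∀ S : ShortComplex F, exactSeq S → Nonempty (IsLimit (KernelFork.ofι S.f S.zero))
  isCokernel : ∀ S : ShortComplex F, exactSeq S →
    Nonempty (IsColimit (CokernelCofork.ofπ S.g S.zero))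
  inflation_id : ∀ X : F, IsInflation exactSeq (𝟙 X)
  deflation_id : ∀ X : F, IsDeflation exactSeq (𝟙 X)
  inflation_comp : ∀ {X Y Z : F} (i : X ⟶ Y) (j : Y ⟶ Z), IsInflation exactSeq i →
    IsInflation exactSeq j → IsInflation exactSeq (i ≫ j)
  deflation_comp : ∀ {X Y Z : F} (p : X ⟶ Y) (q : Y ⟶ Z), IsDeflation exactSeq p →
    IsDeflation exactSeq q → IsDeflation exactSeq (p ≫ q)
  inflation_pushout : ∀ {X Y X' : F} (i : X ⟶ Y) (f : X ⟶ X'), IsInflation exactSeq i →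
    ∃ (Y' : F) (f' : Y ⟶ Y') (i' : X' ⟶ Y'), IsPushout i f f' i' ∧ IsInflation exactSeq i'
  deflation_pullback : ∀ {Y Z Z' : F} (p : Y ⟶ Z) (f : Z' ⟶ Z), IsDeflation exactSeq p →
    ∃ (Y' : F) (f' : Y' ⟶ Y) (p' : Y' ⟶ Z'), IsPullback f' p' p f ∧ IsDeflation exactSeq p'

namespace ExactStructure

variable (E : ExactStructure F)

/-- An object `I` is injective if `F(-, I)` preserves exact sequences, i.e. every morphism to `I`
extends along inflations. -/
def IsInjective (I : F) : Prop :=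
  ∀ S : ShortComplex F, E.exactSeq S → ∀ f : S.X₁ ⟶ I, ∃ g : S.X₂ ⟶ I, S.f ≫ g = f

/-- An object `P` is projective if `F(P, -)` preserves exact sequences, i.e. every morphism from
`P` lifts along deflations. -/
def IsProjective (P : F) : Prop :=
  ∀ S : ShortComplex F, E.exactSeq S → ∀ f : P ⟶ S.X₃, ∃ g : P ⟶ S.X₂, g ≫ S.g = f

/-- An exact structure is Frobenius if there are enough injectives and enough projectives, and
the injective and the projective objects coincide. -/
structure IsFrobenius : Prop where
  enoughInjectives : ∀ A : F, ∃ (I C : F) (i : A ⟶ I) (p : I ⟶ C) (h : i ≫ p = 0),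
    E.exactSeq (ShortComplex.mk i p h) ∧ E.IsInjective I
  enoughProjectives : ∀ C : F, ∃ (A P : F) (i : A ⟶ P) (p : P ⟶ C) (h : i ≫ p = 0),
    E.exactSeq (ShortComplex.mk i p h) ∧ E.IsProjective P
  injective_iff_projective : ∀ A : F, E.IsInjective A ↔ E.IsProjective A

/-- Two morphisms are stably equivalent if their difference factors through an injective. -/
def stableRel : HomRel F := fun A B f g =>
  ∃ (I : F) (a : A ⟶ I) (b : I ⟶ B), E.IsInjective I ∧ f - g = a ≫ b

variable {E} in
lemma IsInjective.biprod [HasBinaryBiproducts F] {I J : F} (hI : E.IsInjective I)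
    (hJ : E.IsInjective J) : E.IsInjective (I ⊞ J) := fun S hS f => by
  obtain ⟨g, hg⟩ := hI S hS (f ≫ biprod.fst)
  obtain ⟨h, hh⟩ := hJ S hS (f ≫ biprod.snd)
  exact ⟨biprod.lift g h, by ext <;> simp [hg, hh]⟩

lemma isInjective_of_isZero {Z : F} (hZ : IsZero Z) : E.IsInjective Z :=
  fun _ _ _ => ⟨0, hZ.eq_of_tgt _ _⟩

section

variable [HasBinaryBiproducts F]

lemma stableRel_add ⦃X Y : F⦄ (f₁ f₂ g₁ g₂ : X ⟶ Y) (hf : E.stableRel f₁ f₂)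
    (hg : E.stableRel g₁ g₂) : E.stableRel (f₁ + g₁) (f₂ + g₂) := by
  obtain ⟨I, a, b, hI, h⟩ := hf
  obtain ⟨J, a', b', hJ, h'⟩ := hg
  exact ⟨I ⊞ J, biprod.lift a a', biprod.desc b b', hI.biprod hJ, by
    rw [add_sub_add_comm, h, h', biprod.lift_desc]⟩

variable [HasZeroObject F]

instance : Congruence E.stableRel where
  equivalence {X Y} :=
    { refl := fun f => by
        obtain ⟨Z, hZ⟩ := HasZeroObject.zero (C := F)
        exact ⟨Z, 0, 0, E.isInjective_of_isZero hZ, by simp⟩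
      symm := by
        rintro f g ⟨I, a, b, hI, h⟩
        exact ⟨I, -a, b, hI, by rw [Preadditive.neg_comp, ← h, neg_sub]⟩
      trans := by
        intro f g k h h'
        obtain ⟨I, a, b, hI, h⟩ := h
        obtain ⟨J, a', b', hJ, h'⟩ := h'
        exact ⟨I ⊞ J, biprod.lift a a', biprod.desc b b', hI.biprod hJ, by
          rw [biprod.lift_desc, ← h, ← h', sub_add_sub_cancel]⟩ }
  comp_left := by
    rintro X Y Z f g g' ⟨I, a, b, hI, h⟩
    exact ⟨I, f ≫ a, b, hI, by rw [Category.assoc, ← h, Preadditive.comp_sub]⟩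
  comp_right := by
    rintro X Y Z f f' g ⟨I, a, b, hI, h⟩
    exact ⟨I, a, b ≫ g, hI, by rw [← Category.assoc, ← h, Preadditive.sub_comp]⟩

/-- The stable category: same objects, with stable equivalence classes of morphisms. -/
abbrev Stable := Quotient E.stableRel

instance : Preadditive E.Stable := Quotient.preadditive _ E.stableRel_add

instance : (Quotient.functor E.stableRel).Additive :=
  Quotient.functor_additive _ E.stableRel_add

instance (K : Type w) [CommRing K] [Linear K F] : Linear K E.Stable :=
  Quotient.linear K _ (by
    rintro r X Y f g ⟨I, a, b, hI, h⟩
    exact ⟨I, r • a, b, hI, by rw [Linear.smul_comp, ← h, smul_sub]⟩)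

end

namespace IsFrobenius

variable {E} (hE : E.IsFrobenius)

/-- The chosen injective object containing `A`. -/
noncomputable def inj (A : F) : F := (hE.enoughInjectives A).choose

/-- The chosen cokernel `A[1]` of the inclusion of `A` in an injective object. -/
noncomputable def shiftObj (A : F) : F := (hE.enoughInjectives A).choose_spec.choose

/-- The chosen inflation from `A` to an injective object. -/
noncomputable def ι (A : F) : A ⟶ hE.inj A :=
  (hE.enoughInjectives A).choose_spec.choose_spec.choose

/-- The chosen deflation from an injective object to `A[1]`. -/
noncomputable def π (A : F) : hE.inj A ⟶ hE.shiftObj A :=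
  (hE.enoughInjectives A).choose_spec.choose_spec.choose_spec.choose

lemma ι_π (A : F) : hE.ι A ≫ hE.π A = 0 :=
  (hE.enoughInjectives A).choose_spec.choose_spec.choose_spec.choose_spec.choose

lemma exactSeq_ι_π (A : F) : E.exactSeq (ShortComplex.mk (hE.ι A) (hE.π A) (hE.ι_π A)) :=
  (hE.enoughInjectives A).choose_spec.choose_spec.choose_spec.choose_spec.choose_spec.1

lemma isInjective_inj (A : F) : E.IsInjective (hE.inj A) :=
  (hE.enoughInjectives A).choose_spec.choose_spec.choose_spec.choose_spec.choose_spec.2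

lemma exists_desc {A X : F} (u : hE.inj A ⟶ X) (hu : hE.ι A ≫ u = 0) :
    ∃ v : hE.shiftObj A ⟶ X, hE.π A ≫ v = u := by
  obtain ⟨h⟩ := E.isCokernel _ (hE.exactSeq_ι_π A)
  exact ⟨h.desc (CokernelCofork.ofπ u hu), h.fac _ WalkingParallelPair.one⟩

lemma hom_ext {A X : F} {v v' : hE.shiftObj A ⟶ X} (h : hE.π A ≫ v = hE.π A ≫ v') : v = v' := by
  obtain ⟨hc⟩ := E.isCokernel _ (hE.exactSeq_ι_π A)
  exact Cofork.IsColimit.hom_ext hc h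

/-- `v : A[1] ⟶ B[1]` is induced by `f : A ⟶ B` if it is part of a morphism of exact sequences
between the chosen sequences of `A` and `B`. -/
def Induces {A B : F} (f : A ⟶ B) (v : hE.shiftObj A ⟶ hE.shiftObj B) : Prop :=
  ∃ u : hE.inj A ⟶ hE.inj B, hE.ι A ≫ u = f ≫ hE.ι B ∧ hE.π A ≫ v = u ≫ hE.π B

lemma exists_induces {A B : F} (f : A ⟶ B) : ∃ v, hE.Induces f v := by
  obtain ⟨u, hu⟩ := hE.isInjective_inj B _ (hE.exactSeq_ι_π A) (f ≫ hE.ι B)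
  obtain ⟨v, hv⟩ := hE.exists_desc (u ≫ hE.π B) (by
    rw [← Category.assoc]
    erw [hu]
    rw [Category.assoc, hE.ι_π, comp_zero])
  exact ⟨v, u, hu, hv⟩

lemma Induces.comp {A B C : F} {f : A ⟶ B} {g : B ⟶ C} {v v'} (h : hE.Induces f v)
    (h' : hE.Induces g v') : hE.Induces (f ≫ g) (v ≫ v') := by
  obtain ⟨u, h₁, h₂⟩ := h
  obtain ⟨u', h₁', h₂'⟩ := h'
  exact ⟨u ≫ u', by rw [reassoc_of% h₁, h₁', Category.assoc],
    by rw [reassoc_of% h₂, h₂', Category.assoc]⟩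

lemma induces_id (A : F) : hE.Induces (𝟙 A) (𝟙 (hE.shiftObj A)) :=
  ⟨𝟙 _, by simp, by simp⟩

lemma Induces.stableRel {A B : F} {f f' : A ⟶ B} {v v'} (h : hE.Induces f v)
    (h' : hE.Induces f' v') (hf : E.stableRel f f') : E.stableRel v v' := by
  obtain ⟨u, h₁, h₂⟩ := h
  obtain ⟨u', h₁', h₂'⟩ := h'
  obtain ⟨I, a, b, hI, hab⟩ := hf
  obtain ⟨a', ha'⟩ := hI _ (hE.exactSeq_ι_π A) a
  dsimp at a' ha'
  obtain ⟨t, ht⟩ := hE.exists_desc (u - u' - a' ≫ b ≫ hE.ι B) (by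
    rw [Preadditive.comp_sub, Preadditive.comp_sub, h₁, h₁', reassoc_of% ha', ← Category.assoc a,
      ← hab, Preadditive.sub_comp, sub_self])
  refine ⟨hE.inj B, t, hE.π B, hE.isInjective_inj B, hE.hom_ext ?_⟩
  rw [Preadditive.comp_sub, h₂, h₂', reassoc_of% ht]
  simp [Preadditive.sub_comp, hE.ι_π]

variable [HasBinaryBiproducts F] [HasZeroObject F]

/-- The shift functor of the stable category. -/
noncomputable def shift : E.Stable ⥤ E.Stable :=
  CategoryTheory.Quotient.lift _
    { obj := fun A => (Quotient.functor E.stableRel).obj (hE.shiftObj A)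
      map := fun f => (Quotient.functor E.stableRel).map (hE.exists_induces f).choose
      map_id := fun A => by
        rw [← (Quotient.functor E.stableRel).map_id]
        exact CategoryTheory.Quotient.sound _ (Induces.stableRel hE
          (hE.exists_induces (𝟙 A)).choose_spec (hE.induces_id A)
          (Congruence.equivalence.refl _))
      map_comp := fun f g => by
        rw [← (Quotient.functor E.stableRel).map_comp]
        exact CategoryTheory.Quotient.sound _ (Induces.stableRel hE
          (hE.exists_induces (f ≫ g)).choose_spec
          (Induces.comp hE (hE.exists_induces f).choose_spec (hE.exists_induces g).choose_spec)
          (Congruence.equivalence.refl _)) }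
    (fun A B f g h => CategoryTheory.Quotient.sound _ (Induces.stableRel hE
      (hE.exists_induces f).choose_spec (hE.exists_induces g).choose_spec h))

/-- The triangulated structure of the stable category of a Frobenius category. The distinguished
triangles are those isomorphic to the image of `(i, p, e)`, where `A ⟶ B ⟶ C` is an exact
sequence with morphisms `i` and `p`, and `e : C ⟶ A[1]` is part of a morphism of exact
sequences, which is the identity of `A`, to the chosen sequence `A ⟶ inj A ⟶ A[1]`. -/
noncomputable def triangles : TriangleStructure E.Stable where
  shift := hE.shift
  distinguished {X Y Z} f g h :=
    ∃ (A B C : F) (i : A ⟶ B) (p : B ⟶ C) (w : i ≫ p = 0) (b : B ⟶ hE.inj A)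
      (e : C ⟶ hE.shiftObj A) (α : X ≅ (Quotient.functor E.stableRel).obj A)
      (β : Y ≅ (Quotient.functor E.stableRel).obj B)
      (γ : Z ≅ (Quotient.functor E.stableRel).obj C),
      E.exactSeq (ShortComplex.mk i p w) ∧ i ≫ b = hE.ι A ∧ p ≫ e = b ≫ hE.π A ∧
      f ≫ β.hom = α.hom ≫ (Quotient.functor E.stableRel).map i ∧
      g ≫ γ.hom = β.hom ≫ (Quotient.functor E.stableRel).map p ∧
      h ≫ hE.shift.map α.hom = γ.hom ≫ (Quotient.functor E.stableRel).map e

end IsFrobenius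

end ExactStructure

end Exact

/-! The homotopy category of complexes K(A) is the hub: each of the other descriptions of the
triangulated category T is compared with it, and an equivalence is in particular an embedding.

From complexes to Frobenius categories: the complexes whose class lies in the essential image of T
in K(A), with the degreewise split sequences, form a Frobenius category (`ComplexesOf.isFrobenius`).
Its injective objects are the contractible complexes, and a morphism factors through one exactly
when it is nullhomotopic, so the stable category is that essential image.

From complexes to dg categories: the full dg category of the complexes G(t), for t in T, has H⁰
equivalent to T. Under this equivalence its Yoneda functor becomes an exact fully faithful functor
from T to dg modules, whose essential image is therefore a triangulated subcategory
(`ImageDG.isDGPretriangulated`).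

From dg categories to complexes: formal shifts (X, n) and a formal morphism δ of degree 1 with δ² =
0 and [δ, f] = d f are adjoined to a dg category. An object X becomes the complex of the (X, n) with
differential δ. A cochain between two such complexes is a family f p + (g p) δ. It is a cocycle of
degree 0 when the f p are closed and f (p + 1) = f p + d (g p), so up to homotopy only the class of
f 0 survives and `realization` is fully faithful. For dg modules its exactness is formal, since
cones and shifts are given by equations which every dg functor preserves; for a pretriangulated dg
category it follows along the Yoneda embedding (`isExact_realization`).

From Frobenius categories to complexes: every object is the object of cocycles Z⁰ of an acyclic
complex of injectives, and homotopy classes of chain maps correspond to stable classes of morphisms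
between the Z⁰ (`AcyclicData.Represents.eq_iff`). This embeds the stable category in K(Inj). An
exact sequence yields a morphism from a mapping cone to the third complex with the right
compatibilities (`AcyclicData.exists_mappingCone_hom`), and `distTriang_map_of_fullyFaithful` shows
that it is invertible.

The axioms of a triangulated category are never checked for dg modules or for stable categories.
Only `IsoClosed`, `ConesUnique` and `HasCones` are used, together with the principle
`IsExact.of_comp` that exactness can be tested after a fully faithful exact functor. -/

/-! ### Triangle structures and the formal behaviour of exact functors. -/

namespace TriangleStructure

open Pretriangulated

variable {S : Type u} [Category.{v} S] {S' : Type u'} [Category.{v'} S']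
  {S'' : Type u''} [Category.{v''} S'']

/-- The class of distinguished triangles is closed under isomorphisms. -/
def IsoClosed (𝒮 : TriangleStructure S) : Prop :=
  ∀ ⦃X Y Z X' Y' Z' : S⦄ (f : X ⟶ Y) (g : Y ⟶ Z) (h : Z ⟶ 𝒮.shift.obj X) (f' : X' ⟶ Y')
    (g' : Y' ⟶ Z') (h' : Z' ⟶ 𝒮.shift.obj X') (a : X ≅ X') (b : Y ≅ Y') (c : Z ≅ Z'),
    f ≫ b.hom = a.hom ≫ f' → g ≫ c.hom = b.hom ≫ g' → h ≫ 𝒮.shift.map a.hom = c.hom ≫ h' →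
    𝒮.distinguished f' g' h' → 𝒮.distinguished f g h

/-- Isomorphisms between the first morphisms of distinguished triangles extend to isomorphisms of
triangles. -/
def ConesUnique (𝒮 : TriangleStructure S) : Prop :=
  ∀ ⦃X Y Z X' Y' Z' : S⦄ (f : X ⟶ Y) (g : Y ⟶ Z) (h : Z ⟶ 𝒮.shift.obj X) (f' : X' ⟶ Y')
    (g' : Y' ⟶ Z') (h' : Z' ⟶ 𝒮.shift.obj X') (a : X ≅ X') (b : Y ≅ Y'),
    𝒮.distinguished f g h → 𝒮.distinguished f' g' h' → f ≫ b.hom = a.hom ≫ f' →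
    ∃ c : Z ≅ Z', g ≫ c.hom = b.hom ≫ g' ∧ h ≫ 𝒮.shift.map a.hom = c.hom ≫ h'

/-- Every morphism is the first morphism of a distinguished triangle. -/
def HasCones (𝒮 : TriangleStructure S) : Prop :=
  ∀ ⦃X Y : S⦄ (f : X ⟶ Y), ∃ (Z : S) (g : Y ⟶ Z) (h : Z ⟶ 𝒮.shift.obj X), 𝒮.distinguished f g h

section Mathlib

variable (T : Type u) [Category.{v} T] [Preadditive T] [Limits.HasZeroObject T]
  [HasShift T ℤ] [∀ n : ℤ, (shiftFunctor T n).Additive] [Pretriangulated T]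

variable {T} in
lemma distTriang_of_iso {X Y Z X' Y' Z' : T} {f : X ⟶ Y} {g : Y ⟶ Z} {h : Z ⟶ X⟦(1 : ℤ)⟧}
    {f' : X' ⟶ Y'} {g' : Y' ⟶ Z'} {h' : Z' ⟶ X'⟦(1 : ℤ)⟧} (H : Triangle.mk f' g' h' ∈ distTriang T)
    (a : X ≅ X') (b : Y ≅ Y') (c : Z ≅ Z') (h₁ : f ≫ b.hom = a.hom ≫ f')
    (h₂ : g ≫ c.hom = b.hom ≫ g') (h₃ : h ≫ a.hom⟦(1 : ℤ)⟧' = c.hom ≫ h') :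
    Triangle.mk f g h ∈ distTriang T :=
  isomorphic_distinguished _ H _ (Triangle.isoMk (Triangle.mk f g h) (Triangle.mk f' g' h')
    a b c h₁ h₂ h₃)

variable {T} in
lemma distTriang_of_iso₃ {X Y Z Z' : T} {f : X ⟶ Y} {g : Y ⟶ Z} {h : Z ⟶ X⟦(1 : ℤ)⟧}
    {g' : Y ⟶ Z'} {h' : Z' ⟶ X⟦(1 : ℤ)⟧} (H : Triangle.mk f g' h' ∈ distTriang T)
    (c : Z ≅ Z') (h₂ : g ≫ c.hom = g') (h₃ : h = c.hom ≫ h') :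
    Triangle.mk f g h ∈ distTriang T :=
  distTriang_of_iso H (Iso.refl _) (Iso.refl _) c (by simp) (by simpa using h₂) (by simpa using h₃)

lemma isoClosed_ofPretriangulated : (ofPretriangulated T).IsoClosed :=
  fun _ _ _ _ _ _ f g h _ _ _ a b c h₁ h₂ h₃ H =>
    distTriang_of_iso (f := f) (g := g) (h := h) H a b c h₁ h₂ h₃

lemma conesUnique_ofPretriangulated : (ofPretriangulated T).ConesUnique := by
  intro X Y Z X' Y' Z' f g h f' g' h' a b H H' comm
  let e := isoTriangleOfIso₁₂ (Triangle.mk f g h) (Triangle.mk f' g' h') H H' a b comm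
  have e₁ : e.hom.hom₁ = a.hom := isoTriangleOfIso₁₂_hom_hom₁ _ _ _ _ _ _ _
  have e₂ : e.hom.hom₂ = b.hom := isoTriangleOfIso₁₂_hom_hom₂ _ _ _ _ _ _ _
  refine ⟨Triangle.π₃.mapIso e, ?_, ?_⟩
  · rw [← e₂]
    exact e.hom.comm₂
  · rw [← e₁]
    exact e.hom.comm₃

lemma hasCones_ofPretriangulated : (ofPretriangulated T).HasCones :=
  fun _ _ f => distinguished_cocone_triangle f

end Mathlib

lemma IsExact.comp {𝒮 : TriangleStructure S} {𝒮' : TriangleStructure S'}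
    {𝒮'' : TriangleStructure S''} {G : S ⥤ S'} {G' : S' ⥤ S''} (hG : 𝒮.IsExact 𝒮' G)
    (hG' : 𝒮'.IsExact 𝒮'' G') : 𝒮.IsExact 𝒮'' (G ⋙ G') := by
  obtain ⟨η, hη⟩ := hG
  obtain ⟨η', hη'⟩ := hG'
  refine ⟨Functor.isoWhiskerRight η G' ≪≫ Functor.isoWhiskerLeft G η', ?_⟩
  intro X Y Z f g h H
  have := hη' _ _ _ (hη f g h H)
  rw [G'.map_comp, Category.assoc] at this
  exact this

lemma IsExact.of_iso {𝒮 : TriangleStructure S} {𝒮' : TriangleStructure S'} {G G' : S ⥤ S'}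
    (hG : 𝒮.IsExact 𝒮' G) (e : G ≅ G') (h𝒮' : 𝒮'.IsoClosed) : 𝒮.IsExact 𝒮' G' := by
  obtain ⟨η, hη⟩ := hG
  refine ⟨Functor.isoWhiskerLeft _ e.symm ≪≫ η ≪≫ Functor.isoWhiskerRight e _, ?_⟩
  intro X Y Z f g h H
  refine h𝒮' _ _ _ _ _ _ (e.symm.app _) (e.symm.app _) (e.symm.app _) ?_ ?_ ?_ (hη f g h H)
  · exact e.inv.naturality f
  · exact e.inv.naturality g
  · have h₁ := e.inv.naturality h
    have h₂ : 𝒮'.shift.map (e.hom.app X) ≫ 𝒮'.shift.map (e.inv.app X) = 𝟙 _ := by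
      rw [← CategoryTheory.Functor.map_comp, Iso.hom_inv_id_app, CategoryTheory.Functor.map_id]
    change (G'.map h ≫ e.inv.app _ ≫ η.hom.app X ≫ 𝒮'.shift.map (e.hom.app X)) ≫
      𝒮'.shift.map (e.inv.app X) = e.inv.app Z ≫ _
    simp only [Category.assoc, h₂]
    erw [Category.comp_id]
    rw [reassoc_of% h₁]

/-- Fully faithful exact functors reflect exactness of functors. -/
lemma IsExact.of_comp {𝒮 : TriangleStructure S''} {𝒮' : TriangleStructure S'}
    {𝒯 : TriangleStructure S} {E : S'' ⥤ S} {Ψ : S ⥤ S'} [Ψ.Full] [Ψ.Faithful]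
    (hΨ : 𝒯.IsExact 𝒮' Ψ) (h𝒯 : 𝒯.IsoClosed) (h𝒯' : 𝒯.HasCones) (h𝒮' : 𝒮'.ConesUnique)
    (hE : 𝒮.IsExact 𝒮' (E ⋙ Ψ)) : 𝒮.IsExact 𝒯 E := by
  obtain ⟨η, hη⟩ := hΨ
  obtain ⟨ζ, hζ⟩ := hE
  let α : (𝒮.shift ⋙ E) ⋙ Ψ ≅ (E ⋙ 𝒯.shift) ⋙ Ψ :=
    ζ ≪≫ Functor.isoWhiskerLeft E η.symm
  let θ : 𝒮.shift ⋙ E ≅ E ⋙ 𝒯.shift :=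
    ((Functor.FullyFaithful.ofFullyFaithful Ψ).whiskeringRight S'').preimageIso α
  have hθ (X : S'') : Ψ.map (θ.hom.app X) = ζ.hom.app X ≫ η.inv.app (E.obj X) :=
    Ψ.map_preimage _
  refine ⟨θ, ?_⟩
  intro X Y Z f g h H
  -- A cone of `E.map f` is formed in the target. Its image under `Ψ` and the image of the given
  -- triangle are distinguished with the same first morphism, so uniqueness of cones gives an
  -- isomorphism, which lifts through `Ψ`.
  obtain ⟨W, g₁, h₁, H₁⟩ := h𝒯' (E.map f)
  obtain ⟨c, hc, hc'⟩ := h𝒮' _ _ _ _ _ _ (Iso.refl _) (Iso.refl _) (hζ f g h H)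
    (hη (E.map f) g₁ h₁ H₁) (by simp)
  have hc₁ : Ψ.map (E.map g) ≫ c.hom = Ψ.map g₁ := hc.trans (Category.id_comp _)
  have hc₂ : Ψ.map (E.map h) ≫ ζ.hom.app X = c.hom ≫ Ψ.map h₁ ≫ η.hom.app (E.obj X) := by
    rw [← hc', Iso.refl_hom, CategoryTheory.Functor.map_id, Category.comp_id]
    rfl
  refine h𝒯 _ _ _ _ _ _ (Iso.refl _) (Iso.refl _) (Ψ.preimageIso c) ?_ ?_ ?_ H₁
  · simp
  · exact Ψ.map_injective (by simpa using hc₁)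
  · apply Ψ.map_injective
    rw [CategoryTheory.Functor.map_comp, CategoryTheory.Functor.map_comp,
      CategoryTheory.Functor.map_comp, hθ, Iso.refl_hom, CategoryTheory.Functor.map_id,
      CategoryTheory.Functor.map_id, Category.comp_id, reassoc_of% hc₂]
    simp

section

universe v₀ u₀

variable {T : Type u₀} [Category.{v₀} T] [Preadditive T] [Limits.HasZeroObject T]
  [HasShift T ℤ] [∀ n : ℤ, (shiftFunctor T n).Additive] [Pretriangulated T]

/-- A quasi-inverse of an exact equivalence is exact. -/
lemma IsExact.inv {𝒮 : TriangleStructure S} {E : S ⥤ T} [E.IsEquivalence]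
    (hE : 𝒮.IsExact (ofPretriangulated T) E) (h𝒮 : 𝒮.IsoClosed)
    (hcone : 𝒮.HasCones) :
    (ofPretriangulated T).IsExact 𝒮 E.inv := by
  obtain ⟨η, hη⟩ : ∃ η : 𝒮.shift ⋙ E ≅ E ⋙ shiftFunctor T (1 : ℤ),
      ∀ {X Y Z : S} (f : X ⟶ Y) (g : Y ⟶ Z) (h : Z ⟶ 𝒮.shift.obj X),
        𝒮.distinguished f g h →
          Triangle.mk (E.map f) (E.map g) (E.map h ≫ η.hom.app X) ∈ distTriang T := hE
  let e := E.asEquivalence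
  let α : (shiftFunctor T (1 : ℤ) ⋙ E.inv) ⋙ E ≅ (E.inv ⋙ 𝒮.shift) ⋙ E :=
    Functor.isoWhiskerLeft (shiftFunctor T (1 : ℤ)) e.counitIso ≪≫
      Functor.isoWhiskerRight e.counitIso.symm (shiftFunctor T (1 : ℤ)) ≪≫
      Functor.isoWhiskerLeft E.inv η.symm
  let θ : shiftFunctor T (1 : ℤ) ⋙ E.inv ≅ E.inv ⋙ 𝒮.shift :=
    ((Functor.FullyFaithful.ofFullyFaithful E).whiskeringRight T).preimageIso α
  let ε (X : T) : E.obj (E.inv.obj X) ≅ X := e.counitIso.app X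
  have hθ (X : T) : E.map (θ.hom.app X) = (ε _).hom ≫ (ε X).inv⟦(1 : ℤ)⟧' ≫
      η.inv.app (E.inv.obj X) := E.map_preimage _
  have nat {X Y : T} (f : X ⟶ Y) : E.map (E.inv.map f) ≫ (ε Y).hom = (ε X).hom ≫ f :=
    e.counit.naturality f
  refine ⟨θ, ?_⟩
  intro X Y Z f g (h : Z ⟶ X⟦(1 : ℤ)⟧) H
  -- The comparison now takes place in `T`: a cone formed in `S` is sent by `E` to a triangle with
  -- the same first morphism as the given one, up to the counit.
  obtain ⟨W, g₁, h₁, H₁⟩ := hcone (E.inv.map f)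
  obtain ⟨c, hc, hc'⟩ : ∃ c : Z ≅ E.obj W, g ≫ c.hom = (ε Y).inv ≫ E.map g₁ ∧
      h ≫ (ε X).inv⟦(1 : ℤ)⟧' = c.hom ≫ E.map h₁ ≫ η.hom.app (E.inv.obj X) :=
    conesUnique_ofPretriangulated T _ _ _ _ _ _ (ε X).symm (ε Y).symm H
      (hη (E.inv.map f) g₁ h₁ H₁) (e.counitInv.naturality f)
  refine h𝒮 _ _ _ _ _ _ (Iso.refl _) (Iso.refl _)
    (E.preimageIso (ε Z ≪≫ c)) ?_ ?_ ?_ H₁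
  · simp
  · apply E.map_injective
    have := nat g
    rw [E.map_comp, E.preimageIso_hom, E.map_preimage, Iso.trans_hom, reassoc_of% this, hc,
      Iso.hom_inv_id_assoc, Iso.refl_hom, Category.id_comp]
  · apply E.map_injective
    have := nat h
    have h₂ : c.hom ≫ E.map h₁ = h ≫ (ε X).inv⟦(1 : ℤ)⟧' ≫ η.inv.app _ := by
      rw [reassoc_of% hc', Iso.hom_inv_id_app]
      exact congrArg _ (Category.comp_id _).symm
    rw [Iso.refl_hom, CategoryTheory.Functor.map_id, Category.comp_id]
    refine (E.map_comp (E.inv.map h) (θ.hom.app X)).trans ?_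
    rw [E.map_comp, E.preimageIso_hom, E.map_preimage, Iso.trans_hom, Category.assoc, h₂, hθ,
      reassoc_of% this]

/-- By fullness a morphism between objects of the image comes from `T`, where it has a cone;
uniqueness of cones identifies the image of this cone with the given one. Closure under desuspension
uses that the shift of the target reflects isomorphisms between objects, being fully faithful. -/
lemma IsExact.isTriangulatedSubcategory_essImage [Preadditive S'] {𝒮' : TriangleStructure S'}
    {Ψ : T ⥤ S'} [Ψ.Full] [Ψ.Additive] (hΨ : (ofPretriangulated T).IsExact 𝒮' Ψ)
    (h𝒮' : 𝒮'.ConesUnique) [𝒮'.shift.Full] [𝒮'.shift.Faithful] :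
    𝒮'.IsTriangulatedSubcategory Ψ.essImage := by
  obtain ⟨η, hη⟩ : ∃ η : shiftFunctor T (1 : ℤ) ⋙ Ψ ≅ Ψ ⋙ 𝒮'.shift,
      ∀ {X Y Z : T} (f : X ⟶ Y) (g : Y ⟶ Z) (h : Z ⟶ X⟦(1 : ℤ)⟧),
        Triangle.mk f g h ∈ distTriang T →
        𝒮'.distinguished (Ψ.map f) (Ψ.map g) (Ψ.map h ≫ η.hom.app X) := hΨ
  refine ⟨?_, fun e h => Functor.essImage.ofIso e h, ?_, ?_⟩
  · obtain ⟨Z, hZ⟩ := Limits.HasZeroObject.zero (C := T)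
    exact ⟨Ψ.obj Z, Functor.map_isZero Ψ hZ, Ψ.obj_mem_essImage Z⟩
  · intro X
    constructor
    · rintro ⟨t, ⟨e⟩⟩
      exact ⟨t⟦(-1 : ℤ)⟧, ⟨𝒮'.shift.preimageIso ((η.app (t⟦(-1 : ℤ)⟧)).symm ≪≫
        Ψ.mapIso ((shiftEquiv T (1 : ℤ)).counitIso.app t) ≪≫ e)⟩⟩
    · rintro ⟨t, ⟨e⟩⟩
      exact ⟨t⟦(1 : ℤ)⟧, ⟨η.app t ≪≫ 𝒮'.shift.mapIso e⟩⟩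
  · rintro X Y Z f g h H ⟨t, ⟨a⟩⟩ ⟨t', ⟨b⟩⟩
    obtain ⟨W, g₁, h₁, H₁⟩ := distinguished_cocone_triangle (Ψ.preimage (a.hom ≫ f ≫ b.inv))
    obtain ⟨c, -, -⟩ := h𝒮' _ _ _ _ _ _ a b (hη _ _ _ H₁) H (by simp)
    exact ⟨W, ⟨c⟩⟩

end

lemma isExact_induced (𝒮' : TriangleStructure S') (Φ : S ⥤ S') [Φ.Full] [Φ.Faithful]
    (h : 𝒮'.IsTriangulatedSubcategory Φ.essImage) :
    (𝒮'.induced Φ h).IsExact 𝒮' Φ :=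
  ⟨Functor.essImage.liftFunctorCompIso (Φ ⋙ 𝒮'.shift) Φ _, fun _ _ _ H => H⟩

/-! ### A criterion for a fully faithful functor to preserve a distinguished triangle. -/

section FullyFaithfulCriterion

open Pretriangulated

variable {T : Type u} [Category.{v} T] [Preadditive T] [Limits.HasZeroObject T]
  [HasShift T ℤ] [∀ n : ℤ, (shiftFunctor T n).Additive] [Pretriangulated T]
  {S : Type u'} [Category.{v'} S] [Preadditive S] [Limits.HasZeroObject S]
  [HasShift S ℤ] [∀ n : ℤ, (shiftFunctor S n).Additive] [Pretriangulated S]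

/-- A fully faithful functor which commutes with the shift sends a distinguished triangle to a
distinguished triangle as soon as there is a suitable morphism from the cone of the image of its
first morphism. -/
lemma distTriang_map_of_fullyFaithful (G : T ⥤ S) [G.Full] [G.Faithful] [G.Additive]
    (η : shiftFunctor T (1 : ℤ) ⋙ G ≅ G ⋙ shiftFunctor S (1 : ℤ)) {X Y Z : T} {f : X ⟶ Y}
    {g : Y ⟶ Z} {h : Z ⟶ X⟦(1 : ℤ)⟧} (H : Triangle.mk f g h ∈ distTriang T) {V : S}
    {u : G.obj Y ⟶ V} {d : V ⟶ (G.obj X)⟦(1 : ℤ)⟧} (HV : Triangle.mk (G.map f) u d ∈ distTriang S)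
    (c : V ⟶ G.obj Z) (hc₁ : u ≫ c = G.map g) (hc₂ : c ≫ G.map h ≫ η.hom.app X = d) :
    Triangle.mk (G.map f) (G.map g) (G.map h ≫ η.hom.app X) ∈ distTriang S := by
  let e (X : T) : G.obj (X⟦(1 : ℤ)⟧) ≅ (G.obj X)⟦(1 : ℤ)⟧ := η.app X
  have he {X Y : T} (f : X ⟶ Y) : G.map (f⟦(1 : ℤ)⟧') ≫ (e Y).hom = (e X).hom ≫ (G.map f)⟦1⟧' :=
    η.hom.naturality f
  replace hc₂ : c ≫ G.map h ≫ (e X).hom = d := hc₂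
  have gf : f ≫ g = 0 := comp_distTriang_mor_zero₁₂ _ H
  have hf : h ≫ f⟦(1 : ℤ)⟧' = 0 := comp_distTriang_mor_zero₃₁ _ H
  have fu : G.map f ≫ u = 0 := comp_distTriang_mor_zero₁₂ _ HV
  have df : d ≫ (G.map f)⟦(1 : ℤ)⟧' = 0 := comp_distTriang_mor_zero₃₁ _ HV
  -- This and `surj` are the two halves of the five lemma for morphisms out of `G.obj W`:
  -- composition with `c` is bijective on such morphisms.
  have inj {W : T} (a : G.obj W ⟶ V) (ha : a ≫ c = 0) : a = 0 := by
    obtain ⟨b, rfl⟩ : ∃ b, a = b ≫ u := Triangle.coyoneda_exact₃ _ HV a (by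
      change a ≫ d = 0
      rw [← hc₂, reassoc_of% ha, Limits.zero_comp])
    obtain ⟨b, rfl⟩ := G.map_surjective b
    rw [Category.assoc, hc₁, ← G.map_comp] at ha
    obtain ⟨k, rfl⟩ : ∃ k, b = k ≫ f :=
      Triangle.coyoneda_exact₂ _ H b (G.map_injective (ha.trans (G.map_zero _ _).symm))
    rw [G.map_comp, Category.assoc, fu, Limits.comp_zero]
  have surj {W : T} (a : G.obj W ⟶ G.obj Z) : ∃ b, b ≫ c = a := by
    obtain ⟨a, rfl⟩ := G.map_surjective a
    obtain ⟨b, hb⟩ : ∃ b, G.map (a ≫ h) ≫ (e X).hom = b ≫ d :=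
      Triangle.coyoneda_exact₁ _ HV (G.map (a ≫ h) ≫ (e X).hom) (by
        change (G.map (a ≫ h) ≫ (e X).hom) ≫ (G.map f)⟦(1 : ℤ)⟧' = 0
        rw [Category.assoc, ← he, ← G.map_comp_assoc, Category.assoc, hf, Limits.comp_zero,
          G.map_zero, Limits.zero_comp])
    obtain ⟨b', hb'⟩ := G.map_surjective (b ≫ c - G.map a)
    obtain ⟨k, hk⟩ : ∃ k, b' = k ≫ g := Triangle.coyoneda_exact₃ _ H b' (by
      change b' ≫ h = 0
      apply G.map_injective
      rw [← cancel_mono (e X).hom, G.map_comp, hb', G.map_zero, Limits.zero_comp,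
        Preadditive.sub_comp, Preadditive.sub_comp, ← G.map_comp, hb, ← hc₂]
      simp)
    refine ⟨b - G.map k ≫ u, ?_⟩
    rw [Preadditive.sub_comp, Category.assoc, hc₁, ← G.map_comp, ← hk, hb', sub_sub_cancel]
  obtain ⟨s, hs⟩ := surj (𝟙 (G.obj Z))
  -- `V` is not known to be in the image of `G`, so the Yoneda lemma is not enough. The error `c ≫ s
  -- - 𝟙 V` vanishes after `u`, hence equals `d ≫ a` for some `a`. Since `d ≫ a ≫ c = 0`, the
  -- morphism `a ≫ c` factors through `(G.map f)⟦1⟧'`. The source and target of the latter are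
  -- isomorphic to images of `G`, so `inj` and `surj` show that `a` itself factors through it, and
  -- `d` kills it.
  have hcs : c ≫ s = 𝟙 V := by
    obtain ⟨a, ha⟩ : ∃ a, c ≫ s - 𝟙 V = d ≫ a := Triangle.yoneda_exact₃ _ HV (c ≫ s - 𝟙 V) (by
      change u ≫ (c ≫ s - 𝟙 V) = 0
      rw [Preadditive.comp_sub, reassoc_of% hc₁, Category.comp_id, sub_eq_zero]
      rw [← sub_eq_zero]
      refine inj _ ?_
      rw [Preadditive.sub_comp, Category.assoc, hs, hc₁, Category.comp_id, sub_self])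
    have hda : d ≫ a ≫ c = 0 := by
      rw [← reassoc_of% ha, Preadditive.sub_comp, Category.assoc, hs, Category.comp_id,
        Category.id_comp, sub_self]
    obtain ⟨b, hb⟩ : ∃ b, a ≫ c = (G.map f)⟦(1 : ℤ)⟧' ≫ b := by
      obtain ⟨b, hb⟩ : ∃ b, a ≫ c = (-(G.map f)⟦(1 : ℤ)⟧') ≫ b :=
        Triangle.yoneda_exact₃ _ (rot_of_distTriang _ HV) (a ≫ c) hda
      exact ⟨-b, by simpa using hb⟩
    obtain ⟨b', hb'⟩ := surj ((e Y).hom ≫ b)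
    have : (e X).hom ≫ a = (e X).hom ≫ (G.map f)⟦(1 : ℤ)⟧' ≫ (e Y).inv ≫ b' := by
      rw [← sub_eq_zero]
      refine inj _ ?_
      simp only [Preadditive.sub_comp, Category.assoc, hb, hb', Iso.inv_hom_id_assoc, sub_self]
    rw [cancel_epi] at this
    rw [← sub_eq_zero, ha, this, reassoc_of% df, Limits.zero_comp]
  exact distTriang_of_iso₃ HV ⟨s, c, hs, hcs⟩ (by
    rw [← hc₁, Category.assoc, hcs, Category.comp_id]) (by
    rw [← hc₂, reassoc_of% hs]
    rfl)

end FullyFaithfulCriterion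

end TriangleStructure

/-! ### Cones and shifts in a dg category, given by equations that every dg functor preserves. -/

namespace DGCategory

variable {K : Type w} [CommRing K] {D : Type u} [DGCategory.{w, v} K D]

lemma comp_neg {X Y Z : D} {n m p : ℤ} (h : n + m = p) (g : DGHom K Y Z n) (f : DGHom K X Y m) :
    comp h g (-f) = -comp h g f := map_neg _ _

lemma neg_comp {X Y Z : D} {n m p : ℤ} (h : n + m = p) (g : DGHom K Y Z n) (f : DGHom K X Y m) :
    comp h (-g) f = -comp h g f := LinearMap.map_neg₂ _ _ _

lemma comp_add {X Y Z : D} {n m p : ℤ} (h : n + m = p) (g : DGHom K Y Z n)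
    (f f' : DGHom K X Y m) : comp h g (f + f') = comp h g f + comp h g f' := map_add _ _ _

lemma add_comp {X Y Z : D} {n m p : ℤ} (h : n + m = p) (g g' : DGHom K Y Z n)
    (f : DGHom K X Y m) : comp h (g + g') f = comp h g f + comp h g' f := LinearMap.map_add₂ _ _ _ _

lemma comp_zero {X Y : D} (Z : D) {n m p : ℤ} (h : n + m = p) (g : DGHom K Y Z n) :
    comp h g (0 : DGHom K X Y m) = 0 := map_zero _

lemma zero_comp (X : D) {Y Z : D} {n m p : ℤ} (h : n + m = p) (f : DGHom K X Y m) :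
    comp h (0 : DGHom K Y Z n) f = 0 := LinearMap.map_zero₂ _ _

variable {X Y Z X' : D}

/-- The data exhibiting `Z` as a cone of a closed morphism of degree `0`. -/
structure ConeData (φ : closedHom (K := K) X Y) (Z : D) where
  inl : DGHom K X Z (-1)
  inr : DGHom K Y Z 0
  fst : DGHom K Z X 1
  snd : DGHom K Z Y 0
  d_inl : d (neg_add_cancel 1) inl = comp (add_zero 0) inr φ.1
  d_inr : d (zero_add 1) inr = 0
  d_fst : d one_add_one_eq_two fst = 0
  d_snd : d (zero_add 1) snd = -comp (zero_add 1) φ.1 fst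
  fst_inl : comp (add_neg_cancel 1) fst inl = id X
  snd_inl : comp (zero_add (-1)) snd inl = 0
  fst_inr : comp (add_zero 1) fst inr = 0
  snd_inr : comp (add_zero 0) snd inr = id Y
  total : comp (neg_add_cancel 1) inl fst + comp (add_zero 0) inr snd = id Z

variable (K) in
/-- The data exhibiting `X'` as the shift of `X`. -/
structure ShiftData (X X' : D) where
  σ : DGHom K X X' (-1)
  τ : DGHom K X' X 1
  d_σ : d (neg_add_cancel 1) σ = 0
  d_τ : d one_add_one_eq_two τ = 0
  τ_σ : comp (add_neg_cancel 1) τ σ = id X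
  σ_τ : comp (neg_add_cancel 1) σ τ = id X'

namespace ConeData

variable {φ : closedHom (K := K) X Y} (c : ConeData φ Z)

/-- The inclusion of the target in the cone. -/
def inrHom : closedHom (K := K) Y Z := ⟨c.inr, c.d_inr⟩

/-- The connecting morphism of a cone. -/
def delta (s : ShiftData K X X') : closedHom (K := K) Z X' :=
  ⟨-comp (neg_add_cancel 1) s.σ c.fst, by
    change d (zero_add 1) _ = 0
    rw [map_neg, d_comp (neg_add_cancel 1) (zero_add 1) (neg_add_cancel 1) one_add_one_eq_two
      (zero_add 1) (by norm_num), s.d_σ, c.d_fst, comp_zero, zero_comp, smul_zero, add_zero,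
      neg_zero]⟩

/-- The comparison of two cones. -/
def compare {Z' : D} (c' : ConeData φ Z') : closedHom (K := K) Z Z' :=
  ⟨comp (neg_add_cancel 1) c'.inl c.fst + comp (add_zero 0) c'.inr c.snd, by
    change d (zero_add 1) _ = 0
    rw [map_add, d_comp (neg_add_cancel 1) (zero_add 1) (neg_add_cancel 1) one_add_one_eq_two
      (zero_add 1) (by norm_num), d_comp (add_zero 0) (zero_add 1) (zero_add 1) (zero_add 1)
      (add_zero 1) (zero_add 1), c.d_fst, comp_zero, smul_zero, add_zero, c'.d_inl, c'.d_inr,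
      c.d_snd, zero_comp, zero_add, Int.negOnePow_zero, one_smul, comp_neg,
      assoc (add_zero 0) (zero_add 1) (zero_add 1) (zero_add 1), add_neg_cancel]⟩

lemma compare_inr {Z' : D} (c' : ConeData φ Z') :
    comp (add_zero 0) (c.compare c').1 c.inr = c'.inr := by
  change comp (add_zero 0) (comp (neg_add_cancel 1) c'.inl c.fst +
    comp (add_zero 0) c'.inr c.snd) c.inr = _
  rw [add_comp, assoc _ (add_zero 1) _ (by norm_num), c.fst_inr, comp_zero, zero_add,
    assoc _ (add_zero 0) _ (by norm_num), c.snd_inr, comp_id]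

lemma compare_inl {Z' : D} (c' : ConeData φ Z') :
    comp (zero_add (-1)) (c.compare c').1 c.inl = c'.inl := by
  change comp (zero_add (-1)) (comp (neg_add_cancel 1) c'.inl c.fst +
    comp (add_zero 0) c'.inr c.snd) c.inl = _
  rw [add_comp, assoc _ (add_neg_cancel 1) _ (by norm_num), c.fst_inl, comp_id,
    assoc _ (zero_add (-1)) _ (by norm_num), c.snd_inl, comp_zero, add_zero]

lemma fst_compare {Z' : D} (c' : ConeData φ Z') :
    comp (add_zero 1) c'.fst (c.compare c').1 = c.fst := by
  change comp (add_zero 1) c'.fst (comp (neg_add_cancel 1) c'.inl c.fst +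
    comp (add_zero 0) c'.inr c.snd) = _
  rw [comp_add, ← assoc (add_neg_cancel 1) (neg_add_cancel 1) (zero_add 1), c'.fst_inl, id_comp,
    ← assoc (add_zero 1) _ (by norm_num), c'.fst_inr, zero_comp, add_zero]

lemma compare_compare {Z' : D} (c' : ConeData φ Z') :
    comp (add_zero 0) (c'.compare c).1 (c.compare c').1 = id Z := by
  change comp (add_zero 0) (c'.compare c).1 (comp (neg_add_cancel 1) c'.inl c.fst +
    comp (add_zero 0) c'.inr c.snd) = _
  rw [comp_add, ← assoc (zero_add (-1)) (neg_add_cancel 1) (by norm_num),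
    ← assoc (add_zero 0) (add_zero 0) (by norm_num), compare_inl, compare_inr, c.total]

end ConeData

/-- The comparison of two shifts. -/
def ShiftData.compare {X'' : D} (s : ShiftData K X X') (s' : ShiftData K X X'') :
    closedHom (K := K) X' X'' :=
  ⟨comp (neg_add_cancel 1) s'.σ s.τ, by
    change d (zero_add 1) _ = 0
    rw [d_comp (neg_add_cancel 1) (zero_add 1) (neg_add_cancel 1) one_add_one_eq_two
      (zero_add 1) (by norm_num), s'.d_σ, s.d_τ]
    simp [comp_zero]⟩

lemma ShiftData.compare_compare {X'' : D} (s : ShiftData K X X') (s' : ShiftData K X X'') :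
    comp (add_zero 0) (s'.compare s).1 (s.compare s').1 = id X' := by
  change comp _ (comp _ s.σ s'.τ) (comp _ s'.σ s.τ) = _
  rw [assoc (neg_add_cancel 1) (add_zero 1) _ (neg_add_cancel 1),
    ← assoc (add_neg_cancel 1) (neg_add_cancel 1) (zero_add 1) (add_zero 1), s'.τ_σ, id_comp,
    s.σ_τ]

end DGCategory

namespace DGFunctor

open DGCategory

variable {K : Type w} [CommRing K] {C : Type u} [DGCategory.{w, v} K C]
  {D : Type u'} [DGCategory.{w, v'} K D] (F : DGFunctor K C D)

/-- The image of a closed morphism by a dg functor. -/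
def mapClosed {X Y : C} (f : closedHom (K := K) X Y) : closedHom (K := K) (F.obj X) (F.obj Y) :=
  ⟨F.map 0 f.1, by
    have hf : d (zero_add 1) f.1 = 0 := f.2
    change d (zero_add 1) _ = 0
    rw [← F.map_d, hf, map_zero]⟩

/-- Dg functors preserve cones. -/
def mapCone {X Y Z : C} {φ : closedHom (K := K) X Y} (c : ConeData φ Z) :
    ConeData (F.mapClosed φ) (F.obj Z) where
  inl := F.map _ c.inl
  inr := F.map _ c.inr
  fst := F.map _ c.fst
  snd := F.map _ c.snd
  d_inl := by rw [← F.map_d, c.d_inl]; exact F.map_comp _ _ _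
  d_inr := by rw [← F.map_d, c.d_inr, map_zero]
  d_fst := by rw [← F.map_d, c.d_fst, map_zero]
  d_snd := by rw [← F.map_d, c.d_snd, map_neg]; exact congrArg _ (F.map_comp _ _ _)
  fst_inl := by rw [← F.map_comp, c.fst_inl, F.map_id]
  snd_inl := by rw [← F.map_comp, c.snd_inl, map_zero]
  fst_inr := by rw [← F.map_comp, c.fst_inr, map_zero]
  snd_inr := by rw [← F.map_comp, c.snd_inr, F.map_id]
  total := by rw [← F.map_comp, ← F.map_comp, ← map_add, c.total, F.map_id]

/-- Dg functors preserve shifts. -/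
def mapShift {X X' : C} (s : ShiftData K X X') : ShiftData K (F.obj X) (F.obj X') where
  σ := F.map _ s.σ
  τ := F.map _ s.τ
  d_σ := by rw [← F.map_d, s.d_σ, map_zero]
  d_τ := by rw [← F.map_d, s.d_τ, map_zero]
  τ_σ := by rw [← F.map_comp, s.τ_σ, F.map_id]
  σ_τ := by rw [← F.map_comp, s.σ_τ, F.map_id]

instance : F.mapH0.Additive where
  map_add {X Y f g} := by
    obtain ⟨f, rfl⟩ := (Quotient.functor _).map_surjective f
    obtain ⟨g, rfl⟩ := (Quotient.functor _).map_surjective g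
    exact congrArg (Quotient.functor (homotopyRel K D)).map
        (Subtype.ext (map_add (F.map 0) f.1 g.1))

instance : F.mapH0.Linear K where
  map_smul {X Y} f r := by
    obtain ⟨f, rfl⟩ := (Quotient.functor _).map_surjective f
    exact congrArg (Quotient.functor (homotopyRel K D)).map (Subtype.ext (map_smul (F.map 0) r f.1))

end DGFunctor

/-! ### The homotopy category of complexes as H⁰ of the dg category of complexes. -/

section Complexes

open DGCategory CochainComplex CochainComplex.HomComplex

variable (K : Type w) [CommRing K] {A : Type u} [Category.{v} A] [Preadditive A] [Linear K A]

/-- A morphism of complexes, as a closed morphism of degree `0`. -/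
def homClosed {X Y : CochainComplex A ℤ} (f : X ⟶ Y) : closedHom (K := K) X Y :=
  ⟨Cochain.ofHom f, δ_ofHom f⟩

variable {K} in
/-- The morphism of complexes corresponding to a closed morphism of degree `0`. -/
def closedToHom {X Y : CochainComplex A ℤ} (f : closedHom (K := K) X Y) : X ⟶ Y :=
  Cocycle.homOf (Cocycle.mk f.1 1 (zero_add 1) f.2)

variable {K} in
lemma ofHom_closedToHom {X Y : CochainComplex A ℤ} (f : closedHom (K := K) X Y) :
    Cochain.ofHom (closedToHom f) = f.1 :=
  Cocycle.cochain_ofHom_homOf_eq_coe _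

variable {K} in
lemma homClosed_closedToHom {X Y : CochainComplex A ℤ} (f : closedHom (K := K) X Y) :
    homClosed K (closedToHom f) = f :=
  Subtype.ext (ofHom_closedToHom f)

lemma closedToHom_homClosed {X Y : CochainComplex A ℤ} (f : X ⟶ Y) :
    closedToHom (homClosed K f) = f :=
  Cocycle.homOf_ofHom_eq_self f

variable (A) in
/-- The functor from the underlying category of the dg category of complexes to the homotopy
category. -/
def z0ToHomotopyCategory :
    Z0 K (CochainComplex A ℤ) ⥤ HomotopyCategory A (ComplexShape.up ℤ) where
  obj X := (HomotopyCategory.quotient A _).obj X.obj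
  map {X Y} f := (HomotopyCategory.quotient A _).map (closedToHom f)
  map_id X := by
    rw [← CategoryTheory.Functor.map_id]
    exact congrArg _ (closedToHom_homClosed K (𝟙 X.obj))
  map_comp {X Y Z} f g := by
    rw [← CategoryTheory.Functor.map_comp]
    congr 1
    apply Cochain.ofHom_injective
    rw [Cochain.ofHom_comp, ofHom_closedToHom, ofHom_closedToHom, ofHom_closedToHom]
    rfl

lemma homotopyRel_iff {X Y : Z0 K (CochainComplex A ℤ)} (f g : X ⟶ Y) :
    homotopyRel K _ f g ↔ (z0ToHomotopyCategory K A).map f = (z0ToHomotopyCategory K A).map g := by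
  constructor
  · rintro ⟨h, hh⟩
    refine HomotopyCategory.eq_of_homotopy _ _ ((Cochain.equivHomotopy _ _).symm ⟨h, ?_⟩)
    rw [ofHom_closedToHom, ofHom_closedToHom, ← sub_eq_iff_eq_add]
    exact hh
  · intro H
    obtain ⟨h, hh⟩ := Cochain.equivHomotopy _ _ (HomotopyCategory.homotopyOfEq _ _ H)
    rw [ofHom_closedToHom, ofHom_closedToHom, ← sub_eq_iff_eq_add] at hh
    exact ⟨h, hh⟩

variable (A) in
/-- The functor from the homotopy category of the dg category of complexes to the homotopy
category of complexes. -/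
def h0ToHomotopyCategory :
    H0 K (CochainComplex A ℤ) ⥤ HomotopyCategory A (ComplexShape.up ℤ) :=
  CategoryTheory.Quotient.lift _ (z0ToHomotopyCategory K A)
    (fun _ _ f g h => (homotopyRel_iff K f g).1 h)

instance : (h0ToHomotopyCategory K A).Full where
  map_surjective {X Y} f := by
    obtain ⟨f, rfl⟩ := (HomotopyCategory.quotient A _).map_surjective f
    exact ⟨homToH0 (homClosed K f), congrArg _ (closedToHom_homClosed K f)⟩

instance : (h0ToHomotopyCategory K A).Faithful where
  map_injective {X Y} f g h := by
    obtain ⟨f, rfl⟩ := (Quotient.functor _).map_surjective f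
    obtain ⟨g, rfl⟩ := (Quotient.functor _).map_surjective g
    exact CategoryTheory.Quotient.sound _ ((homotopyRel_iff K f g).2 h)

instance : (h0ToHomotopyCategory K A).Additive where
  map_add {X Y f g} := by
    obtain ⟨f, rfl⟩ := (Quotient.functor _).map_surjective f
    obtain ⟨g, rfl⟩ := (Quotient.functor _).map_surjective g
    refine Eq.trans ?_ ((HomotopyCategory.quotient A _).map_add (f := closedToHom f)
      (g := closedToHom g))
    refine congrArg (HomotopyCategory.quotient A _).map ?_
    apply Cochain.ofHom_injective
    rw [Cochain.ofHom_add, ofHom_closedToHom, ofHom_closedToHom, ofHom_closedToHom]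
    rfl

instance : (h0ToHomotopyCategory K A).Linear K where
  map_smul {X Y} f r := by
    obtain ⟨f, rfl⟩ := (Quotient.functor _).map_surjective f
    refine Eq.trans ?_ ((HomotopyCategory.quotient A _).map_smul r (closedToHom f))
    refine congrArg (HomotopyCategory.quotient A _).map ?_
    ext n
    rfl

end Complexes

/-! ### Abstract cones and shifts of complexes compared with the standard ones. -/

section ComplexesCone

open DGCategory CochainComplex CochainComplex.HomComplex Pretriangulated

variable (K : Type w) [CommRing K] {A : Type u} [Category.{v} A] [Preadditive A] [Linear K A]

/-- The shift of a complex is its shift in the dg category of complexes. -/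
def complexShiftData (X : CochainComplex A ℤ) : ShiftData K X (X⟦(1 : ℤ)⟧) where
  σ := (Cochain.ofHom (𝟙 X)).rightShift 1 (-1) (neg_add_cancel 1)
  τ := (Cochain.ofHom (𝟙 (X⟦(1 : ℤ)⟧))).rightUnshift 1 (zero_add 1)
  d_σ := by
    change δ (-1) 0 _ = 0
    rw [Cochain.δ_rightShift _ 1 (-1) 0 _ 1 (zero_add 1), δ_ofHom, Cochain.rightShift_zero,
      smul_zero]
  d_τ := by
    change δ 1 2 _ = 0
    rw [Cochain.δ_rightUnshift _ 1 (zero_add 1) 2 1 one_add_one_eq_two, δ_ofHom,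
      Cochain.rightUnshift_zero, smul_zero]
  τ_σ := by
    change Cochain.comp ((Cochain.ofHom (𝟙 X)).rightShift 1 (-1) (neg_add_cancel 1))
      ((Cochain.ofHom (𝟙 (X⟦(1 : ℤ)⟧))).rightUnshift 1 (zero_add 1)) (neg_add_cancel 1) =
      Cochain.ofHom (𝟙 X)
    ext p
    rw [Cochain.comp_v _ _ _ p (p + (-1)) p rfl (by lia),
      Cochain.rightShift_v _ 1 (-1) _ p (p + (-1)) rfl p (by lia),
      Cochain.rightUnshift_v _ _ _ (p + (-1)) p (by lia) (p + (-1)) (by lia)]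
    rw [Cochain.ofHom_v, Cochain.ofHom_v]
    erw [Category.id_comp, Category.id_comp, Iso.inv_hom_id]
    rfl
  σ_τ := by
    change Cochain.comp ((Cochain.ofHom (𝟙 (X⟦(1 : ℤ)⟧))).rightUnshift 1 (zero_add 1))
      ((Cochain.ofHom (𝟙 X)).rightShift 1 (-1) (neg_add_cancel 1)) (add_neg_cancel 1) =
      Cochain.ofHom (𝟙 (X⟦(1 : ℤ)⟧))
    ext p
    rw [Cochain.comp_v _ _ _ p (p + 1) p rfl (by lia),
      Cochain.rightShift_v _ 1 (-1) _ (p + 1) p (by lia) (p + 1) (by lia),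
      Cochain.rightUnshift_v _ _ _ p (p + 1) rfl p (by lia)]
    rw [Cochain.ofHom_v, Cochain.ofHom_v]
    erw [Category.id_comp, Category.id_comp]
    rfl

variable {K}

lemma closedToHom_closedComp {X Y Z : CochainComplex A ℤ} (g : closedHom (K := K) Y Z)
    (f : closedHom (K := K) X Y) :
    closedToHom (closedComp g f) = closedToHom f ≫ closedToHom g := by
  apply Cochain.ofHom_injective
  rw [Cochain.ofHom_comp, ofHom_closedToHom, ofHom_closedToHom, ofHom_closedToHom]
  rfl

lemma closedToHom_id (X : CochainComplex A ℤ) :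
    closedToHom (K := K) (⟨DGCategory.id X, d_id _ _⟩ : closedHom X X) = 𝟙 X :=
  closedToHom_homClosed K (𝟙 X)

/-- The isomorphism between two cones of the same morphism of complexes. -/
@[simps]
def coneIso {X Y Z Z' : CochainComplex A ℤ} {φ : closedHom (K := K) X Y} (c : ConeData φ Z)
    (c' : ConeData φ Z') : Z ≅ Z' where
  hom := closedToHom (c.compare c')
  inv := closedToHom (c'.compare c)
  hom_inv_id := by
    rw [← closedToHom_closedComp, ← closedToHom_id (K := K)]
    exact congrArg _ (Subtype.ext (c.compare_compare c'))
  inv_hom_id := by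
    rw [← closedToHom_closedComp, ← closedToHom_id (K := K)]
    exact congrArg _ (Subtype.ext (c'.compare_compare c))

/-- The comparison of a shift of a complex with the standard one. -/
def DGCategory.ShiftData.isoShift {X X' : CochainComplex A ℤ} (s : ShiftData K X X') :
    X' ≅ X⟦(1 : ℤ)⟧ where
  hom := closedToHom (s.compare (complexShiftData K X))
  inv := closedToHom ((complexShiftData K X).compare s)
  hom_inv_id := by
    rw [← closedToHom_closedComp, ← closedToHom_id (K := K)]
    exact congrArg _ (Subtype.ext (s.compare_compare _))
  inv_hom_id := by
    rw [← closedToHom_closedComp, ← closedToHom_id (K := K)]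
    exact congrArg _ (Subtype.ext ((complexShiftData K X).compare_compare s))

variable (K)

variable [Limits.HasBinaryBiproducts A]

/-- The mapping cone of a morphism of complexes is a cone in the dg category of complexes. -/
noncomputable def mappingConeData {X Y : CochainComplex A ℤ} (φ : closedHom (K := K) X Y) :
    ConeData φ (mappingCone (closedToHom φ)) where
  inl := mappingCone.inl _
  inr := Cochain.ofHom (mappingCone.inr _)
  fst := (mappingCone.fst _).1
  snd := mappingCone.snd _
  d_inl := by
    refine (mappingCone.δ_inl _).trans ?_
    rw [Cochain.ofHom_comp, ofHom_closedToHom]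
    rfl
  d_inr := δ_ofHom _
  d_fst := (mappingCone.fst _).δ_eq_zero 2
  d_snd := by
    refine (mappingCone.δ_snd _).trans ?_
    rw [ofHom_closedToHom]
    rfl
  fst_inl := mappingCone.inl_fst _
  snd_inl := mappingCone.inl_snd _
  fst_inr := mappingCone.inr_fst _
  snd_inr := mappingCone.inr_snd _
  total := mappingCone.id _

variable {K}

/-- The minus sign in `ConeData.delta` is the one carried by `coneProj`, so abstract cones yield the
standard mapping cone triangles without any correction. -/
lemma mappingConeData_delta {X Y : CochainComplex A ℤ} (φ : closedHom (K := K) X Y) :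
    (mappingConeData K φ).delta (complexShiftData K X) =
      homClosed K (coneProj (closedToHom φ)) := by
  refine Subtype.ext ?_
  change -((mappingCone.fst (closedToHom φ)).1.comp
    ((Cochain.ofHom (𝟙 X)).rightShift 1 (-1) (neg_add_cancel 1)) (add_neg_cancel 1)) =
      Cochain.ofHom (coneProj (closedToHom φ))
  refine cone_ext (add_zero (-1)) ?_ ?_
  · rw [inl_coneProj, Cochain.comp_neg, mappingCone.inl_fst_assoc]
  · rw [inr_coneProj, Cochain.comp_neg, mappingCone.inr_fst_assoc, neg_zero]

variable [Limits.HasZeroObject A]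

/-- The shift of a complex is compatible with the shift in the homotopy category. -/
noncomputable def DGCategory.ShiftData.isoShiftQuotient {X X' : CochainComplex A ℤ}
    (s : ShiftData K X X') :
    (HomotopyCategory.quotient A (ComplexShape.up ℤ)).obj X' ≅
      ((HomotopyCategory.quotient A (ComplexShape.up ℤ)).obj X)⟦(1 : ℤ)⟧ :=
  (HomotopyCategory.quotient A _).mapIso s.isoShift ≪≫
    ((HomotopyCategory.quotient A (ComplexShape.up ℤ)).commShiftIso (1 : ℤ)).app X

lemma distTriang_mappingCone {X Y : CochainComplex A ℤ} (φ : X ⟶ Y) :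
    Triangle.mk ((HomotopyCategory.quotient A _).map φ)
      ((HomotopyCategory.quotient A _).map (mappingCone.inr φ))
      ((HomotopyCategory.quotient A (ComplexShape.up ℤ)).map (coneProj φ) ≫
        ((HomotopyCategory.quotient A (ComplexShape.up ℤ)).commShiftIso (1 : ℤ)).hom.app X) ∈
      distTriang (HomotopyCategory A (ComplexShape.up ℤ)) :=
  HomotopyCategory.mappingCone_triangleh_distinguished φ

/-- The triangle attached to a cone in the dg category of complexes is distinguished. -/
lemma DGCategory.ConeData.distTriang {X Y Z X' : CochainComplex A ℤ} {φ : closedHom (K := K) X Y}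
    (c : ConeData φ Z) (s : ShiftData K X X') :
    Triangle.mk ((HomotopyCategory.quotient A _).map (closedToHom φ))
      ((HomotopyCategory.quotient A _).map (closedToHom c.inrHom))
      ((HomotopyCategory.quotient A (ComplexShape.up ℤ)).map (closedToHom (c.delta s)) ≫
        s.isoShiftQuotient.hom) ∈ distTriang (HomotopyCategory A (ComplexShape.up ℤ)) := by
  -- Two cones of one morphism are isomorphic as complexes by `ConeData.compare`, so the mapping
  -- cone triangle can be transported.
  refine TriangleStructure.distTriang_of_iso₃
    (distTriang_mappingCone (closedToHom φ))
    ((HomotopyCategory.quotient A _).mapIso (coneIso c (mappingConeData K φ))) ?_ ?_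
  · rw [Functor.mapIso_hom, coneIso_hom, ← CategoryTheory.Functor.map_comp,
      ← closedToHom_closedComp]
    refine congrArg (HomotopyCategory.quotient A _).map ?_
    apply Cochain.ofHom_injective
    rw [ofHom_closedToHom]
    exact c.compare_inr (mappingConeData K φ)
  · change _ ≫ (HomotopyCategory.quotient A (ComplexShape.up ℤ)).map _ ≫
      ((HomotopyCategory.quotient A (ComplexShape.up ℤ)).commShiftIso (1 : ℤ)).hom.app X = _
    rw [← Functor.map_comp_assoc, Functor.mapIso_hom, coneIso_hom, ← Functor.map_comp_assoc]
    refine congrArg (fun t => (HomotopyCategory.quotient A (ComplexShape.up ℤ)).map t ≫ _) ?_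
    change closedToHom _ ≫ closedToHom _ = closedToHom _ ≫ _
    rw [← closedToHom_homClosed K (coneProj (closedToHom φ)), ← mappingConeData_delta,
      ← closedToHom_closedComp, ← closedToHom_closedComp]
    refine congrArg _ (Subtype.ext ?_)
    change comp _ (comp _ (complexShiftData K X).σ s.τ) (-comp _ s.σ c.fst) =
      comp _ (-comp _ (complexShiftData K X).σ _) _
    rw [comp_neg, neg_comp, assoc (neg_add_cancel 1) (add_zero 1) _ (neg_add_cancel 1),
      assoc (neg_add_cancel 1) (add_zero 1) _ (neg_add_cancel 1), c.fst_compare,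
      ← assoc (add_neg_cancel 1) (neg_add_cancel 1) (zero_add 1) (add_zero 1), s.τ_σ, id_comp]

end ComplexesCone

/-! ### Objectwise cones and shifts in the dg category of dg functors. -/

section DGFunShift

open DGCategory CochainComplex CochainComplex.HomComplex

variable {K : Type w} [CommRing K] {C : Type u} [DGCategory.{w, v} K C]
  {A : Type u'} [Category.{v'} A] [Preadditive A] [Linear K A]

lemma rightShift_id_comp_shift {X Y : CochainComplex A ℤ} {n k : ℤ} (f : Cochain X Y n)
    (h : -1 + n = k) (h' : n + -1 = k) :
    ((complexShiftData K X).σ : Cochain X (X⟦(1 : ℤ)⟧) (-1)).comp (f.shift 1) h =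
      f.comp ((complexShiftData K Y).σ : Cochain Y (Y⟦(1 : ℤ)⟧) (-1)) h' :=
  (rightShift_comp_shift f h' h).symm

/-- Since `τ` is inverse to `σ`, this is the naturality of `σ` composed with `τ` on both sides. -/
lemma shift_comp_rightUnshift_id {X Y : CochainComplex A ℤ} {n k : ℤ} (f : Cochain X Y n)
    (h : n + 1 = k) (h' : 1 + n = k) :
    (f.shift 1).comp ((complexShiftData K Y).τ : Cochain (Y⟦(1 : ℤ)⟧) Y 1) h =
      ((complexShiftData K X).τ : Cochain (X⟦(1 : ℤ)⟧) X 1).comp f h' := by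
  have h₁ : ((complexShiftData K X).τ : Cochain (X⟦(1 : ℤ)⟧) X 1).comp
      ((complexShiftData K X).σ : Cochain X (X⟦(1 : ℤ)⟧) (-1)) (add_neg_cancel 1) =
      Cochain.ofHom (𝟙 _) := (complexShiftData K X).σ_τ
  have h₂ : ((complexShiftData K Y).σ : Cochain Y (Y⟦(1 : ℤ)⟧) (-1)).comp
      ((complexShiftData K Y).τ : Cochain (Y⟦(1 : ℤ)⟧) Y 1) (neg_add_cancel 1) =
      Cochain.ofHom (𝟙 _) := (complexShiftData K Y).τ_σ
  have h₃ := rightShift_id_comp_shift (K := K) f (k := n - 1) (by lia) (by lia)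
  rw [← Cochain.id_comp (f.shift 1), ← h₁, Cochain.comp_assoc _ _ _ (add_neg_cancel 1)
    (by lia : -1 + n = n - 1) (by lia), h₃, Cochain.comp_assoc _ _ _ (by lia : 1 + (n - 1) = n)
    (by lia : n - 1 + 1 = n) (by lia), Cochain.comp_assoc _ _ _ (by lia : n + -1 = n - 1)
      (neg_add_cancel 1) (by lia), h₂,
    Cochain.comp_id]

/-- The objectwise shift of dg functors is a shift in the dg category of dg functors. -/
def dgFunShiftData (F : DGFunctor K C (CochainComplex A ℤ)) :
    ShiftData K F (F.compose (shiftDG K A)) where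
  σ := ⟨fun X => (complexShiftData K (F.obj X)).σ, by
    intro X Y m p h h' f
    change ((F.map m f : Cochain _ _ m).comp
      ((complexShiftData K (F.obj Y)).σ : Cochain _ _ (-1)) h' : Cochain _ _ p) =
      (-1 * m).negOnePow • ((complexShiftData K (F.obj X)).σ : Cochain _ _ (-1)).comp
        (m.negOnePow • (F.map m f : Cochain _ _ m).shift 1) h
    -- The sign `(-1) ^ m` in `shiftDG` cancels the Koszul sign in the naturality of a
    -- transformation of degree `-1`.
    rw [Cochain.comp_units_smul, rightShift_id_comp_shift, smul_smul, ← Int.negOnePow_add,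
      Int.negOnePow_even, one_smul]
    exact ⟨0, by ring⟩⟩
  τ := ⟨fun X => (complexShiftData K (F.obj X)).τ, by
    intro X Y m p h h' f
    change Cochain.comp (m.negOnePow • (F.map m f : Cochain _ _ m).shift 1)
      ((complexShiftData K (F.obj Y)).τ : Cochain _ _ 1) h' =
      (1 * m).negOnePow • ((complexShiftData K (F.obj X)).τ : Cochain _ _ 1).comp
        (F.map m f : Cochain _ _ m) h
    rw [Cochain.units_smul_comp, shift_comp_rightUnshift_id, one_mul]⟩
  d_σ := Subtype.ext (funext fun X => (complexShiftData K (F.obj X)).d_σ)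
  d_τ := Subtype.ext (funext fun X => (complexShiftData K (F.obj X)).d_τ)
  τ_σ := Subtype.ext (funext fun X => (complexShiftData K (F.obj X)).τ_σ)
  σ_τ := Subtype.ext (funext fun X => (complexShiftData K (F.obj X)).σ_τ)

variable {F G : DGFunctor K C (CochainComplex A ℤ)}

/-- The component of a closed natural transformation. -/
def closedComponent (φ : closedHom (K := K) F G) (X : C) : closedHom (K := K) (F.obj X) (G.obj X) :=
  ⟨φ.1.1 X, congrFun (congrArg Subtype.val φ.2) X⟩

lemma dgFunShiftData_naturality (φ : closedHom (K := K) F G) :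
    comp (zero_add (-1)) ((DGFunctor.postcompose (shiftDG K A)).mapClosed φ).1
      (dgFunShiftData F).σ = comp (add_zero (-1)) (dgFunShiftData G).σ φ.1 := by
  refine Subtype.ext (funext fun X => ?_)
  change Cochain.comp ((complexShiftData K (F.obj X)).σ : Cochain _ _ (-1))
    ((0 : ℤ).negOnePow • (φ.1.1 X : Cochain _ _ 0).shift 1) (by lia) =
    Cochain.comp (φ.1.1 X : Cochain _ _ 0) ((complexShiftData K (G.obj X)).σ : Cochain _ _ (-1))
      (zero_add (-1))
  rw [Int.negOnePow_zero, one_smul]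
  exact rightShift_id_comp_shift _ _ _

variable [Limits.HasBinaryBiproducts A]

lemma coneMap_fst (φ : closedHom (K := K) F G) {X Y : C} {m p : ℤ} (f : DGHom K X Y m)
    (h : m + 1 = p) (h' : 1 + m = p) :
    (coneMap φ m f).comp (mappingCone.fst (componentHom φ Y)).1 h =
      m.negOnePow • (mappingCone.fst (componentHom φ X)).1.comp (F.map m f : Cochain _ _ m) h' := by
  refine cone_ext (k := m) (by lia) ?_ ?_
  · rw [← Cochain.comp_assoc _ _ _ (rfl : -1 + m = -1 + m) h (by lia),
      inl_coneMap φ f _ (by lia), Cochain.units_smul_comp, Cochain.comp_assoc _ _ _ _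
      (neg_add_cancel 1) (by lia), mappingCone.inl_fst, Cochain.comp_id, Cochain.comp_units_smul,
      mappingCone.inl_fst_assoc]
  · rw [← Cochain.comp_assoc _ _ _ (zero_add m) h (by lia), inr_coneMap,
      Cochain.comp_assoc_of_second_is_zero_cochain, mappingCone.inr_fst, Cochain.comp_zero,
      Cochain.comp_units_smul, mappingCone.inr_fst_assoc, smul_zero]

lemma coneMap_snd (φ : closedHom (K := K) F G) {X Y : C} {m : ℤ} (f : DGHom K X Y m) :
    (coneMap φ m f).comp (mappingCone.snd (componentHom φ Y)) (add_zero m) =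
      (mappingCone.snd (componentHom φ X)).comp (G.map m f : Cochain _ _ m) (zero_add m) := by
  refine cone_ext (rfl : -1 + m = -1 + m) ?_ ?_
  · rw [← Cochain.comp_assoc_of_third_is_zero_cochain, inl_coneMap φ f _ (by lia),
      Cochain.units_smul_comp, Cochain.comp_assoc_of_third_is_zero_cochain, mappingCone.inl_snd,
      Cochain.comp_zero, smul_zero, mappingCone.inl_snd_assoc]
  · rw [← Cochain.comp_assoc_of_third_is_zero_cochain, inr_coneMap,
      Cochain.comp_assoc_of_third_is_zero_cochain, mappingCone.inr_snd, Cochain.comp_id,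
      mappingCone.inr_snd_assoc]

/-- The objectwise cone is a cone in the dg category of dg functors. -/
noncomputable def dgFunConeData (φ : closedHom (K := K) F G) : ConeData φ (coneDG φ) where
  inl := ⟨fun X => (mappingConeData K (closedComponent φ X)).inl, by
    intro X Y m p h h' f
    change Cochain.comp (F.map m f) (mappingCone.inl (componentHom φ Y)) h' =
      (-1 * m).negOnePow • (mappingCone.inl (componentHom φ X)).comp (coneMap φ m f) h
    rw [inl_coneMap φ f h h', smul_smul, ← Int.negOnePow_add, Int.negOnePow_even, one_smul]
    exact ⟨0, by ring⟩⟩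
  inr := (coneInr φ).1
  fst := ⟨fun X => (mappingConeData K (closedComponent φ X)).fst, by
    intro X Y m p h h' f
    rw [one_mul]
    exact coneMap_fst φ f h' h⟩
  snd := ⟨fun X => (mappingConeData K (closedComponent φ X)).snd, by
    intro X Y m p h h' f
    obtain rfl : m = p := by lia
    rw [zero_mul, Int.negOnePow_zero, one_smul]
    exact coneMap_snd φ f⟩
  d_inl := Subtype.ext (funext fun X => (mappingConeData K (closedComponent φ X)).d_inl)
  d_inr := (coneInr φ).2
  d_fst := Subtype.ext (funext fun X => (mappingConeData K (closedComponent φ X)).d_fst)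
  d_snd := Subtype.ext (funext fun X => (mappingConeData K (closedComponent φ X)).d_snd)
  fst_inl := Subtype.ext (funext fun X => (mappingConeData K (closedComponent φ X)).fst_inl)
  snd_inl := Subtype.ext (funext fun X => (mappingConeData K (closedComponent φ X)).snd_inl)
  fst_inr := Subtype.ext (funext fun X => (mappingConeData K (closedComponent φ X)).fst_inr)
  snd_inr := Subtype.ext (funext fun X => (mappingConeData K (closedComponent φ X)).snd_inr)
  total := Subtype.ext (funext fun X => (mappingConeData K (closedComponent φ X)).total)

lemma dgFunConeData_delta (φ : closedHom (K := K) F G) :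
    (dgFunConeData φ).delta (dgFunShiftData F) = coneDelta φ :=
  Subtype.ext (Subtype.ext (funext fun X =>
    congrArg Subtype.val (mappingConeData_delta (closedComponent φ X))))

end DGFunShift

/-! ### Dg functors from dg functors to complexes induce exact functors. -/

section Exactness

open DGCategory CochainComplex CochainComplex.HomComplex Pretriangulated

variable {K : Type w} [CommRing K]

section

variable {A : Type u'} [Category.{v'} A] [Preadditive A] [Linear K A]

lemma complexShiftData_naturality {X Y : CochainComplex A ℤ} (f : X ⟶ Y) :
    comp (zero_add (-1)) (homClosed K (f⟦(1 : ℤ)⟧')).1 (complexShiftData K X).σ =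
      comp (add_zero (-1)) (complexShiftData K Y).σ (homClosed K f).1 := by
  refine Eq.trans ?_ (rightShift_id_comp_shift (K := K) (Cochain.ofHom f) (add_zero (-1))
    (zero_add (-1)))
  change Cochain.comp _ (Cochain.ofHom (f⟦(1 : ℤ)⟧')) (add_zero (-1)) = _
  congr 1
  ext p
  rw [Cochain.shift_v']
  rfl

/-- The hypothesis expresses that `f'` is the shift of `f`: as `σ` and `τ` are inverse to each
other, it forces `f' = σ₂ f τ₁`, and the middle factors cancel in the comparison with the standard
shift. -/
lemma isoShift_naturality {X₁ X₂ X₁' X₂' : CochainComplex A ℤ} (s₁ : ShiftData K X₁ X₁')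
    (s₂ : ShiftData K X₂ X₂') (f : closedHom (K := K) X₁ X₂) (f' : closedHom (K := K) X₁' X₂')
    (hf : comp (zero_add (-1)) f'.1 s₁.σ = comp (add_zero (-1)) s₂.σ f.1) :
    closedToHom f' ≫ s₂.isoShift.hom = s₁.isoShift.hom ≫ (closedToHom f)⟦(1 : ℤ)⟧' := by
  change closedToHom f' ≫ closedToHom (s₂.compare (complexShiftData K X₂)) =
    closedToHom (s₁.compare (complexShiftData K X₁)) ≫ _
  rw [← closedToHom_homClosed K ((closedToHom f)⟦(1 : ℤ)⟧'), ← closedToHom_closedComp,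
    ← closedToHom_closedComp]
  refine congrArg _ (Subtype.ext ?_)
  change comp _ (comp _ (complexShiftData K X₂).σ s₂.τ) f'.1 =
    comp _ (homClosed K ((closedToHom f)⟦(1 : ℤ)⟧')).1 (comp _ (complexShiftData K X₁).σ s₁.τ)
  have h₁ : f'.1 = comp (neg_add_cancel 1) (comp (add_zero (-1)) s₂.σ f.1) s₁.τ := by
    rw [← hf, assoc (zero_add (-1)) (neg_add_cancel 1) _ (add_zero 0), s₁.σ_τ, comp_id]
  rw [← assoc (zero_add (-1)) (neg_add_cancel 1) (neg_add_cancel 1),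
    complexShiftData_naturality, homClosed_closedToHom, h₁,
    assoc (neg_add_cancel 1) (add_zero 1) _ (neg_add_cancel 1),
    ← assoc (m := -1) (add_neg_cancel 1) (neg_add_cancel 1) (zero_add 1) (add_zero 1),
    ← assoc (add_neg_cancel 1) (add_zero (-1)) (add_zero 0) (add_neg_cancel 1), s₂.τ_σ, id_comp,
    assoc (add_zero (-1)) (zero_add 1) (neg_add_cancel 1) (neg_add_cancel 1)]

lemma isoShiftQuotient_naturality {X₁ X₂ X₁' X₂' : CochainComplex A ℤ} (s₁ : ShiftData K X₁ X₁')
    (s₂ : ShiftData K X₂ X₂') (f : closedHom (K := K) X₁ X₂) (f' : closedHom (K := K) X₁' X₂')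
    (hf : comp (zero_add (-1)) f'.1 s₁.σ = comp (add_zero (-1)) s₂.σ f.1) :
    (HomotopyCategory.quotient A (ComplexShape.up ℤ)).map (closedToHom f') ≫
        s₂.isoShiftQuotient.hom = s₁.isoShiftQuotient.hom ≫
      ((HomotopyCategory.quotient A (ComplexShape.up ℤ)).map (closedToHom f))⟦(1 : ℤ)⟧' := by
  have h := isoShift_naturality s₁ s₂ f f' hf
  have h' := ((HomotopyCategory.quotient A (ComplexShape.up ℤ)).commShiftIso
    (1 : ℤ)).hom.naturality (closedToHom f)
  change _ ≫ (HomotopyCategory.quotient A (ComplexShape.up ℤ)).map s₂.isoShift.hom ≫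
    ((HomotopyCategory.quotient A (ComplexShape.up ℤ)).commShiftIso (1 : ℤ)).hom.app X₂ =
    ((HomotopyCategory.quotient A (ComplexShape.up ℤ)).map s₁.isoShift.hom ≫
    ((HomotopyCategory.quotient A (ComplexShape.up ℤ)).commShiftIso (1 : ℤ)).hom.app X₁) ≫ _
  rw [← Functor.map_comp_assoc, h, Functor.map_comp_assoc, Category.assoc]
  exact congrArg _ h'

end

variable {C : Type u} [DGCategory.{w, v} K C] {B : Type u'} [Category.{v'} B] [Preadditive B]
  [Linear K B] [Limits.HasBinaryBiproducts B] {A : Type u''} [Category.{v''} A] [Preadditive A]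
  [Linear K A] [Limits.HasBinaryBiproducts A] [Limits.HasZeroObject A]
  (Θ : DGFunctor K (DGFunctor K C (CochainComplex B ℤ)) (CochainComplex A ℤ))

/-- A dg functor from the dg functors with values in complexes to complexes commutes with the
shift. -/
noncomputable def dgFunShiftIso :
    (dgFunTriangles K C B).shift ⋙ Θ.mapH0 ⋙ h0ToHomotopyCategory K A ≅
      (Θ.mapH0 ⋙ h0ToHomotopyCategory K A) ⋙
        shiftFunctor (HomotopyCategory A (ComplexShape.up ℤ)) (1 : ℤ) :=
  NatIso.ofComponents (fun F => (Θ.mapShift (dgFunShiftData F.as.obj)).isoShiftQuotient) (by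
    intro F G f
    obtain ⟨f, rfl⟩ := (Quotient.functor _).map_surjective f
    refine isoShiftQuotient_naturality (Θ.mapShift (dgFunShiftData F.as.obj))
      (Θ.mapShift (dgFunShiftData G.as.obj)) (Θ.mapClosed f)
      (Θ.mapClosed ((DGFunctor.postcompose (shiftDG K B)).mapClosed f)) ?_
    refine (Θ.map_comp _ _ _).symm.trans (Eq.trans ?_ (Θ.map_comp _ _ _))
    exact congrArg _ (dgFunShiftData_naturality f))

/-- Dg functors from the dg functors with values in complexes to complexes are exact on homotopy
categories. -/
lemma isExact_mapH0_dgFun : (dgFunTriangles K C B).IsExact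
    (TriangleStructure.ofPretriangulated (HomotopyCategory A (ComplexShape.up ℤ)))
    (Θ.mapH0 ⋙ h0ToHomotopyCategory K A) := by
  refine ⟨dgFunShiftIso Θ, ?_⟩
  rintro X Y Z f g h ⟨F, G, φ, a, b, c, h₁, h₂, h₃⟩
  let Ψ := Θ.mapH0 ⋙ h0ToHomotopyCategory K A
  refine TriangleStructure.distTriang_of_iso
    ((Θ.mapCone (dgFunConeData φ)).distTriang (Θ.mapShift (dgFunShiftData F)))
    (Ψ.mapIso a) (Ψ.mapIso b) (Ψ.mapIso c) ?_ ?_ ?_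
  · exact (Ψ.map_comp _ _).symm.trans ((congrArg Ψ.map h₁).trans (Ψ.map_comp _ _))
  · exact (Ψ.map_comp _ _).symm.trans ((congrArg Ψ.map h₂).trans (Ψ.map_comp _ _))
  · have h₄ := (Ψ.map_comp _ _).symm.trans ((congrArg Ψ.map h₃).trans (Ψ.map_comp _ _))
    have h₅ := (dgFunShiftIso Θ).hom.naturality a.hom
    -- The connecting morphism is a composition of structural morphisms of the cone and of the
    -- shift, so `Θ` preserves it strictly.
    have h₆ : (Θ.mapCone (dgFunConeData φ)).delta (Θ.mapShift (dgFunShiftData F)) =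
        Θ.mapClosed (coneDelta φ) := by
      rw [← dgFunConeData_delta]
      refine Subtype.ext ?_
      change -comp _ (Θ.map _ _) (Θ.map _ _) = Θ.map 0 (-comp _ _ _)
      rw [map_neg, Θ.map_comp]
    rw [h₆]
    change (Ψ.map h ≫ (dgFunShiftIso Θ).hom.app X) ≫ (Ψ.map a.hom)⟦(1 : ℤ)⟧' =
      Ψ.map c.hom ≫ Ψ.map (homToH0 (coneDelta φ)) ≫ (dgFunShiftIso Θ).hom.app (toH0 K F)
    exact (Category.assoc _ _ _).trans ((congrArg (Ψ.map h ≫ ·) h₅.symm).trans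
      ((Category.assoc _ _ _).symm.trans ((congrArg (· ≫ _) h₄).trans (Category.assoc _ _ _))))

end Exactness

/-! ### Adjoining formal shifts and a formal differential to a dg category. -/

namespace DGCategory

section AdjoinDifferential

variable {K : Type w} [CommRing K] {D : Type u} [DGCategory.{w, v} K D]

/-- The composition of the formal morphisms `g.1 + g.2 δ` and `f.1 + f.2 δ`, where `δ` is a
formal morphism of degree `1` such that `δ² = 0` and the graded commutator of `δ` with a morphism
of the dg category is its differential. -/
def extComp {X Y Z : D} {n m p : ℤ} (h : n + m = p)
    (g : DGHom K Y Z n × DGHom K Y Z (n - 1)) (f : DGHom K X Y m × DGHom K X Y (m - 1)) :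
    DGHom K X Z p × DGHom K X Z (p - 1) :=
  (comp h g.1 f.1 + comp (by lia : n - 1 + (m + 1) = p) g.2 (d rfl f.1),
    comp (by lia : n + (m - 1) = p - 1) g.1 f.2 +
      m.negOnePow • comp (by lia : n - 1 + m = p - 1) g.2 f.1 +
      comp (by lia : n - 1 + m = p - 1) g.2 (d (sub_add_cancel m 1) f.2))

/-- The product is dictated by `δ f = d f + (-1) ^ m f δ` for `f` of degree `m` and by `δ² = 0`.
These relations are consistent because the differential is a graded derivation of square zero, and
exactly these two facts give associativity. -/
lemma extComp_assoc {W X Y Z : D} {n m p nm mp nmp : ℤ} (h₁ : n + m = nm) (h₂ : m + p = mp)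
    (h₃ : nm + p = nmp) (h₄ : n + mp = nmp) (f : DGHom K Y Z n × DGHom K Y Z (n - 1))
    (g : DGHom K X Y m × DGHom K X Y (m - 1)) (k : DGHom K W X p × DGHom K W X (p - 1)) :
    extComp h₃ (extComp h₁ f g) k = extComp h₄ f (extComp h₂ g k) := by
  obtain ⟨f, f'⟩ := f
  obtain ⟨g, g'⟩ := g
  obtain ⟨k, k'⟩ := k
  subst h₁ h₂ h₃
  have e : ((m - 1).negOnePow : ℤˣ) = -m.negOnePow := by
    rw [Int.negOnePow_sub, Int.negOnePow_one, mul_neg, mul_one]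
  refine Prod.ext ?_ ?_
  · simp only [extComp, map_add, LinearMap.add_apply]
    rw [d_comp rfl rfl rfl rfl (by lia) (by lia),
      d_comp (by lia : m - 1 + (p + 1) = m + p) rfl (sub_add_cancel m 1)
        (rfl : p + 1 + 1 = p + 1 + 1) (by lia) (by lia),
      d_d, comp_zero, smul_zero, add_zero, comp_add, comp_units_smul, units_smul_comp,
      assoc rfl rfl rfl h₄,
      assoc (by lia : n - 1 + (m + 1) = n + m) (by lia : m + 1 + p = m + p + 1) rfl (by lia),
      assoc (by lia : n + (m - 1) = n + m - 1) (by lia : m - 1 + (p + 1) = m + p) (by lia) (by lia),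
      assoc (by lia : n - 1 + m = n + m - 1) (by lia : m + (p + 1) = m + p + 1) (by lia) (by lia),
      assoc (by lia : n - 1 + m = n + m - 1) (by lia : m + (p + 1) = m + p + 1) (by lia) (by lia)]
    abel
  · simp only [extComp, map_add, LinearMap.add_apply, smul_add, comp_units_smul, units_smul_comp,
      d_units_smul]
    rw [d_comp (by lia : m + (p - 1) = m + p - 1) (by lia) rfl (sub_add_cancel p 1)
        (by lia : m + 1 + (p - 1) = m + p) (by lia),
      d_comp (by lia : m - 1 + p = m + p - 1) (sub_add_cancel _ 1) (sub_add_cancel m 1) rfl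
        (by lia) (by lia : m - 1 + (p + 1) = m + p),
      d_comp (by lia : m - 1 + p = m + p - 1) (sub_add_cancel _ 1) (sub_add_cancel m 1)
        (rfl : p + 1 = p + 1) (by lia) (by lia : m - 1 + (p + 1) = m + p), d_d]
    simp only [comp_zero, smul_zero, add_zero, comp_add, smul_add, comp_units_smul]
    rw [assoc rfl (by lia : m + (p - 1) = m + p - 1) (by lia) (by lia) f g k',
      assoc (by lia : n - 1 + (m + 1) = n + m) (by lia : m + 1 + (p - 1) = m + p) (by lia)
        (by lia) f' _ k',
      assoc (by lia : n + (m - 1) = n + m - 1) (by lia : m - 1 + p = m + p - 1) (by lia)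
        (by lia) f g' k,
      assoc (by lia : n + (m - 1) = n + m - 1) (by lia : m - 1 + p = m + p - 1) (by lia)
        (by lia) f g' _,
      assoc (by lia : n - 1 + m = n + m - 1) (rfl : m + p = m + p) (by lia) (by lia) f' g k,
      assoc (by lia : n - 1 + m = n + m - 1) (by lia : m + p = m + p) (by lia) (by lia) f' g
        (d _ k'),
      assoc (by lia : n - 1 + m = n + m - 1) (by lia : m + p = m + p) (by lia) (by lia) f' _ k,
      assoc (by lia : n - 1 + m = n + m - 1) (by lia : m + p = m + p) (by lia) (by lia) f' _
        (d _ k')]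
    simp only [e, Units.neg_smul, smul_neg]
    simp only [smul_smul, ← Int.negOnePow_add, add_comm p m]
    abel

lemma extComp_add {X Y Z : D} {n m p : ℤ} (h : n + m = p)
    (g : DGHom K Y Z n × DGHom K Y Z (n - 1)) (f f' : DGHom K X Y m × DGHom K X Y (m - 1)) :
    extComp h g (f + f') = extComp h g f + extComp h g f' := by
  refine Prod.ext ?_ ?_
  · simp only [extComp, Prod.fst_add, map_add]
    abel
  · simp only [extComp, Prod.fst_add, Prod.snd_add, map_add, smul_add]
    abel

lemma add_extComp {X Y Z : D} {n m p : ℤ} (h : n + m = p)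
    (g g' : DGHom K Y Z n × DGHom K Y Z (n - 1)) (f : DGHom K X Y m × DGHom K X Y (m - 1)) :
    extComp h (g + g') f = extComp h g f + extComp h g' f := by
  refine Prod.ext ?_ ?_
  · simp only [extComp, Prod.fst_add, Prod.snd_add, map_add, LinearMap.add_apply]
    abel
  · simp only [extComp, Prod.fst_add, Prod.snd_add, map_add, LinearMap.add_apply, smul_add]
    abel

lemma extComp_smul {X Y Z : D} {n m p : ℤ} (h : n + m = p) (r : K)
    (g : DGHom K Y Z n × DGHom K Y Z (n - 1)) (f : DGHom K X Y m × DGHom K X Y (m - 1)) :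
    extComp h g (r • f) = r • extComp h g f := by
  refine Prod.ext ?_ ?_
  · simp only [extComp, Prod.smul_fst, map_smul, smul_add]
  · simp only [extComp, Prod.smul_fst, Prod.smul_snd, map_smul, smul_add, smul_comm r]

lemma smul_extComp {X Y Z : D} {n m p : ℤ} (h : n + m = p) (r : K)
    (g : DGHom K Y Z n × DGHom K Y Z (n - 1)) (f : DGHom K X Y m × DGHom K X Y (m - 1)) :
    extComp h (r • g) f = r • extComp h g f := by
  refine Prod.ext ?_ ?_
  · simp only [extComp, Prod.smul_fst, Prod.smul_snd, map_smul, LinearMap.smul_apply, smul_add]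
  · simp only [extComp, Prod.smul_fst, Prod.smul_snd, map_smul, LinearMap.smul_apply, smul_add,
      smul_comm r]

/-- An object of the category obtained from a dg category by adjoining formal shifts and a formal
differential. -/
structure ExtObj (K : Type w) [CommRing K] (D : Type u) [DGCategory.{w, v} K D] where
  obj : D
  deg : ℤ

namespace ExtObj

instance : Category (ExtObj K D) where
  Hom X Y := DGHom K X.obj Y.obj (Y.deg - X.deg) × DGHom K X.obj Y.obj (Y.deg - X.deg - 1)
  id X := ((sub_self X.deg).symm ▸ DGCategory.id X.obj, 0)
  comp f g := extComp (sub_add_sub_cancel _ _ _) g f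
  id_comp {X Y} f := by
    -- The identity lives in degree `X.deg - X.deg`, which is `0` only propositionally; generalizing
    -- this degree removes the cast.
    have h : ∀ (n : ℤ) (e : n = 0) (h : (Y.deg - X.deg) + n = Y.deg - X.deg),
        extComp h f ((e.symm ▸ DGCategory.id X.obj : DGHom K X.obj X.obj n), 0) = f := by
      rintro _ rfl h
      ext1 <;> simp [extComp, d_id, comp_id, comp_zero]
    exact h _ (sub_self _) _
  comp_id {X Y} f := by
    have h : ∀ (n : ℤ) (e : n = 0) (h : n + (Y.deg - X.deg) = Y.deg - X.deg),
        extComp h ((e.symm ▸ DGCategory.id Y.obj : DGHom K Y.obj Y.obj n), 0) f = f := by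
      rintro _ rfl h
      ext1 <;> simp [extComp, id_comp]
    exact h _ (sub_self _) _
  assoc f g h := (extComp_assoc _ _ _ _ _ _ _).symm

instance (X Y : ExtObj K D) : AddCommGroup (X ⟶ Y) :=
  inferInstanceAs (AddCommGroup (DGHom K X.obj Y.obj (Y.deg - X.deg) ×
    DGHom K X.obj Y.obj (Y.deg - X.deg - 1)))

instance (X Y : ExtObj K D) : Module K (X ⟶ Y) :=
  inferInstanceAs (Module K (DGHom K X.obj Y.obj (Y.deg - X.deg) ×
    DGHom K X.obj Y.obj (Y.deg - X.deg - 1)))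

instance : Preadditive (ExtObj K D) where
  add_comp _ _ _ f f' g := extComp_add _ g f f'
  comp_add _ _ _ f g g' := add_extComp _ g g' f

instance : Linear K (ExtObj K D) where
  smul_comp _ _ _ r f g := extComp_smul _ r g f
  comp_smul _ _ _ f r g := smul_extComp _ r g f

end ExtObj

end AdjoinDifferential

end DGCategory

/-! ### The additive hull by matrices; families over `Fin n` keep the objects in the original
universe. -/

namespace CategoryTheory

section AddHull

variable (K : Type w) [CommRing K] (C : Type u) [Category.{v} C] [Preadditive C]

/-- The finite families of objects indexed by `Fin n`, with matrices as morphisms. -/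
abbrev AddHull := InducedCategory (Mat_ C)
  (fun S : Σ n : ℕ, Fin n → C => (⟨Fin S.1, S.2⟩ : Mat_ C))

namespace AddHull

variable {C} {D : Type u'} [Category.{v'} D] [Preadditive D]

noncomputable instance [Linear K C] : Linear K (Mat_ C) where
  homModule M N := inferInstanceAs (Module K (∀ i j, M.X i ⟶ N.X j))
  smul_comp M N L r f g := by
    ext i j
    rw [Mat_.comp_apply]
    exact (Finset.sum_congr rfl fun k _ => Linear.smul_comp _ _ _ r (f i k) (g k j)).trans
      (Finset.smul_sum.symm.trans (congrArg (r • ·) (Mat_.comp_apply f g i j).symm))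
  comp_smul M N L f r g := by
    ext i j
    rw [Mat_.comp_apply]
    exact (Finset.sum_congr rfl fun k _ => Linear.comp_smul _ _ _ (f i k) r (g k j)).trans
      (Finset.smul_sum.symm.trans (congrArg (r • ·) (Mat_.comp_apply f g i j).symm))

instance : (inducedFunctor (fun S : Σ n : ℕ, Fin n → C =>
    (⟨Fin S.1, S.2⟩ : Mat_ C))).EssSurj where
  mem_essImage M := by
    classical
    let e := Fintype.equivFin M.ι
    refine ⟨⟨Fintype.card M.ι, fun i => M.X (e.symm i)⟩, ⟨?_⟩⟩
    refine ⟨fun i j => if h : e.symm i = j then eqToHom (congrArg M.X h) else 0,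
      fun i j => if h : i = e.symm j then eqToHom (congrArg M.X h) else 0, ?_, ?_⟩
    · ext i j
      refine (Mat_.comp_apply _ _ _ _).trans ?_
      rw [Finset.sum_eq_single (e.symm i)]
      · by_cases h : i = j
        · subst h
          simp
        · rw [Mat_.id_apply_of_ne _ _ _ h, dif_neg (fun h' => h (e.symm.injective h')),
            Limits.comp_zero]
      · intro k _ hk
        rw [dif_neg hk.symm, Limits.zero_comp]
      · simp
    · ext i j
      refine (Mat_.comp_apply _ _ _ _).trans ?_
      refine (Finset.sum_eq_single (e i) ?_ ?_).trans ?_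
      rotate_left 2
      · by_cases h : i = j
        · subst h
          simp
        · rw [Mat_.id_apply_of_ne _ _ _ h, dif_neg (c := e.symm (e i) = j) (fun h' => h
            ((e.symm_apply_apply i).symm.trans h')), Limits.comp_zero]
      · intro k _ hk
        rw [dif_neg (fun h => hk (by rw [h]; simp)), Limits.zero_comp]
      · simp

instance : (inducedFunctor (fun S : Σ n : ℕ, Fin n → C =>
    (⟨Fin S.1, S.2⟩ : Mat_ C))).IsEquivalence where

instance : Limits.HasFiniteProducts (AddHull C) where
  out _ := Adjunction.hasLimitsOfShape_of_equivalence
    (inducedFunctor (fun S : Σ n : ℕ, Fin n → C => (⟨Fin S.1, S.2⟩ : Mat_ C)))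

instance : Limits.HasFiniteBiproducts (AddHull C) :=
  Limits.HasFiniteBiproducts.of_hasFiniteProducts

instance : Limits.HasBinaryBiproducts (AddHull C) :=
  Limits.hasBinaryBiproducts_of_finite_biproducts _

variable (C) in
/-- The objects of a category, as families with one element. -/
noncomputable def embedding : C ⥤ AddHull C where
  obj X := ⟨1, fun _ => X⟩
  map f := InducedCategory.homMk fun _ _ => f
  map_id X := InducedCategory.hom_ext (by
    ext i j
    obtain rfl : i = j := Subsingleton.elim (α := Fin 1) i j
    exact (Mat_.id_apply_self (⟨Fin 1, fun _ => X⟩ : Mat_ C) _).symm)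
  map_comp f g := InducedCategory.hom_ext (by
    ext i j
    refine Eq.trans ?_ (Mat_.comp_apply _ _ _ _).symm
    exact (Fin.sum_univ_one (fun _ : Fin 1 => f ≫ g)).symm)

instance : (embedding C).Full where
  map_surjective f := ⟨f.hom (0 : Fin 1) (0 : Fin 1), InducedCategory.hom_ext (by
    ext i j
    obtain rfl : i = (0 : Fin 1) := Subsingleton.elim (α := Fin 1) i 0
    obtain rfl : j = (0 : Fin 1) := Subsingleton.elim (α := Fin 1) j 0
    rfl)⟩

instance : (embedding C).Faithful where
  map_injective h := congrFun (congrFun (congrArg InducedCategory.Hom.hom h) (0 : Fin 1))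
      (0 : Fin 1)

instance : (embedding C).Additive where
  map_add := rfl

instance [Linear K C] : (embedding C).Linear K where
  map_smul _ _ := rfl

variable (F : C ⥤ D) [F.Additive]

/-- The functor induced on matrices by an additive functor. -/
noncomputable def map : AddHull C ⥤ AddHull D where
  obj S := ⟨S.1, fun i => F.obj (S.2 i)⟩
  map f := InducedCategory.homMk fun i j => F.map (f.hom i j)
  map_id S := InducedCategory.hom_ext (by
    ext i j
    by_cases h : i = j
    · subst h
      exact (congrArg F.map (Mat_.id_apply_self _ _)).trans ((F.map_id _).trans
        (Mat_.id_apply_self (⟨Fin S.1, fun i => F.obj (S.2 i)⟩ : Mat_ D) _).symm)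
    · exact (congrArg F.map (Mat_.id_apply_of_ne _ _ _ h)).trans ((F.map_zero _ _).trans
        (Mat_.id_apply_of_ne (⟨Fin S.1, fun i => F.obj (S.2 i)⟩ : Mat_ D) _ _ h).symm))
  map_comp f g := InducedCategory.hom_ext (by
    ext i j
    refine Eq.trans ?_ (Mat_.comp_apply _ _ _ _).symm
    exact (congrArg F.map (Mat_.comp_apply _ _ _ _)).trans ((F.map_sum _ _).trans
      (Finset.sum_congr rfl fun k _ => F.map_comp _ _)))

instance : (map F).Additive where
  map_add := InducedCategory.hom_ext (by
    ext i j
    exact F.map_add)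

instance [F.Full] : (map F).Full where
  map_surjective f := ⟨InducedCategory.homMk fun i j => F.preimage (f.hom i j),
    InducedCategory.hom_ext (by
      ext i j
      exact F.map_preimage _)⟩

instance [F.Faithful] : (map F).Faithful where
  map_injective {X Y f g} h := InducedCategory.hom_ext (by
    ext i j
    exact F.map_injective (congrFun (congrFun (congrArg InducedCategory.Hom.hom h) i) j))

end AddHull

end AddHull

end CategoryTheory

/-! ### The formal complex of an object, and its full faithfulness on homotopy categories. -/

namespace DGCategory

open CochainComplex CochainComplex.HomComplex

variable {K : Type w} [CommRing K] {D : Type u} [DGCategory.{w, v} K D]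

namespace ExtObj

/-- The morphism in the category with formal shifts and a formal differential, with given
components. -/
def homMk {X Y : ExtObj K D} {n m : ℤ} (h : Y.deg - X.deg = n) (h' : n - 1 = m)
    (f : DGHom K X.obj Y.obj n) (g : DGHom K X.obj Y.obj m) : X ⟶ Y :=
  by
    subst h h'
    exact (f, g)

variable {X Y Z : ExtObj K D} {n m p n' m' p' : ℤ}

lemma exists_homMk (h : Y.deg - X.deg = n) (h' : n - 1 = n') (φ : X ⟶ Y) :
    ∃ f g, φ = homMk h h' f g := by
  subst h h'
  exact ⟨φ.1, φ.2, rfl⟩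

lemma homMk_inj {h : Y.deg - X.deg = n} {h' : n - 1 = n'} {f f' : DGHom K X.obj Y.obj n}
    {g g' : DGHom K X.obj Y.obj n'} (H : homMk h h' f g = homMk h h' f' g') :
    f = f' ∧ g = g' := by
  subst h h'
  exact ⟨congrArg Prod.fst H, congrArg Prod.snd H⟩

lemma homMk_add (h : Y.deg - X.deg = n) (h' : n - 1 = n') (f f' : DGHom K X.obj Y.obj n)
    (g g' : DGHom K X.obj Y.obj n') :
    homMk h h' (f + f') (g + g') = homMk h h' f g + homMk h h' f' g' := by
  subst h h'
  rfl

lemma homMk_neg (h : Y.deg - X.deg = n) (h' : n - 1 = n') (f : DGHom K X.obj Y.obj n)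
    (g : DGHom K X.obj Y.obj n') : homMk h h' (-f) (-g) = -homMk h h' f g := by
  subst h h'
  rfl

lemma homMk_smul (h : Y.deg - X.deg = n) (h' : n - 1 = n') (r : K) (f : DGHom K X.obj Y.obj n)
    (g : DGHom K X.obj Y.obj n') : homMk h h' (r • f) (r • g) = r • homMk h h' f g := by
  subst h h'
  rfl

lemma homMk_zero (h : Y.deg - X.deg = n) (h' : n - 1 = n') :
    homMk h h' (0 : DGHom K X.obj Y.obj n) 0 = 0 := by
  subst h h'
  rfl

lemma homMk_id (h : X.deg - X.deg = 0) (h' : 0 - 1 = n') :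
    homMk h h' (DGCategory.id X.obj) 0 = 𝟙 X := by
  have key : ∀ (n : ℤ) (e : n = 0) (e' : n - 1 = n') (e'' : X.deg - X.deg = n),
      homMk e'' e' (e.symm ▸ DGCategory.id X.obj : DGHom K X.obj X.obj n) 0 =
        (show X ⟶ X from (((sub_self X.deg).symm ▸ DGCategory.id X.obj :
          DGHom K X.obj X.obj (X.deg - X.deg)), 0)) := by
    rintro n e rfl rfl
    rfl
  exact key 0 rfl h' h

/-- Every degree is a free variable tied to the others by equations, so that composites can be
computed without casts. -/
lemma homMk_comp (hn : Z.deg - Y.deg = n) (hn' : n - 1 = n') (hm : Y.deg - X.deg = m)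
    (hm' : m - 1 = m') (hp : Z.deg - X.deg = p) (hp' : p - 1 = p') (h : n + m = p)
    {m₁ : ℤ} (h₁ : m + 1 = m₁) (h₂ : m' + 1 = m) (h₃ : n' + m₁ = p) (h₄ : n + m' = p')
    (h₅ : n' + m = p')
    (f : DGHom K X.obj Y.obj m) (f' : DGHom K X.obj Y.obj m') (g : DGHom K Y.obj Z.obj n)
    (g' : DGHom K Y.obj Z.obj n') :
    homMk hm hm' f f' ≫ homMk hn hn' g g' =
      homMk hp hp' (comp h g f + comp h₃ g' (d h₁ f))
        (comp h₄ g f' + m.negOnePow • comp h₅ g' f + comp h₅ g' (d h₂ f')) := by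
  subst hn hn' hm hm' hp hp' h₁
  rfl

end ExtObj

open ExtObj

/-- The formal differential. -/
def formalD (X : D) {i j : ℤ} (h : i + 1 = j) : (⟨X, i⟩ : ExtObj K D) ⟶ ⟨X, j⟩ :=
  homMk (n := 1) (m := 0) (by change j - i = 1; lia) rfl 0 (DGCategory.id X)

/-- The commutator rule moves `δ` from the left to the right of `f` and of `f'`; the term `f' δ δ`
vanishes. -/
lemma homMk_formalD {X Y : D} {i j k n n' m : ℤ} (h : k + 1 = j) (hi : k - i = n) (hn : n - 1 = n')
    (hi' : j - i = m) (hm : n + 1 = m) (hm' : m - 1 = n) (hn' : n' + 1 = n)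
    (f : DGHom K X Y n) (f' : DGHom K X Y n') :
    homMk (X := ⟨X, i⟩) (Y := ⟨Y, k⟩) hi hn f f' ≫ formalD Y h =
      homMk (X := ⟨X, i⟩) (Y := ⟨Y, j⟩) hi' hm' (d hm f) (n.negOnePow • f + d hn' f') := by
  unfold formalD
  rw [homMk_comp (X := ⟨X, i⟩) (Y := ⟨Y, k⟩) (Z := ⟨Y, j⟩) _ _ hi hn hi' hm' (by lia) hm hn'
    (by lia) (by lia) (by lia), zero_comp, zero_comp, id_comp, id_comp, id_comp, zero_add, zero_add]

lemma formalD_homMk {X Y : D} {i j k n n' m : ℤ} (h : i + 1 = j) (hi : k - j = n) (hn : n - 1 = n')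
    (hi' : k - i = m) (hm : m - 1 = n) (f : DGHom K X Y n) (f' : DGHom K X Y n') :
    formalD X h ≫ homMk (X := ⟨X, j⟩) (Y := ⟨Y, k⟩) hi hn f f' =
      homMk (X := ⟨X, i⟩) (Y := ⟨Y, k⟩) hi' hm 0 f := by
  unfold formalD
  rw [homMk_comp (X := ⟨X, i⟩) (Y := ⟨X, j⟩) (Z := ⟨Y, k⟩) hi hn _ _ hi' hm (by lia) rfl
    (by lia) (by lia) (by lia) (by lia)]
  simp only [d_id, map_zero, comp_id, smul_zero, add_zero]

/-- The complex `⋯ ⟶ X[n] ⟶ X[n + 1] ⟶ ⋯` given by the formal differential. -/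
def formalComplex (X : D) : CochainComplex (ExtObj K D) ℤ where
  X n := ⟨X, n⟩
  d i j := if h : i + 1 = j then formalD X h else 0
  shape i j h := dif_neg h
  d_comp_d' i j k hij hjk := by
    obtain rfl : i + 1 = j := hij
    obtain rfl : i + 1 + 1 = k := hjk
    rw [dif_pos rfl, dif_pos rfl]
    refine (formalD_homMk (n := 1) (m := 2) _ _ _ (by lia) rfl _ _).trans ?_
    exact homMk_zero _ _

lemma formalComplex_d (X : D) {i j : ℤ} (h : i + 1 = j) :
    (formalComplex (K := K) X).d i j = formalD X h := dif_pos h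

/-- A cochain between formal complexes with given components. -/
def formalCochain {X Y : D} {n m : ℤ} (h : n - 1 = m) (f : ℤ → DGHom K X Y n)
    (g : ℤ → DGHom K X Y m) : Cochain (formalComplex (K := K) X) (formalComplex Y) n :=
  Cochain.mk fun p q hpq => homMk (X := ⟨X, p⟩) (Y := ⟨Y, q⟩) (by change q - p = n; lia) h (f p)
      (g p)

lemma formalCochain_v {X Y : D} {n m : ℤ} (h : n - 1 = m) (f : ℤ → DGHom K X Y n)
    (g : ℤ → DGHom K X Y m) (p q : ℤ) (hpq : p + n = q) (h') :
    (formalCochain h f g).v p q hpq = homMk (X := ⟨X, p⟩) (Y := ⟨Y, q⟩) h' h (f p) (g p) := rfl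

lemma exists_formalCochain {X Y : D} {n m : ℤ} (h : n - 1 = m)
    (φ : Cochain (formalComplex (K := K) X) (formalComplex Y) n) :
    ∃ f g, φ = formalCochain h f g := by
  have H : ∀ p : ℤ, ∃ f g, φ.v p (p + n) rfl = homMk (X := ⟨X, p⟩) (Y := ⟨Y, p + n⟩)
    (by change p + n - p = n; lia) h f g := fun p => exists_homMk _ _ _
  choose f g hfg using H
  refine ⟨f, g, ?_⟩
  ext p q hpq
  subst hpq
  exact hfg p

lemma formalCochain_inj {X Y : D} {n m : ℤ} {h : n - 1 = m} {f f' : ℤ → DGHom K X Y n}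
    {g g' : ℤ → DGHom K X Y m} (H : formalCochain h f g = formalCochain h f' g') :
    f = f' ∧ g = g' := by
  have H' (p : ℤ) := homMk_inj (Cochain.congr_v H p (p + n) rfl)
  exact ⟨funext fun p => (H' p).1, funext fun p => (H' p).2⟩

lemma formalCochain_add {X Y : D} {n m : ℤ} (h : n - 1 = m) (f f' : ℤ → DGHom K X Y n)
    (g g' : ℤ → DGHom K X Y m) : formalCochain h (f + f') (g + g') =
      formalCochain h f g + formalCochain h f' g' :=
  Cochain.ext _ _ fun _ _ _ => homMk_add _ _ _ _ _ _

lemma formalCochain_smul {X Y : D} {n m : ℤ} (h : n - 1 = m) (r : K) (f : ℤ → DGHom K X Y n)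
    (g : ℤ → DGHom K X Y m) : formalCochain h (r • f) (r • g) = r • formalCochain h f g :=
  Cochain.ext _ _ fun _ _ _ => homMk_smul _ _ _ _ _

lemma formalCochain_zero {X Y : D} {n m : ℤ} (h : n - 1 = m) :
    formalCochain h (0 : ℤ → DGHom K X Y n) 0 = 0 :=
  Cochain.ext _ _ fun _ _ _ => homMk_zero _ _

/-- The term `f p` comes from the differential of the target and `f (p + 1)` from that of the
source. In degree `0` a cocycle is thus a sequence of closed morphisms in which `g p` is a homotopy
between `f p` and `f (p + 1)`. This is why only the homotopy class of `f 0` is visible. -/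
lemma δ_formalCochain {X Y : D} {n m l : ℤ} (h : n - 1 = m) (hm : m + 1 = n) (hl : n + 1 = l)
    (hl' : l - 1 = n)
    (f : ℤ → DGHom K X Y n) (g : ℤ → DGHom K X Y m) :
    δ n l (formalCochain h f g) = formalCochain hl' (fun p => d hl (f p))
      (fun p => n.negOnePow • f p + d hm (g p) + l.negOnePow • f (p + 1)) := by
  ext p q hpq
  rw [δ_v n l hl _ p q hpq (q - 1) (p + 1) rfl rfl, formalComplex_d _ (sub_add_cancel q 1),
    formalComplex_d _ rfl, formalCochain_v _ _ _ _ _ _ (by change q - 1 - p = n; lia),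
    formalCochain_v _ _ _ _ _ _ (by change q - (p + 1) = n; lia),
    formalCochain_v _ _ _ _ _ _ (by change q - p = l; lia)]
  have key : (homMk (X := ⟨X, p⟩) (Y := ⟨Y, q - 1⟩) (by change q - 1 - p = n; lia) h (f p) (g p) ≫
      formalD Y (sub_add_cancel q 1) + l.negOnePow • (formalD X rfl ≫ homMk (X := ⟨X, p + 1⟩)
      (Y := ⟨Y, q⟩) (by change q - (p + 1) = n; lia) h (f (p + 1)) (g (p + 1))) :
        (⟨X, p⟩ : ExtObj K D) ⟶ ⟨Y, q⟩) = homMk (by change q - p = l; lia) hl' (d hl (f p))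
          (n.negOnePow • f p + d hm (g p) + l.negOnePow • f (p + 1)) := by
    rw [homMk_formalD _ _ _ (by lia : q - p = l) hl hl' hm,
      formalD_homMk _ _ _ (by lia : q - p = l) hl']
    rcases Int.units_eq_one_or l.negOnePow with h | h <;> rw [h]
    · rw [one_smul, one_smul, ← homMk_add, add_zero]
    · rw [Units.neg_smul, Units.neg_smul, one_smul, one_smul, ← homMk_neg, ← homMk_add, neg_zero,
        add_zero]
  exact key

variable (K D) in
/-- The dg functor sending an object to its formal complex. -/
def formalDG : DGFunctor K D (CochainComplex (ExtObj K D) ℤ) where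
  obj X := formalComplex X
  map {X Y} n :=
    { toFun := fun f => formalCochain rfl (fun _ => f) 0
      map_add' := fun f g => by
        refine Eq.trans ?_ (formalCochain_add _ _ _ _ _)
        rw [add_zero]
        rfl
      map_smul' := fun r f => by
        refine Eq.trans ?_ (formalCochain_smul _ _ _ _)
        rw [smul_zero]
        rfl }
  map_d {X Y n m} h f := by
    change formalCochain rfl (fun _ => d h f) 0 = δ n m (formalCochain rfl (fun _ => f) 0)
    obtain rfl : m - 1 = n := by lia
    rw [δ_formalCochain rfl (sub_add_cancel _ 1) h rfl]
    congr 1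
    funext p
    have : m.negOnePow = -(m - 1).negOnePow := by
      rw [Int.negOnePow_sub, Int.negOnePow_one, mul_neg, mul_one, neg_neg]
    change (0 : DGHom K X Y (m - 1)) = _ + d (sub_add_cancel _ 1) (0 : DGHom K X Y (m - 1 - 1)) + _
    rw [this, Units.neg_smul, map_zero, add_zero, add_neg_cancel]
  map_id X := by
    refine Cochain.ext₀ _ _ fun p => ?_
    refine (homMk_id (X := (⟨X, p⟩ : ExtObj K D)) (sub_self p) rfl).trans ?_
    exact (Cochain.ofHom_v (𝟙 (formalComplex (K := K) X)) p).symm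
  map_comp {X Y Z n m p} h g f := by
    refine Cochain.ext _ _ fun i j hij => ?_
    refine Eq.trans ?_ (Cochain.comp_v _ _ (by lia : m + n = p) i (i + m) j rfl (by lia)).symm
    refine Eq.trans ?_ (homMk_comp (X := ⟨X, i⟩) (Y := ⟨Y, i + m⟩) (Z := ⟨Z, j⟩)
      (by change j - (i + m) = n; lia) rfl (by change i + m - i = m; lia) rfl
      (by change j - i = p; lia) rfl h rfl (sub_add_cancel _ 1) (by lia) (by lia) (by lia)
      _ _ _ _).symm
    simp only [Pi.zero_apply, zero_comp, comp_zero, smul_zero, add_zero]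
    rfl

/-- A discrete primitive, used to add up the homotopies between consecutive terms of a cocycle. -/
lemma exists_sum {M : Type*} [AddCommGroup M] (g : ℤ → M) :
    ∃ a : ℤ → M, a 0 = 0 ∧ ∀ p, a (p + 1) = a p + g p := by
  refine ⟨fun n => ∑ i ∈ Finset.Ico 0 n, g i - ∑ i ∈ Finset.Ico n 0, g i, by simp, fun p => ?_⟩
  rcases le_or_gt 0 p with hp | hp
  · dsimp only
    have : Finset.Ico 0 (p + 1) = insert p (Finset.Ico 0 p) := by
      ext i
      simp only [Finset.mem_Ico, Finset.mem_insert]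
      lia
    rw [Finset.Ico_eq_empty (by lia : ¬ p < 0), Finset.Ico_eq_empty (by lia : ¬ p + 1 < 0), this,
      Finset.sum_insert (by simp)]
    simp [add_comm]
  · dsimp only
    have : Finset.Ico p 0 = insert p (Finset.Ico (p + 1) 0) := by
      ext i
      simp only [Finset.mem_Ico, Finset.mem_insert]
      lia
    rw [Finset.Ico_eq_empty (by lia : ¬ 0 < p), Finset.Ico_eq_empty (by lia : ¬ 0 < p + 1), this,
      Finset.sum_insert (by simp)]
    simp

instance : (formalDG K D).mapH0.Faithful where
  map_injective {X Y} f g hfg := by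
    obtain ⟨f, rfl⟩ := (Quotient.functor (homotopyRel K D)).map_surjective f
    obtain ⟨g, rfl⟩ := (Quotient.functor (homotopyRel K D)).map_surjective g
    obtain ⟨k, hk⟩ : homotopyRel K _ ((formalDG K D).mapZ0.map f) ((formalDG K D).mapZ0.map g) :=
      (Quotient.functor_map_eq_iff (homotopyRel K _) _ _).1 hfg
    obtain ⟨a, b, rfl⟩ := exists_formalCochain (m := -2) (by norm_num) k
    -- In the part without `δ`, the coboundary formula at each index involves only the `a` of that
    -- index, so any single term of `a` is a homotopy in `D`.
    refine CategoryTheory.Quotient.sound _ ⟨a 0, ?_⟩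
    have hk' : formalCochain rfl (fun _ => f.1 - g.1) 0 = δ (-1) 0
        (formalCochain (by norm_num) a b) :=
      (map_sub _ _ _).trans hk
    rw [δ_formalCochain (by norm_num) (by norm_num) (by norm_num) (by norm_num)] at hk'
    exact congrFun (formalCochain_inj hk').1 0

instance : (formalDG K D).mapH0.Full where
  map_surjective {X Y} f := by
    obtain ⟨φ, rfl⟩ := (Quotient.functor (homotopyRel K _)).map_surjective
      (X := (⟨formalComplex X.as.obj⟩ : Z0 K _)) (Y := ⟨formalComplex Y.as.obj⟩) f
    obtain ⟨f, g, hfg⟩ := exists_formalCochain (m := -1) (by norm_num) φ.1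
    have hφ : δ 0 1 φ.1 = 0 := φ.2
    rw [hfg, δ_formalCochain (by norm_num) (by norm_num) (by norm_num) (by norm_num)] at hφ
    obtain ⟨h₁, h₂⟩ : (fun p => d (zero_add 1) (f p)) = 0 ∧ _ := formalCochain_inj
      (g' := 0) (hφ.trans (formalCochain_zero _).symm)
    -- Then `f p = f 0 + d (a p)`. The cochain `a`, with zero coefficient of `δ`, is a homotopy
    -- between `φ` and the image of `f 0`, because the `δ` part of its coboundary is `a (p + 1) - a
    -- p = g p`.
    obtain ⟨a, ha₀, ha⟩ := exists_sum g
    have h₃ (p : ℤ) : f (p + 1) = f p + d (neg_add_cancel 1) (g p) := by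
      have := congrFun h₂ p
      simp only [Int.negOnePow_zero, one_smul, Int.negOnePow_one, Units.neg_smul,
        Pi.zero_apply] at this
      exact (sub_eq_zero.1 ((sub_eq_add_neg _ _).trans this)).symm
    have h₄ (p : ℤ) : f p = f 0 + d (neg_add_cancel 1) (a p) := by
      induction p using Int.induction_on with
      | zero => rw [ha₀, map_zero, add_zero]
      | succ p hp => rw [h₃, hp, ha, map_add, add_assoc]
      | pred p hp =>
        have h₅ := h₃ (-p - 1)
        have h₆ := ha (-p - 1)
        rw [sub_add_cancel] at h₅ h₆
        rw [h₆, map_add, ← add_assoc, h₅] at hp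
        exact add_right_cancel hp
    refine ⟨(Quotient.functor (homotopyRel K D)).map (X := X.as) (Y := Y.as)
      ⟨f 0, congrFun h₁ 0⟩, ?_⟩
    symm
    refine CategoryTheory.Quotient.sound _ ⟨formalCochain (m := -2) (by norm_num) a 0, ?_⟩
    change φ.1 - formalCochain _ _ _ = δ (-1) 0 _
    rw [δ_formalCochain (by norm_num) (by norm_num) (by norm_num) (by norm_num), hfg,
      sub_eq_iff_eq_add, ← formalCochain_add]
    congr 1
    · funext p
      rw [h₄]
      exact add_comm _ _
    · funext p
      simp [ha]

end DGCategory

/-! ### Realization of H⁰ of a dg category in complexes over an additive category. -/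

section MapDG

open CochainComplex CochainComplex.HomComplex

variable (K : Type w) [CommRing K] {A : Type u} [Category.{v} A] [Preadditive A] [Linear K A]
  {B : Type u'} [Category.{v'} B] [Preadditive B] [Linear K B] (F : A ⥤ B) [F.Additive]
  [F.Linear K]

/-- The dg functor between dg categories of complexes induced by a linear functor. -/
def mapDG : DGFunctor K (CochainComplex A ℤ) (CochainComplex B ℤ) where
  obj X := (F.mapHomologicalComplex _).obj X
  map n :=
    { toFun := fun f => Cochain.map f F
      map_add' := fun f g => Cochain.ext _ _ fun p q hpq => F.map_add
      map_smul' := fun r f => Cochain.ext _ _ fun p q hpq => F.map_smul r _ }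
  map_d {X Y n m} _ f := (δ_map n f F (m := m)).symm
  map_id X := (Cochain.map_ofHom X X (𝟙 X) F).trans
    (congrArg Cochain.ofHom (CategoryTheory.Functor.map_id _ X))
  map_comp {X Y Z n m p} h g f := Cochain.map_comp Z f g (by lia : m + n = p) F

lemma mapDG_bijective [F.Full] [F.Faithful] (X Y : CochainComplex A ℤ) (n : ℤ) :
    Function.Bijective ((mapDG K F).map (A := X) (B := Y) n) := by
  constructor
  · intro f g h
    exact Cochain.ext _ _ fun p q hpq => F.map_injective (Cochain.congr_v h p q hpq)
  · intro f
    exact ⟨Cochain.mk fun p q hpq => F.preimage (f.v p q hpq),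
      Cochain.ext _ _ fun p q hpq => F.map_preimage _⟩

end MapDG

namespace DGCategory

variable (K : Type w) [CommRing K] (D : Type u) [DGCategory.{w, v} K D]

instance mapH0_mapDG_full {A : Type u''} [Category.{v''} A] [Preadditive A] [Linear K A]
    {B : Type u'} [Category.{v'} B] [Preadditive B] [Linear K B] (F : A ⥤ B) [F.Additive]
    [F.Linear K] [F.Full] [F.Faithful] : (mapDG K F).mapH0.Full :=
  DGFunctor.mapH0_full _ (mapDG_bijective K F)

instance mapH0_mapDG_faithful {A : Type u''} [Category.{v''} A] [Preadditive A] [Linear K A]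
    {B : Type u'} [Category.{v'} B] [Preadditive B] [Linear K B] (F : A ⥤ B) [F.Additive]
    [F.Linear K] [F.Full] [F.Faithful] : (mapDG K F).mapH0.Faithful :=
  DGFunctor.mapH0_faithful _ (mapDG_bijective K F)

/-- The realization of the objects of a dg category as complexes in an additive category. -/
noncomputable def realizationDG : DGFunctor K D (CochainComplex (AddHull (ExtObj K D)) ℤ) :=
  (formalDG K D).compose (mapDG K (AddHull.embedding (ExtObj K D)))

instance : (realizationDG K D).mapH0.Full where
  map_surjective {X Y} f := by
    obtain ⟨g, rfl⟩ := (mapDG K (AddHull.embedding (ExtObj K D))).mapH0.map_surjective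
      (X := (formalDG K D).mapH0.obj X) (Y := (formalDG K D).mapH0.obj Y) f
    obtain ⟨h, rfl⟩ := (formalDG K D).mapH0.map_surjective g
    refine ⟨h, ?_⟩
    obtain ⟨h, rfl⟩ := (Quotient.functor _).map_surjective h
    rfl

instance : (realizationDG K D).mapH0.Faithful where
  map_injective {X Y} f g h := by
    refine (formalDG K D).mapH0.map_injective
      ((mapDG K (AddHull.embedding (ExtObj K D))).mapH0.map_injective ?_)
    obtain ⟨f, rfl⟩ := (Quotient.functor _).map_surjective f
    obtain ⟨g, rfl⟩ := (Quotient.functor _).map_surjective g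
    exact h

/-- The realization of the homotopy category of a dg category in the homotopy category of
complexes of an additive category. -/
noncomputable def realization :
    H0 K D ⥤ HomotopyCategory (AddHull (ExtObj K D)) (ComplexShape.up ℤ) :=
  (realizationDG K D).mapH0 ⋙ h0ToHomotopyCategory K _

instance : (realization K D).Full := inferInstanceAs ((_ ⋙ _ : _ ⥤ _).Full)
instance : (realization K D).Faithful := inferInstanceAs ((_ ⋙ _ : _ ⥤ _).Faithful)
instance : (realization K D).Additive := inferInstanceAs ((_ ⋙ _ : _ ⥤ _).Additive)
instance : (realization K D).Linear K := inferInstanceAs ((_ ⋙ _ : _ ⥤ _).Linear K)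

end DGCategory

/-! ### Triangles of dg functors: cones exist and are unique up to isomorphism. -/

section Triangles

open DGCategory TriangleStructure

/-- `f.shift 1` is the conjugate of `f` by the invertible morphisms `σ` and `τ`, and the sign in
`shiftDG` is a unit. -/
lemma shiftDG_bijective (K : Type w) [CommRing K] (A : Type u') [Category.{v'} A] [Preadditive A]
    [Linear K A] (X Y : CochainComplex A ℤ) (n : ℤ) :
    Function.Bijective ((shiftDG K A).map (A := X) (B := Y) n) := by
  let σ (X : CochainComplex A ℤ) : DGHom K X (X⟦(1 : ℤ)⟧) (-1) := (complexShiftData K X).σ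
  let τ (X : CochainComplex A ℤ) : DGHom K (X⟦(1 : ℤ)⟧) X 1 := (complexShiftData K X).τ
  have hσ (f : DGHom K X Y n) : comp (by lia : n + -1 = n - 1)
      (show DGHom K (X⟦(1 : ℤ)⟧) (Y⟦(1 : ℤ)⟧) n from CochainComplex.HomComplex.Cochain.shift f 1)
        (σ X) = comp (by lia : -1 + n = n - 1) (σ Y) f :=
    rightShift_id_comp_shift (K := K) f (k := n - 1) (by lia) (by lia)
  have H : Function.Bijective (fun f : CochainComplex.HomComplex.Cochain X Y n => f.shift 1) := by
    constructor
    · intro f g h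
      have h' : comp (by lia : -1 + n = n - 1) (σ Y) (show DGHom K X Y n from f) =
          comp (by lia : -1 + n = n - 1) (σ Y) (show DGHom K X Y n from g) := by
        rw [← hσ, ← hσ]
        exact congrArg (fun t => comp (K := K) (by lia : n + -1 = n - 1)
          (show DGHom K (X⟦(1 : ℤ)⟧) (Y⟦(1 : ℤ)⟧) n from t) (σ X)) h
      have h'' := congrArg (comp (by lia : 1 + (n - 1) = n) (τ Y)) h'
      rw [← assoc (add_neg_cancel 1) _ (zero_add n), ← assoc (add_neg_cancel 1) _ (zero_add n),
        (complexShiftData K Y).τ_σ, id_comp, id_comp] at h''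
      exact h''
    · intro g
      let g' : DGHom K (X⟦(1 : ℤ)⟧) (Y⟦(1 : ℤ)⟧) n := g
      let f : DGHom K X Y n := comp (by lia : 1 + (n - 1) = n) (τ Y)
        (comp (by lia : n + -1 = n - 1) g' (σ X))
      have h' := congrArg (comp (by lia : n - 1 + 1 = n) · (τ X)) (hσ f)
      dsimp only at h'
      rw [← assoc (n := -1) (neg_add_cancel 1) _ (by lia : 0 + (n - 1) = n - 1),
        (complexShiftData K Y).σ_τ, id_comp, assoc _ (neg_add_cancel 1) _ (add_zero n),
        assoc _ (neg_add_cancel 1) _ (add_zero n), (complexShiftData K X).σ_τ, comp_id,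
        comp_id] at h'
      exact ⟨f, h'⟩
  rcases Int.units_eq_one_or n.negOnePow with h | h
  · have : ⇑((shiftDG K A).map (A := X) (B := Y) n) = fun f => f.shift 1 := by
      funext f
      change n.negOnePow • CochainComplex.HomComplex.Cochain.shift (K := X) (L := Y) f 1 = _
      rw [h, one_smul]
    rw [this]
    exact H
  · have : ⇑((shiftDG K A).map (A := X) (B := Y) n) = Neg.neg ∘ fun f => f.shift 1 := by
      funext f
      change n.negOnePow • CochainComplex.HomComplex.Cochain.shift (K := X) (L := Y) f 1 = _
      rw [h, Units.neg_smul, one_smul]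
      rfl
    rw [this]
    exact (neg_bijective (G := CochainComplex.HomComplex.Cochain _ _ n)).comp H

lemma DGFunctor.postcompose_bijective {K : Type w} [CommRing K] {C : Type u} [DGCategory.{w, v} K C]
    {D : Type u'}
    [DGCategory.{w, v'} K D] {E : Type u''} [DGCategory.{w, v''} K E] (Φ : DGFunctor K D E)
    (hΦ : ∀ (X Y : D) (n : ℤ), Function.Bijective (Φ.map (A := X) (B := Y) n))
    (F G : DGFunctor K C D) (n : ℤ) :
    Function.Bijective ((DGFunctor.postcompose (C := C) Φ).map (A := F) (B := G) n) := by
  constructor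
  · intro φ ψ h
    exact Subtype.ext (funext fun X => (hΦ _ _ _).1 (congrFun (congrArg Subtype.val h) X))
  · intro φ
    choose ψ hψ using fun X => (hΦ (F.obj X) (G.obj X) n).2 (φ.1 X)
    refine ⟨⟨ψ, fun X Y m p h h' f => (hΦ _ _ _).1 ?_⟩, Subtype.ext (funext hψ)⟩
    rw [Units.smul_def, map_zsmul, ← Units.smul_def, Φ.map_comp, Φ.map_comp, hψ, hψ]
    exact DGFunctor.natTrans_comm φ h h' f

/-- An isomorphism of triangles found in the target lifts back by full faithfulness. This borrows
uniqueness of cones from a homotopy category of complexes instead of proving axioms in the source.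
-/
lemma TriangleStructure.IsExact.conesUnique {S : Type u} [Category.{v} S] {S' : Type u'}
    [Category.{v'} S'] {𝒮 : TriangleStructure S} {𝒮' : TriangleStructure S'} {G : S ⥤ S'}
    [G.Full] [G.Faithful] (hG : 𝒮.IsExact 𝒮' G) (h𝒮' : 𝒮'.ConesUnique) : 𝒮.ConesUnique := by
  obtain ⟨η, hη⟩ := hG
  intro X Y Z X' Y' Z' f g h f' g' h' a b H H' w
  obtain ⟨c, hc, hc'⟩ := h𝒮' _ _ _ _ _ _ (G.mapIso a) (G.mapIso b) (hη f g h H) (hη f' g' h' H')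
    (by rw [G.mapIso_hom, G.mapIso_hom, ← G.map_comp, w, G.map_comp])
  refine ⟨G.preimageIso c, G.map_injective (by simpa using hc), G.map_injective ?_⟩
  rw [← cancel_mono (η.hom.app X')]
  have := η.hom.naturality a.hom
  dsimp at this hc'
  rw [Category.assoc] at hc'
  simp only [G.map_comp, Category.assoc, this, G.preimageIso_hom, G.map_preimage]
  exact hc'

section

variable (K : Type w) [CommRing K] (C : Type u) [DGCategory.{w, v} K C]
  (A : Type u') [Category.{v'} A] [Preadditive A] [Linear K A] [Limits.HasBinaryBiproducts A]

lemma isoClosed_dgFunTriangles : (dgFunTriangles K C A).IsoClosed := by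
  intro X Y Z X' Y' Z' f g k f' g' k' a b c h₁ h₂ h₃ ⟨F, G, φ, a', b', c', h₁', h₂', h₃'⟩
  refine ⟨F, G, φ, a ≪≫ a', b ≪≫ b', c ≪≫ c', ?_, ?_, ?_⟩
  · simp only [Iso.trans_hom, Category.assoc, reassoc_of% h₁, h₁']
  · simp only [Iso.trans_hom, Category.assoc, reassoc_of% h₂, h₂']
  · erw [Iso.trans_hom, CategoryTheory.Functor.map_comp, reassoc_of% h₃, h₃']
    rw [Iso.trans_hom, Category.assoc]
    rfl

lemma exists_distinguished_dgFunTriangles {X Y : H0 K (DGFunctor K C (CochainComplex A ℤ))}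
    (f : X ⟶ Y) : ∃ (Z : _) (g : Y ⟶ Z) (h : Z ⟶ (dgFunTriangles K C A).shift.obj X),
      (dgFunTriangles K C A).distinguished f g h := by
  obtain ⟨φ, rfl⟩ := (Quotient.functor _).map_surjective f
  refine ⟨_, homToH0 (coneInr φ), homToH0 (coneDelta φ), X.as.obj, Y.as.obj, φ, Iso.refl _,
    Iso.refl _, Iso.refl _, ?_, ?_, ?_⟩
  · exact (Category.comp_id _).trans (Category.id_comp _).symm
  · exact (Category.comp_id _).trans (Category.id_comp _).symm
  · exact (congrArg (homToH0 (coneDelta φ) ≫ ·) (CategoryTheory.Functor.map_id _ _)).trans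
      ((Category.comp_id _).trans (Category.id_comp _).symm)

/-- The realization is applied to the dg category of dg functors itself: it is fully faithful on H⁰
and exact, so cones are as unique as in a homotopy category of complexes. -/
lemma conesUnique_dgFunTriangles : (dgFunTriangles K C A).ConesUnique :=
  IsExact.conesUnique (G := realization K (DGFunctor K C (CochainComplex A ℤ)))
    (isExact_mapH0_dgFun (realizationDG K _)) (conesUnique_ofPretriangulated _)

instance : (dgFunTriangles K C A).shift.Full :=
  DGFunctor.mapH0_full _ ((shiftDG K A).postcompose_bijective (shiftDG_bijective K A))

instance : (dgFunTriangles K C A).shift.Faithful :=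
  DGFunctor.mapH0_faithful _ ((shiftDG K A).postcompose_bijective (shiftDG_bijective K A))

end

end Triangles

/-! ### Properties inherited by an induced triangle structure. -/

namespace TriangleStructure

variable {S : Type u} [Category.{v} S] {S' : Type u'} [Category.{v'} S']

variable {𝒮' : TriangleStructure S'} {Φ : S ⥤ S'} [Φ.Full] [Φ.Faithful]
  (h : 𝒮'.IsTriangulatedSubcategory Φ.essImage)

lemma IsoClosed.induced (h𝒮' : 𝒮'.IsoClosed) : (𝒮'.induced Φ h).IsoClosed := by
  -- The existential hides how the shift was lifted and retains only its comparison with the shift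
  -- of the target and the description of the triangles.
  obtain ⟨η, hη⟩ : ∃ η : (𝒮'.induced Φ h).shift ⋙ Φ ≅ Φ ⋙ 𝒮'.shift, ∀ {X Y Z : S} (f : X ⟶ Y)
      (g : Y ⟶ Z) (k : Z ⟶ (𝒮'.induced Φ h).shift.obj X), (𝒮'.induced Φ h).distinguished f g k ↔
        𝒮'.distinguished (Φ.map f) (Φ.map g) (Φ.map k ≫ η.hom.app X) :=
    ⟨Functor.essImage.liftFunctorCompIso (Φ ⋙ 𝒮'.shift) Φ _, fun _ _ _ => Iff.rfl⟩
  intro X Y Z X' Y' Z' f g k f' g' k' a b c h₁ h₂ h₃ H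
  rw [hη] at H ⊢
  refine h𝒮' _ _ _ _ _ _ (Φ.mapIso a) (Φ.mapIso b) (Φ.mapIso c) ?_ ?_ ?_ H
  · simpa using congrArg Φ.map h₁
  · simpa using congrArg Φ.map h₂
  · have := η.hom.naturality a.hom
    have h₃' := congrArg Φ.map h₃
    simp only [Φ.map_comp] at h₃'
    dsimp at this ⊢
    rw [Category.assoc, ← this, reassoc_of% h₃']

/-- A cone of `Φ.map f` lies in the essential image, which is a triangulated subcategory, and
fullness of `Φ` brings its morphisms back. -/
lemma HasCones.induced (h𝒮' : 𝒮'.HasCones) (h𝒮'' : 𝒮'.IsoClosed) :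
    (𝒮'.induced Φ h).HasCones := by
  obtain ⟨η, hη⟩ : ∃ η : (𝒮'.induced Φ h).shift ⋙ Φ ≅ Φ ⋙ 𝒮'.shift, ∀ {X Y Z : S} (f : X ⟶ Y)
      (g : Y ⟶ Z) (k : Z ⟶ (𝒮'.induced Φ h).shift.obj X), (𝒮'.induced Φ h).distinguished f g k ↔
        𝒮'.distinguished (Φ.map f) (Φ.map g) (Φ.map k ≫ η.hom.app X) :=
    ⟨Functor.essImage.liftFunctorCompIso (Φ ⋙ 𝒮'.shift) Φ _, fun _ _ _ => Iff.rfl⟩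
  intro X Y f
  obtain ⟨Z, g, k, H⟩ := h𝒮' (Φ.map f)
  obtain ⟨W, ⟨e⟩⟩ := h.of_distinguished _ _ _ H (Φ.obj_mem_essImage X) (Φ.obj_mem_essImage Y)
  refine ⟨W, Φ.preimage (g ≫ e.inv), Φ.preimage (e.hom ≫ k ≫ η.inv.app X), (hη _ _ _).2 ?_⟩
  refine h𝒮'' _ _ _ _ _ _ (Iso.refl _) (Iso.refl _) e ?_ ?_ ?_ H
  · simp
  · simp
  · simp only [Φ.map_preimage, Category.assoc, Iso.inv_hom_id_app, Iso.refl_hom,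
      CategoryTheory.Functor.map_id]
    erw [Category.comp_id, Category.comp_id]

end TriangleStructure

/-! ### Functoriality of the realization with respect to dg functors. -/

section Functoriality

open DGCategory CochainComplex CochainComplex.HomComplex

variable {K : Type w} [CommRing K] {C : Type u} [DGCategory.{w, v} K C]
  {D : Type u'} [DGCategory.{w, v'} K D] (F : DGFunctor K C D)

namespace DGFunctor

lemma mapExt_extComp {X Y Z : C} {n m p : ℤ} (h : n + m = p)
    (g : DGHom K Y Z n × DGHom K Y Z (n - 1)) (f : DGHom K X Y m × DGHom K X Y (m - 1)) :
    (F.map p (extComp h g f).1, F.map (p - 1) (extComp h g f).2) =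
      extComp h (F.map n g.1, F.map (n - 1) g.2) (F.map m f.1, F.map (m - 1) f.2) := by
  refine Prod.ext ?_ ?_
  · simp only [extComp, map_add, F.map_comp, F.map_d]
  · simp only [extComp, map_add, F.map_comp, F.map_d, Units.smul_def, map_zsmul]

/-- The functor induced by a dg functor on the categories with formal shifts and a formal
differential. -/
def mapExt : ExtObj K C ⥤ ExtObj K D where
  obj X := ⟨F.obj X.obj, X.deg⟩
  map f := (F.map _ f.1, F.map _ f.2)
  map_id X := by
    have key : ∀ (n : ℤ) (e : n = 0),
        (F.map n (e.symm ▸ DGCategory.id X.obj : DGHom K X.obj X.obj n), F.map (n - 1)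
          (0 : DGHom K X.obj X.obj (n - 1))) =
          ((e.symm ▸ DGCategory.id (F.obj X.obj) : DGHom K _ _ n), 0) := by
      rintro _ rfl
      rw [map_zero, F.map_id]
    exact key _ (sub_self _)
  map_comp f g := mapExt_extComp F _ g f

instance : F.mapExt.Additive where
  map_add := Prod.ext (map_add _ _ _) (map_add _ _ _)

lemma mapExt_full (hF : ∀ (X Y : C) (n : ℤ), Function.Bijective (F.map (A := X) (B := Y) n)) :
    F.mapExt.Full where
  map_surjective {X Y} f := by
    obtain ⟨f₁, f₂⟩ := f
    obtain ⟨g₁, rfl⟩ := (hF X.obj Y.obj _).2 f₁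
    obtain ⟨g₂, rfl⟩ := (hF X.obj Y.obj _).2 f₂
    exact ⟨(g₁, g₂), rfl⟩

lemma mapExt_faithful (hF : ∀ (X Y : C) (n : ℤ), Function.Bijective (F.map (A := X) (B := Y) n)) :
    F.mapExt.Faithful where
  map_injective h :=
    Prod.ext ((hF _ _ _).1 (congrArg Prod.fst h)) ((hF _ _ _).1 (congrArg Prod.snd h))

lemma mapExt_homMk {X Y : ExtObj K C} {n m : ℤ} (h : Y.deg - X.deg = n) (h' : n - 1 = m)
    (f : DGHom K X.obj Y.obj n) (g : DGHom K X.obj Y.obj m) :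
    F.mapExt.map (ExtObj.homMk h h' f g) =
      ExtObj.homMk (X := F.mapExt.obj X) (Y := F.mapExt.obj Y) h h' (F.map n f) (F.map m g) := by
  subst h h'
  rfl

lemma mapExt_formalComplex_d (X : C) (i j : ℤ) :
    F.mapExt.map ((formalComplex (K := K) X).d i j) = (formalComplex (F.obj X)).d i j := by
  by_cases h : i + 1 = j
  · rw [formalComplex_d _ h, formalComplex_d _ h]
    exact (F.mapExt_homMk _ _ _ _).trans (congrArg₂ (ExtObj.homMk (X := ⟨F.obj X, i⟩)
      (Y := ⟨F.obj X, j⟩) (by change j - i = 1; lia) rfl) (map_zero _) (F.map_id X))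
  · rw [(formalComplex (K := K) X).shape _ _ h, (formalComplex (K := K) (F.obj X)).shape _ _ h]
    exact F.mapExt.map_zero _ _

/-- The functor induced by a dg functor between the categories in which objects are realized as
complexes. -/
noncomputable def mapHull : AddHull (ExtObj K C) ⥤ AddHull (ExtObj K D) := AddHull.map F.mapExt

instance : F.mapHull.Additive := inferInstanceAs (AddHull.map F.mapExt).Additive

/-- Realizations are compatible with dg functors. -/
noncomputable def realizationDGObjIso (X : C) :
    (F.mapHull.mapHomologicalComplex (ComplexShape.up ℤ)).obj ((realizationDG K C).obj X) ≅
      (realizationDG K D).obj (F.obj X) :=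
  HomologicalComplex.Hom.isoOfComponents (fun n => Iso.refl
    ((AddHull.embedding (ExtObj K D)).obj ⟨F.obj X, n⟩)) (fun i j _ => by
    refine (Category.id_comp _).trans (Eq.trans ?_ (Category.comp_id _).symm)
    exact congrArg (AddHull.embedding (ExtObj K D)).map (F.mapExt_formalComplex_d X i j).symm)

/-- Realizations are compatible with dg functors. -/
noncomputable def realizationIso :
    realization K C ⋙ F.mapHull.mapHomotopyCategory (ComplexShape.up ℤ) ≅
      F.mapH0 ⋙ realization K D :=
  NatIso.ofComponents (fun X => (HomotopyCategory.quotient _ _).mapIso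
      (F.realizationDGObjIso X.as.obj)) (by
    intro X Y f
    obtain ⟨f, rfl⟩ := (Quotient.functor _).map_surjective f
    have key : (F.mapHull.mapHomologicalComplex (ComplexShape.up ℤ)).map
        (closedToHom ((realizationDG K C).mapClosed f)) ≫ (F.realizationDGObjIso Y.as.obj).hom =
        (F.realizationDGObjIso X.as.obj).hom ≫
          closedToHom ((realizationDG K D).mapClosed (F.mapClosed f)) := by
      refine HomologicalComplex.hom_ext _ _ fun n => ?_
      rw [HomologicalComplex.comp_f, HomologicalComplex.comp_f]
      erw [Category.comp_id, Category.id_comp]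
      have h : F.mapExt.map (ExtObj.homMk (X := ⟨X.as.obj, n⟩) (Y := ⟨Y.as.obj, n⟩)
          (sub_self n) rfl f.1 0) = ExtObj.homMk (X := ⟨F.obj X.as.obj, n⟩)
          (Y := ⟨F.obj Y.as.obj, n⟩) (sub_self n) rfl (F.map 0 f.1) 0 :=
        (F.mapExt_homMk (X := ⟨X.as.obj, n⟩) (Y := ⟨Y.as.obj, n⟩) (sub_self n) rfl f.1 0).trans
          (congrArg (ExtObj.homMk (X := ⟨F.obj X.as.obj, n⟩) (Y := ⟨F.obj Y.as.obj, n⟩)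
            (sub_self n) rfl (F.map 0 f.1)) (map_zero (F.map (0 - 1))))
      exact congrArg (AddHull.embedding (ExtObj K D)).map h
    let Q := HomotopyCategory.quotient (AddHull (ExtObj K D)) (ComplexShape.up ℤ)
    exact (Q.map_comp _ _).symm.trans ((congrArg Q.map key).trans (Q.map_comp _ _)))

end DGFunctor

end Functoriality

/-! ### Exactness of the realization, and embedding of an enhanced category in complexes. -/

section

open TriangleStructure Pretriangulated DGCategory

lemma isExact_of_isTriangulated {T : Type u} [Category.{v} T] [Preadditive T]
    [Limits.HasZeroObject T] [HasShift T ℤ] [∀ n : ℤ, (shiftFunctor T n).Additive]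
    [Pretriangulated T] {S : Type u'} [Category.{v'} S] [Preadditive S] [Limits.HasZeroObject S]
    [HasShift S ℤ] [∀ n : ℤ, (shiftFunctor S n).Additive] [Pretriangulated S] (G : T ⥤ S)
    [G.CommShift ℤ] [G.IsTriangulated] : (ofPretriangulated T).IsExact (ofPretriangulated S) G :=
  ⟨G.commShiftIso (1 : ℤ), fun _ _ _ H => G.map_distinguished _ H⟩

variable {K : Type w} [CommRing K] {C : Type u} [DGCategory.{w, v} K C]

/-- The Yoneda embedding is bijective on morphisms of every degree, so it induces a fully faithful
exact functor between the homotopy categories that receive the two realizations, and exactness may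
be tested after it. By `realizationIso` the composite is the Yoneda functor, exact by definition of
the induced structure, followed by the realization of dg modules, exact by `isExact_mapH0_dgFun`. -/
lemma isExact_realization (h : IsDGPretriangulated K C) :
    (h0Triangles K h).IsExact (ofPretriangulated _) (realization K C) := by
  have := (yonedaDG K C).mapExt_full (yonedaDG_bijective K C)
  have := (yonedaDG K C).mapExt_faithful (yonedaDG_bijective K C)
  have : (yonedaDG K C).mapHull.Full := inferInstanceAs (AddHull.map (yonedaDG K C).mapExt).Full
  have : (yonedaDG K C).mapHull.Faithful :=
    inferInstanceAs (AddHull.map (yonedaDG K C).mapExt).Faithful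
  refine IsExact.of_comp (Ψ := (yonedaDG K C).mapHull.mapHomotopyCategory (ComplexShape.up ℤ))
    (isExact_of_isTriangulated _) (isoClosed_ofPretriangulated _)
    (hasCones_ofPretriangulated _) (conesUnique_ofPretriangulated _) ?_
  refine IsExact.of_iso ?_ (yonedaDG K C).realizationIso.symm (isoClosed_ofPretriangulated _)
  exact (isExact_induced _ _ h).comp (isExact_mapH0_dgFun (realizationDG K (DGMod K C)))

lemma hasCones_h0Triangles (h : IsDGPretriangulated K C) : (h0Triangles K h).HasCones :=
  HasCones.induced h (fun _ _ f => exists_distinguished_dgFunTriangles K Cᵒᵖ _ f)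
    (isoClosed_dgFunTriangles K Cᵒᵖ _)

lemma isoClosed_h0Triangles (h : IsDGPretriangulated K C) : (h0Triangles K h).IsoClosed :=
  IsoClosed.induced h (isoClosed_dgFunTriangles K Cᵒᵖ _)

/-- The homotopy category of a dg enhancement embeds in the homotopy category of complexes of an
additive category. -/
lemma DGEnhancement.exists_functor_homotopyCategory {T : Type u'} [Category.{v'} T]
    [Preadditive T] [Linear K T] [Limits.HasZeroObject T] [HasShift T ℤ]
    [∀ n : ℤ, (shiftFunctor T n).Additive] [Pretriangulated T]
    (e : DGEnhancement.{w, v, v', u, u'} K T (ofPretriangulated T)) :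
    ∃ (A : Type u) (_ : Category.{v} A) (_ : Preadditive A) (_ : Linear K A)
      (_ : Limits.HasBinaryBiproducts A) (_ : Limits.HasZeroObject A)
      (G : T ⥤ HomotopyCategory A (ComplexShape.up ℤ)),
      G.Additive ∧ G.Linear K ∧ (ofPretriangulated T).IsExact
        (ofPretriangulated (HomotopyCategory A (ComplexShape.up ℤ))) G ∧ G.Full ∧ G.Faithful := by
  obtain ⟨C, h, E, hE⟩ := e
  have : E.asEquivalence.functor.Additive := inferInstanceAs E.Additive
  have : E.asEquivalence.functor.Linear K := inferInstanceAs (E.Linear K)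
  have : E.inv.Additive := inferInstanceAs E.asEquivalence.inverse.Additive
  have : E.inv.Linear K := inferInstanceAs (E.asEquivalence.inverse.Linear K)
  have hinv : (ofPretriangulated T).IsExact (h0Triangles K h) E.inv :=
    IsExact.inv (T := T) (𝒮 := h0Triangles K h) (E := E) hE (isoClosed_h0Triangles h)
      (hasCones_h0Triangles h)
  exact ⟨AddHull (ExtObj K C), inferInstance, inferInstance, inferInstance, inferInstance,
    inferInstance, E.inv ⋙ realization K C, inferInstance, inferInstance,
    hinv.comp (isExact_realization h), inferInstance, inferInstance⟩

end

/-! ### Exact functors between homotopy categories induced by dg functors between complexes. -/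

section Exactness

open DGCategory TriangleStructure Pretriangulated CochainComplex CochainComplex.HomComplex

variable (K : Type w) [CommRing K] {A : Type u} [Category.{v} A] [Preadditive A] [Linear K A]

/-- The homotopy category of complexes maps to the homotopy category of the dg category of
complexes. -/
def homotopyCategoryToH0 :
    HomotopyCategory A (ComplexShape.up ℤ) ⥤ H0 K (CochainComplex A ℤ) :=
  CategoryTheory.Quotient.lift _
    { obj := fun X => toH0 K X
      map := fun f => homToH0 (homClosed K f)
      map_id := fun X => rfl
      map_comp := fun f g => congrArg (Quotient.functor _).map
        (Subtype.ext (Cochain.ofHom_comp f g)) }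
    (by
      rintro X Y f g ⟨h⟩
      exact (h0ToHomotopyCategory K A).map_injective
        ((congrArg _ (closedToHom_homClosed K f)).trans
          ((HomotopyCategory.eq_of_homotopy _ _ h).trans
            (congrArg _ (closedToHom_homClosed K g)).symm)))

lemma homotopyCategoryToH0_map_closedToHom {X Y : CochainComplex A ℤ}
    (f : closedHom (K := K) X Y) :
    (homotopyCategoryToH0 K).map ((HomotopyCategory.quotient A (ComplexShape.up ℤ)).map
      (closedToHom f)) = homToH0 f :=
  congrArg homToH0 (homClosed_closedToHom f)

instance : (homotopyCategoryToH0 K (A := A)).Additive where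
  map_add {X Y f g} := by
    obtain ⟨f, rfl⟩ := (HomotopyCategory.quotient A _).map_surjective f
    obtain ⟨g, rfl⟩ := (HomotopyCategory.quotient A _).map_surjective g
    exact congrArg homToH0 (Subtype.ext (Cochain.ofHom_add f g))

variable {K} [Limits.HasBinaryBiproducts A] [Limits.HasZeroObject A] {B : Type u'}
  [Category.{v'} B] [Preadditive B] [Linear K B] [Limits.HasBinaryBiproducts B]
  [Limits.HasZeroObject B] (Θ : DGFunctor K (CochainComplex A ℤ) (CochainComplex B ℤ))

/-- The functor between homotopy categories of complexes induced by a dg functor. -/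
noncomputable def mapComplexes :
    HomotopyCategory A (ComplexShape.up ℤ) ⥤ HomotopyCategory B (ComplexShape.up ℤ) :=
  homotopyCategoryToH0 K ⋙ Θ.mapH0 ⋙ h0ToHomotopyCategory K B

/-- The comparison isomorphism of `mapComplexes Θ` with the shift, on objects. -/
noncomputable def mapComplexesShift (X : CochainComplex A ℤ) :
    (mapComplexes Θ).obj (((HomotopyCategory.quotient A (ComplexShape.up ℤ)).obj X)⟦(1 : ℤ)⟧) ≅
      ((mapComplexes Θ).obj ((HomotopyCategory.quotient A (ComplexShape.up ℤ)).obj X))⟦(1 : ℤ)⟧ :=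
  (mapComplexes Θ).mapIso
    (((HomotopyCategory.quotient A (ComplexShape.up ℤ)).commShiftIso (1 : ℤ)).symm.app X) ≪≫
      (Θ.mapShift (complexShiftData K X)).isoShiftQuotient

lemma mapComplexesShift_naturality {X Y : CochainComplex A ℤ} (f : X ⟶ Y) :
    (mapComplexes Θ).map
        (((HomotopyCategory.quotient A (ComplexShape.up ℤ)).map f)⟦(1 : ℤ)⟧') ≫
      (mapComplexesShift Θ Y).hom = (mapComplexesShift Θ X).hom ≫
        ((mapComplexes Θ).map
          ((HomotopyCategory.quotient A (ComplexShape.up ℤ)).map f))⟦(1 : ℤ)⟧' := by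
  have h₁ : ((HomotopyCategory.quotient A (ComplexShape.up ℤ)).map f)⟦(1 : ℤ)⟧' ≫
      ((HomotopyCategory.quotient A (ComplexShape.up ℤ)).commShiftIso (1 : ℤ)).inv.app Y =
      ((HomotopyCategory.quotient A (ComplexShape.up ℤ)).commShiftIso (1 : ℤ)).inv.app X ≫
        (HomotopyCategory.quotient A (ComplexShape.up ℤ)).map (f⟦(1 : ℤ)⟧') :=
    ((HomotopyCategory.quotient A (ComplexShape.up ℤ)).commShiftIso (1 : ℤ)).inv.naturality f
  have h₂ := isoShiftQuotient_naturality (Θ.mapShift (complexShiftData K X))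
      (Θ.mapShift (complexShiftData K Y)) (Θ.mapClosed (homClosed K f))
      (Θ.mapClosed (homClosed K (f⟦(1 : ℤ)⟧'))) (by
    refine (Θ.map_comp _ _ _).symm.trans (Eq.trans ?_ (Θ.map_comp _ _ _))
    exact congrArg _ (complexShiftData_naturality f))
  refine (Category.assoc _ _ _).symm.trans ((congrArg (· ≫ _)
    (((mapComplexes Θ).map_comp _ _).symm.trans
      ((congrArg (mapComplexes Θ).map h₁).trans ((mapComplexes Θ).map_comp _ _)))).trans ?_)
  exact (Category.assoc _ _ _).trans ((congrArg (_ ≫ ·) h₂).trans (Category.assoc _ _ _).symm)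

/-- Every distinguished triangle is isomorphic to the mapping cone triangle of a chain map, whose
cone and shift data are preserved by `Θ`. -/
lemma isExact_mapComplexes :
    (ofPretriangulated (HomotopyCategory A (ComplexShape.up ℤ))).IsExact
      (ofPretriangulated (HomotopyCategory B (ComplexShape.up ℤ))) (mapComplexes Θ) := by
  refine ⟨NatIso.ofComponents (fun X => mapComplexesShift Θ X.as) (by
    intro X Y f
    obtain ⟨f, rfl⟩ := (HomotopyCategory.quotient A _).map_surjective f
    exact mapComplexesShift_naturality Θ f), ?_⟩
  intro X Y Z f g h H
  obtain ⟨X, rfl⟩ : ∃ X', (HomotopyCategory.quotient A _).obj X' = X := ⟨X.as, rfl⟩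
  obtain ⟨Y, rfl⟩ : ∃ X', (HomotopyCategory.quotient A _).obj X' = Y := ⟨Y.as, rfl⟩
  obtain ⟨f, rfl⟩ := (HomotopyCategory.quotient A _).map_surjective f
  obtain ⟨f, rfl⟩ : ∃ φ, closedToHom (K := K) φ = f := ⟨homClosed K f, closedToHom_homClosed K f⟩
  obtain ⟨c, hc, hc'⟩ := conesUnique_ofPretriangulated _ _ _ _ _ _ _ (Iso.refl _) (Iso.refl _) H
    (distTriang_mappingCone (closedToHom f)) ((Category.comp_id _).trans (Category.id_comp _).symm)
  rw [Iso.refl_hom, Category.id_comp] at hc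
  rw [Iso.refl_hom, CategoryTheory.Functor.map_id, Category.comp_id] at hc'
  refine distTriang_of_iso ((Θ.mapCone (mappingConeData K f)).distTriang
    (Θ.mapShift (complexShiftData K X))) (Iso.refl _) (Iso.refl _) ((mapComplexes Θ).mapIso c)
    ?_ ?_ ?_
  · refine (Category.comp_id _).trans (Eq.trans ?_ (Category.id_comp _).symm)
    change (HomotopyCategory.quotient B _).map
      (closedToHom (Θ.mapClosed (homClosed K (closedToHom f)))) = _
    rw [homClosed_closedToHom]
  · refine Eq.trans ?_ (Category.id_comp _).symm
    exact ((mapComplexes Θ).map_comp _ _).symm.trans (congrArg (mapComplexes Θ).map hc)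
  · have h₆ : (Θ.mapCone (mappingConeData K f)).delta (Θ.mapShift (complexShiftData K X)) =
        Θ.mapClosed (homClosed K (coneProj (closedToHom f))) := by
      rw [← mappingConeData_delta]
      refine Subtype.ext ?_
      change -comp _ (Θ.map _ _) (Θ.map _ _) = Θ.map 0 (-comp _ _ _)
      rw [map_neg, Θ.map_comp]
    have h₇ : h ≫ ((HomotopyCategory.quotient A (ComplexShape.up ℤ)).commShiftIso
        (1 : ℤ)).inv.app X =
        c.hom ≫ (HomotopyCategory.quotient A (ComplexShape.up ℤ)).map
          (coneProj (closedToHom f)) := by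
      refine (congrArg (· ≫ _) hc').trans ?_
      refine (Category.assoc _ _ _).trans (congrArg (c.hom ≫ ·) ?_)
      refine (Category.assoc _ _ _).trans ?_
      exact (congrArg (_ ≫ ·) (((HomotopyCategory.quotient A (ComplexShape.up ℤ)).commShiftIso
        (1 : ℤ)).hom_inv_id_app X)).trans (Category.comp_id _)
    rw [h₆]
    refine ((congrArg (_ ≫ ·) (CategoryTheory.Functor.map_id _ _)).trans
      (Category.comp_id _)).trans ?_
    have h₈ := ((mapComplexes Θ).map_comp _ _).symm.trans
      ((congrArg (mapComplexes Θ).map h₇).trans ((mapComplexes Θ).map_comp _ _))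
    exact (Category.assoc _ _ _).symm.trans ((congrArg (· ≫
      (Θ.mapShift (complexShiftData K X)).isoShiftQuotient.hom) h₈).trans (Category.assoc _ _ _))

end Exactness

/-! ### Full dg subcategories and restriction of dg modules. -/

section Restriction

open DGCategory

variable {K : Type w} [CommRing K] {D : Type u} [DGCategory.{w, v} K D] {ι : Type u'}

/-- The full dg subcategory given by a family of objects of a dg category. -/
@[nolint unusedArguments]
def InducedDG (K : Type w) [CommRing K] {D : Type u} [DGCategory.{w, v} K D] (_φ : ι → D) :
    Type u' := ι

variable (φ : ι → D)

instance : DGCategory.{w, v} K (InducedDG K φ) where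
  Hom i j n := DGHom K (φ i) (φ j) n
  d h := d h
  id i := DGCategory.id (φ i)
  comp h := comp h
  d_d h h' f := d_d h h' f
  id_comp f := id_comp f
  comp_id f := comp_id f
  assoc h₁ h₂ h₃ h₄ f g k := assoc h₁ h₂ h₃ h₄ f g k
  d_comp h hp hn hm h₁ h₂ g f := d_comp h hp hn hm h₁ h₂ g f

namespace InducedDG

/-- The inclusion of a full dg subcategory. -/
def incl : DGFunctor K (InducedDG K φ) D where
  obj i := φ i
  map _ := LinearMap.id
  map_d _ _ := rfl
  map_id _ := rfl
  map_comp _ _ _ := rfl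

lemma incl_bijective (i j : InducedDG K φ) (n : ℤ) :
    Function.Bijective ((incl (K := K) φ).map (A := i) (B := j) n) := Function.bijective_id

instance : (incl (K := K) φ).mapH0.Full := DGFunctor.mapH0_full _ (incl_bijective φ)

instance : (incl (K := K) φ).mapH0.Faithful := DGFunctor.mapH0_faithful _ (incl_bijective φ)

/-- The restriction of right dg modules to a full dg subcategory. -/
def res : DGFunctor K (DGMod K D) (DGMod K (InducedDG K φ)) where
  obj M :=
    { obj := fun i => M.obj (Opposite.op (φ i.unop))
      map := fun {i j} n => M.map (A := Opposite.op (φ i.unop)) (B := Opposite.op (φ j.unop)) n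
      map_d := fun {i j n m} h f =>
        M.map_d (A := Opposite.op (φ i.unop)) (B := Opposite.op (φ j.unop)) h f
      map_id := fun i => M.map_id (Opposite.op (φ i.unop))
      map_comp := fun {i j k n m p} h g f => M.map_comp (X := Opposite.op (φ i.unop))
        (Y := Opposite.op (φ j.unop)) (Z := Opposite.op (φ k.unop)) h g f }
  map {M N} n :=
    { toFun := fun ψ => ⟨fun i => ψ.1 (Opposite.op (φ i.unop)), fun i j m p h h' f =>
        DGFunctor.natTrans_comm ψ (A := Opposite.op (φ i.unop)) (B := Opposite.op (φ j.unop))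
          h h' f⟩
      map_add' := fun _ _ => rfl
      map_smul' := fun _ _ => rfl }
  map_d _ _ := rfl
  map_id _ := rfl
  map_comp _ _ _ := rfl

/-- The right dg modules over a full dg subcategory given by the objects of the dg category. -/
def restrictedYoneda : DGFunctor K D (DGMod K (InducedDG K φ)) :=
  (yonedaDG K D).compose (res φ)

end InducedDG

end Restriction

/-! ### The dg enhancement of a triangulated category embedded in complexes. -/

section

open TriangleStructure Pretriangulated DGCategory

/-- The functor on homotopy categories induced by a composition of dg functors. -/
def DGFunctor.mapH0Compose {K : Type w} [CommRing K] {C : Type u} [DGCategory.{w, v} K C]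
    {D : Type u'} [DGCategory.{w, v'} K D] {E : Type u''} [DGCategory.{w, v''} K E]
    (F : DGFunctor K C D) (F' : DGFunctor K D E) :
    (F.compose F').mapH0 ≅ F.mapH0 ⋙ F'.mapH0 :=
  NatIso.ofComponents (fun _ => Iso.refl _) (by
    intro X Y f
    obtain ⟨f, rfl⟩ := (Quotient.functor _).map_surjective f
    exact (Category.comp_id _).trans (Category.id_comp _).symm)

variable {K : Type w} [CommRing K] {A : Type u} [Category.{v} A] [Preadditive A] [Linear K A]
  {T : Type u'} [Category.{v'} T] [Preadditive T] [Linear K T]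
  (G : T ⥤ HomotopyCategory A (ComplexShape.up ℤ))

/-- The full dg subcategory of the complexes in the image of a functor to the homotopy
category. -/
abbrev ImageDG (K : Type w) [CommRing K] [Linear K A]
    (G : T ⥤ HomotopyCategory A (ComplexShape.up ℤ)) : Type (max u' u'') :=
  InducedDG K (fun t : ULift.{u''} T => ((G.obj t.down).as : CochainComplex A ℤ))

namespace ImageDG

/-- The inclusion of the homotopy category of `ImageDG K G` in the homotopy category. -/
noncomputable def toHomotopyCategory :
    H0 K (ImageDG.{w, v, v', u, u', u''} K G) ⥤ HomotopyCategory A (ComplexShape.up ℤ) :=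
  (InducedDG.incl _).mapH0 ⋙ h0ToHomotopyCategory K A

instance : (toHomotopyCategory (K := K) G).Full := inferInstanceAs (_ ⋙ _ : _ ⥤ _).Full
instance : (toHomotopyCategory (K := K) G).Faithful := inferInstanceAs (_ ⋙ _ : _ ⥤ _).Faithful
instance : (toHomotopyCategory (K := K) G).Additive := inferInstanceAs (_ ⋙ _ : _ ⥤ _).Additive
instance : (toHomotopyCategory (K := K) G).Linear K := inferInstanceAs ((_ ⋙ _ : _ ⥤ _).Linear K)

variable [G.Full] [G.Faithful]

/-- The homotopy category of `ImageDG K G` is equivalent to the source of `G`. -/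
noncomputable def equiv : H0 K (ImageDG.{w, v, v', u, u', u''} K G) ⥤ T where
  obj X := X.as.obj.down
  map {X Y} f := G.preimage (X := X.as.obj.down) (Y := Y.as.obj.down)
    ((toHomotopyCategory G).map f)
  map_id X := G.map_injective ((G.map_preimage _).trans
    (((toHomotopyCategory G).map_id X).trans (G.map_id _).symm))
  map_comp f g := G.map_injective ((G.map_preimage _).trans
    (((toHomotopyCategory G).map_comp f g).trans ((congrArg₂ (· ≫ ·) (G.map_preimage _).symm
      (G.map_preimage _).symm).trans (G.map_comp _ _).symm)))

lemma map_equiv_map {X Y : H0 K (ImageDG.{w, v, v', u, u', u''} K G)} (f : X ⟶ Y) :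
    G.map ((equiv G).map f) = (toHomotopyCategory G).map f := G.map_preimage _

instance : (equiv (K := K) G).Full where
  map_surjective {X Y} f := by
    obtain ⟨g, hg⟩ := (toHomotopyCategory (K := K) G).map_surjective (X := X) (Y := Y) (G.map f)
    exact ⟨g, G.map_injective ((map_equiv_map G g).trans hg)⟩

instance : (equiv (K := K) G).Faithful where
  map_injective {X Y f g} h := (toHomotopyCategory G).map_injective
    ((map_equiv_map G f).symm.trans ((congrArg G.map h).trans (map_equiv_map G g)))

instance : (equiv (K := K) G).EssSurj where
  mem_essImage t := ⟨toH0 K (C := ImageDG K G) ⟨t⟩, ⟨Iso.refl _⟩⟩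

instance : (equiv (K := K) G).IsEquivalence where

instance [G.Additive] : (equiv (K := K) G).Additive where
  map_add {X Y f g} := G.map_injective (by
    rw [map_equiv_map, CategoryTheory.Functor.map_add, CategoryTheory.Functor.map_add,
      map_equiv_map, map_equiv_map]
    rfl)

instance [G.Additive] [G.Linear K] : (equiv (K := K) G).Linear K where
  map_smul {X Y} f a := G.map_injective (by
    rw [map_equiv_map, CategoryTheory.Functor.map_smul, CategoryTheory.Functor.map_smul,
      map_equiv_map]
    rfl)

/-- The functor to dg modules over `ImageDG K G`. -/
noncomputable def toDGMod : T ⥤ H0 K (DGMod K (ImageDG.{w, v, v', u, u', u''} K G)) :=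
  G ⋙ homotopyCategoryToH0 K ⋙ (InducedDG.restrictedYoneda _).mapH0

/-- The functor to dg modules extends the Yoneda functor. -/
noncomputable def equivToDGModIso : equiv (K := K) G ⋙ toDGMod.{w, v, v', u, u', u''} G ≅
    yonedaH0 K (ImageDG.{w, v, v', u, u', u''} K G) :=
  NatIso.ofComponents (fun X => Iso.refl _) (by
    intro X Y f
    obtain ⟨f, rfl⟩ := (Quotient.functor _).map_surjective f
    refine (Category.comp_id _).trans (Eq.trans ?_ (Category.id_comp _).symm)
    change (InducedDG.restrictedYoneda _).mapH0.map ((homotopyCategoryToH0 K).map (G.map _)) = _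
    rw [map_equiv_map]
    exact congrArg ((InducedDG.restrictedYoneda _).mapH0.map)
      (homotopyCategoryToH0_map_closedToHom K ((InducedDG.incl _).mapClosed f)))

variable [Limits.HasBinaryBiproducts A] [Limits.HasZeroObject A] [Limits.HasZeroObject T]
  [HasShift T ℤ] [∀ n : ℤ, (shiftFunctor T n).Additive] [Pretriangulated T] [G.Additive]

instance : (toDGMod.{w, v, v', u, u', u''} (K := K) G).Additive :=
  inferInstanceAs (_ ⋙ _ ⋙ _ : _ ⥤ _).Additive

/-- The functor to dg modules is isomorphic to the Yoneda functor after an equivalence. -/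
noncomputable def toDGModIso : (equiv (K := K) G).inv ⋙
      yonedaH0 K (ImageDG.{w, v, v', u, u', u''} K G) ≅ toDGMod.{w, v, v', u, u', u''} G :=
  Functor.isoWhiskerLeft _ (equivToDGModIso G).symm ≪≫
    Functor.isoWhiskerRight (equiv (K := K) G).asEquivalence.counitIso (toDGMod G)

/-- The restricted Yoneda functor need not be fully faithful on all complexes; on those in the image
of `G` it is the Yoneda functor of the full dg subcategory. -/
instance : (toDGMod.{w, v, v', u, u', u''} (K := K) G).Full := Functor.Full.of_iso (toDGModIso G)

instance : (toDGMod.{w, v, v', u, u', u''} (K := K) G).Faithful :=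
  Functor.Faithful.of_iso (toDGModIso G)

/-- This replaces the Yoneda functor by a functor whose source is already triangulated, as needed to
recognize its essential image as a triangulated subcategory. -/
lemma essImage_yonedaH0 : (yonedaH0 K (ImageDG.{w, v, v', u, u', u''} K G)).essImage =
    (toDGMod.{w, v, v', u, u', u''} (K := K) G).essImage := by
  ext M
  constructor
  · rintro ⟨X, ⟨e⟩⟩
    exact ⟨(equiv G).obj X, ⟨(equivToDGModIso G).app X ≪≫ e⟩⟩
  · rintro ⟨t, ⟨e⟩⟩
    exact ⟨(equiv G).inv.obj t, ⟨(toDGModIso G).app t ≪≫ e⟩⟩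

/-- After `G`, it remains to treat the functor from complexes to dg modules. Its exactness is tested
after the realization of dg modules, where the composite is induced by a dg functor between
complexes and `isExact_mapComplexes` applies. -/
lemma isExact_toDGMod (hG : (ofPretriangulated T).IsExact
    (ofPretriangulated (HomotopyCategory A (ComplexShape.up ℤ))) G) : (ofPretriangulated T).IsExact
    (dgModTriangles K (ImageDG.{w, v, v', u, u', u''} K G)) (toDGMod G) := by
  refine hG.comp ?_
  exact IsExact.of_comp (Ψ := realization K (DGMod K (ImageDG K G)))
    (isExact_mapH0_dgFun (realizationDG K _)) (isoClosed_dgFunTriangles K _ _)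
    (fun _ _ f => exists_distinguished_dgFunTriangles K _ _ f) (conesUnique_ofPretriangulated _)
    ((isExact_mapComplexes ((InducedDG.restrictedYoneda _).compose (realizationDG K _))).of_iso
      (Functor.isoWhiskerLeft (homotopyCategoryToH0 K) (Functor.isoWhiskerRight
        (DGFunctor.mapH0Compose _ _) (h0ToHomotopyCategory K _)))
      (isoClosed_ofPretriangulated _))

lemma isDGPretriangulated (hG : (ofPretriangulated T).IsExact
    (ofPretriangulated (HomotopyCategory A (ComplexShape.up ℤ))) G) :
     IsDGPretriangulated K (ImageDG.{w, v, v', u, u', u''} K G) := by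
  change (dgModTriangles K _).IsTriangulatedSubcategory (yonedaH0 K _).essImage
  rw [essImage_yonedaH0]
  have : (dgModTriangles K (ImageDG.{w, v, v', u, u', u''} K G)).shift.Full :=
    inferInstanceAs (dgFunTriangles K _ (ModuleCat K)).shift.Full
  have : (dgModTriangles K (ImageDG.{w, v, v', u, u', u''} K G)).shift.Faithful :=
    inferInstanceAs (dgFunTriangles K _ (ModuleCat K)).shift.Faithful
  exact (isExact_toDGMod G hG).isTriangulatedSubcategory_essImage (conesUnique_dgFunTriangles K _ _)

/-- Exactness is tested after `toDGMod G`, where the composite becomes the Yoneda functor, exact for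
the induced structure. -/
lemma isExact_equiv (hG : (ofPretriangulated T).IsExact
    (ofPretriangulated (HomotopyCategory A (ComplexShape.up ℤ))) G) :
    (h0Triangles K (isDGPretriangulated.{w, v, v', u, u', u''} (K := K) G hG)).IsExact
      (ofPretriangulated T) (equiv G) :=
  IsExact.of_comp (isExact_toDGMod G hG) (isoClosed_ofPretriangulated T)
    (hasCones_ofPretriangulated T) (conesUnique_dgFunTriangles K _ _)
    ((isExact_induced _ _ _).of_iso (equivToDGModIso G).symm (isoClosed_dgFunTriangles K _ _))

/-- A full triangulated subcategory of a homotopy category of complexes has a dg enhancement. -/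
noncomputable def enhancement [G.Linear K] (hG : (ofPretriangulated T).IsExact
    (ofPretriangulated (HomotopyCategory A (ComplexShape.up ℤ))) G) :
    DGEnhancement.{w, v, v', max u' u'', u'} K T (ofPretriangulated T) where
  C := ImageDG.{w, v, v', u, u', u''} K G
  pretriangulated := isDGPretriangulated G hG
  E := equiv G
  exact := isExact_equiv G hG

end ImageDG

end

/-! ### Split exact sequences in an additive category. -/

section Splittings

open Limits

variable {A : Type u} [Category.{v} A] [Preadditive A]

/-- The morphisms `i` and `p` form a split exact sequence. -/
def IsSplitSeq {X Y Z : A} (i : X ⟶ Y) (p : Y ⟶ Z) : Prop :=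
  ∃ (r : Y ⟶ X) (s : Z ⟶ Y), i ≫ r = 𝟙 X ∧ s ≫ p = 𝟙 Z ∧ r ≫ i + p ≫ s = 𝟙 Y

namespace IsSplitSeq

variable {X Y Z : A} {i : X ⟶ Y} {p : Y ⟶ Z}

lemma zero (h : IsSplitSeq i p) : i ≫ p = 0 := by
  obtain ⟨r, s, h₁, h₂, h₃⟩ := h
  have := congrArg (fun t => i ≫ t ≫ p) h₃
  simpa [reassoc_of% h₁, h₂] using this

lemma op (h : IsSplitSeq i p) : IsSplitSeq p.op i.op := by
  obtain ⟨r, s, h₁, h₂, h₃⟩ := h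
  refine ⟨s.op, r.op, ?_, ?_, ?_⟩
  · rw [← op_comp, h₂, op_id]
  · rw [← op_comp, h₁, op_id]
  · rw [← op_comp, ← op_comp, ← op_add, add_comm, h₃, op_id]

lemma unop {X Y Z : Aᵒᵖ} {i : X ⟶ Y} {p : Y ⟶ Z} (h : IsSplitSeq i p) :
    IsSplitSeq p.unop i.unop := by
  obtain ⟨r, s, h₁, h₂, h₃⟩ := h
  refine ⟨s.unop, r.unop, ?_, ?_, ?_⟩
  · rw [← unop_comp, h₂, unop_id]
  · rw [← unop_comp, h₁, unop_id]
  · rw [← unop_comp, ← unop_comp, ← unop_add, add_comm, h₃, unop_id]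

lemma exists_section (h : IsSplitSeq i p) (r : Y ⟶ X) (hr : i ≫ r = 𝟙 X) :
    ∃ s : Z ⟶ Y, s ≫ p = 𝟙 Z ∧ r ≫ i + p ≫ s = 𝟙 Y := by
  have h₀ := h.zero
  obtain ⟨r', s, h₁, h₂, h₃⟩ := h
  -- The section is corrected so that `r` kills it.
  refine ⟨s - s ≫ r ≫ i, by simp [h₀, h₂], ?_⟩
  have h₄ : p ≫ s = 𝟙 Y - r' ≫ i := by rw [← h₃, add_sub_cancel_left]
  rw [Preadditive.comp_sub, reassoc_of% h₄]
  simp [reassoc_of% hr, h₄]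

lemma of_iso {X' Y' Z' : A} {i' : X' ⟶ Y'} {p' : Y' ⟶ Z'} (h : IsSplitSeq i p) (a : X ≅ X')
    (b : Y ≅ Y') (c : Z ≅ Z') (h₁ : i ≫ b.hom = a.hom ≫ i') (h₂ : p ≫ c.hom = b.hom ≫ p') :
    IsSplitSeq i' p' := by
  obtain ⟨r, s, h₃, h₄, h₅⟩ := h
  have h₁' : i' ≫ b.inv = a.inv ≫ i := by rw [Iso.comp_inv_eq, Category.assoc, h₁]; simp
  refine ⟨b.inv ≫ r ≫ a.hom, c.inv ≫ s ≫ b.hom, ?_, ?_, ?_⟩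
  · rw [reassoc_of% h₁', reassoc_of% h₃, Iso.inv_hom_id]
  · simp only [Category.assoc, ← h₂, reassoc_of% h₄, Iso.inv_hom_id]
  · have h₂' : p' ≫ c.inv = b.inv ≫ p := by
      rw [Iso.comp_inv_eq, Category.assoc, h₂, Iso.inv_hom_id_assoc]
    have := congrArg (fun t => b.inv ≫ t ≫ b.hom) h₅
    simp only [Preadditive.add_comp, Preadditive.comp_add, Category.assoc, h₁, Category.id_comp,
      Iso.inv_hom_id] at this
    simpa only [Category.assoc, reassoc_of% h₂'] using this

lemma of_isZero_right (X : A) {Z : A} (hZ : IsZero Z) (p : X ⟶ Z) : IsSplitSeq (𝟙 X) p :=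
  ⟨𝟙 X, 0, by simp, hZ.eq_of_src _ _, by simp⟩

lemma of_isZero_left (X : A) {Z : A} (hZ : IsZero Z) (i : Z ⟶ X) : IsSplitSeq i (𝟙 X) :=
  ⟨0, 𝟙 X, hZ.eq_of_src _ _, by simp, by simp⟩

lemma of_isPushout (h : IsSplitSeq i p) {X' Y' : A} {f : X ⟶ X'} {f' : Y ⟶ Y'} {i' : X' ⟶ Y'}
    (sq : IsPushout i f f' i') {p' : Y' ⟶ Z} (h₁ : f' ≫ p' = p) (h₂ : i' ≫ p' = 0) :
    IsSplitSeq i' p' := by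
  obtain ⟨r, s, h₃, h₄, h₅⟩ := h
  refine ⟨sq.desc (r ≫ f) (𝟙 _) (by simp [reassoc_of% h₃]), s ≫ f', by simp, by simp [h₁, h₄], ?_⟩
  apply sq.hom_ext
  · rw [Preadditive.comp_add, sq.inl_desc_assoc, reassoc_of% h₁, Category.assoc, ← sq.w,
      ← Category.assoc, ← Category.assoc, ← Preadditive.add_comp, h₅]
    simp
  · rw [Preadditive.comp_add, sq.inr_desc_assoc, reassoc_of% h₂]
    simp

/-- The cokernel of `i ≫ j` is obtained from `W` by pushing out `j` along `p`. Retractions compose,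
and the section is glued from `s ≫ j` and the projector complementary to the image of `i ≫ j`. -/
lemma comp (h : IsSplitSeq i p) {W V : A} {j : Y ⟶ W} {q : W ⟶ V} (h' : IsSplitSeq j q) {U : A}
    {p' : W ⟶ U} {j' : Z ⟶ U} (sq : IsPushout j p p' j') : IsSplitSeq (i ≫ j) p' := by
  obtain ⟨r, s, h₁, h₂, h₃⟩ := h
  obtain ⟨r', s', h₁', h₂', h₃'⟩ := h'
  have h₄ : r ≫ i = 𝟙 _ - p ≫ s := by rw [← h₃, add_sub_cancel_right]
  refine ⟨r' ≫ r, sq.desc (𝟙 _ - r' ≫ r ≫ i ≫ j) (s ≫ j) ?_, ?_, ?_, ?_⟩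
  · rw [Preadditive.comp_sub, reassoc_of% h₁', reassoc_of% h₄]
    simp
  · rw [Category.assoc, reassoc_of% h₁', h₁]
  · apply sq.hom_ext
    · rw [sq.inl_desc_assoc, Preadditive.sub_comp, Category.assoc, Category.assoc, Category.assoc,
        sq.w, reassoc_of% h₄]
      simp [reassoc_of% h₂]
    · rw [sq.inr_desc_assoc, Category.assoc, sq.w, reassoc_of% h₂, Category.comp_id]
  · simp

/-- The exact sequence of a pushout square. The biproduct enters through its equations so that the
lemma applies in each degree to a biproduct of complexes. -/
lemma biprod_of_isPushout (h : IsSplitSeq i p) {X' Y' : A} {f : X ⟶ X'} {f' : Y ⟶ Y'}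
    {i' : X' ⟶ Y'} (sq : IsPushout i f f' i') {W : A} {inl : X' ⟶ W} {inr : Y ⟶ W} {fst : W ⟶ X'}
    {snd : W ⟶ Y} (inl_fst : inl ≫ fst = 𝟙 _) (inl_snd : inl ≫ snd = 0) (inr_fst : inr ≫ fst = 0)
    (inr_snd : inr ≫ snd = 𝟙 _) (total : fst ≫ inl + snd ≫ inr = 𝟙 _) :
    IsSplitSeq (f ≫ inl - i ≫ inr) (fst ≫ i' + snd ≫ f') := by
  obtain ⟨r, s, h₁, h₂, h₃⟩ := h
  have w := sq.w
  refine ⟨-(snd ≫ r), sq.desc (inr + r ≫ (f ≫ inl - i ≫ inr)) inl ?_, ?_, ?_, ?_⟩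
  · simp [reassoc_of% h₁]
  · simp [h₁, reassoc_of% inl_snd, reassoc_of% inr_snd]
  · apply sq.hom_ext
    · simp [w, reassoc_of% inl_snd, reassoc_of% inr_snd, reassoc_of% inl_fst, reassoc_of% inr_fst]
    · simp [reassoc_of% inl_snd, reassoc_of% inl_fst]
  · simp [← total]
    abel

variable [HasBinaryBiproducts A]

/-- As `Y` is the sum of `X` and `Z`, the pushout is the sum of `X'` and `Z`. -/
lemma hasPushout (h : IsSplitSeq i p) {X' : A} (f : X ⟶ X') : HasPushout i f := by
  obtain ⟨r, s, h₁, h₂, h₃⟩ := h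
  have h₀ : i ≫ p = 0 := zero ⟨r, s, h₁, h₂, h₃⟩
  have w : i ≫ biprod.lift (r ≫ f) p = f ≫ biprod.inl := by
    apply biprod.hom_ext <;> simp [reassoc_of% h₁, h₀]
  refine (IsPushout.of_isColimit' ⟨w⟩ (PushoutCocone.IsColimit.mk _
    (fun c => biprod.desc c.inr (s ≫ c.inl)) (fun c => ?_) (fun c => by simp)
      (fun c m hm₁ hm₂ => ?_))).hasPushout
  · have hc : i ≫ c.inl = f ≫ c.inr := c.condition
    rw [biprod.lift_desc, Category.assoc, ← hc, ← Category.assoc, ← Category.assoc,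
      ← Preadditive.add_comp, h₃, Category.id_comp]
  · have h₄ : s ≫ r = 0 := by
      have := congrArg (fun t => s ≫ t ≫ r) h₃
      simpa [h₁, reassoc_of% h₂] using this
    apply biprod.hom_ext'
    · rw [hm₂, biprod.inl_desc]
    · rw [biprod.inr_desc, ← hm₁, ← Category.assoc]
      congr 1
      apply biprod.hom_ext <;> simp [h₂, reassoc_of% h₄]

lemma of_isPullback (h : IsSplitSeq i p) {Z' Y' : A} {f : Z' ⟶ Z} {f' : Y' ⟶ Y} {p' : Y' ⟶ Z'}
    (sq : IsPullback f' p' p f) {i' : X ⟶ Y'} (h₁ : i' ≫ f' = i) (h₂ : i' ≫ p' = 0) :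
    IsSplitSeq i' p' :=
  (h.op.of_isPushout sq.op.flip (p' := i'.op) (by rw [← op_comp, h₁])
    (by rw [← op_comp, h₂, op_zero])).unop

lemma comp_of_isPullback (h : IsSplitSeq i p) {W V : A} {j : W ⟶ V} {q : V ⟶ Y}
    (h' : IsSplitSeq j q) {U : A} {i' : U ⟶ V} {q' : U ⟶ X} (sq : IsPullback i' q' q i) :
    IsSplitSeq i' (q ≫ p) :=
  (h.op.comp h'.op sq.op.flip).unop

lemma hasPullback (h : IsSplitSeq i p) {Z' : A} (f : Z' ⟶ Z) : HasPullback p f := by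
  have := h.op.hasPushout f.op
  exact (IsPushout.of_hasPushout p.op f.op).unop.flip.hasPullback

end IsSplitSeq

end Splittings

/-! ### Degreewise split sequences of complexes. -/

section DegreewiseSplit

open Limits HomologicalComplex

variable {A : Type u} [Category.{v} A] [Preadditive A]

/-- The morphisms `i` and `p` of complexes form a degreewise split exact sequence. -/
def IsDegreewiseSplit {X Y Z : CochainComplex A ℤ} (i : X ⟶ Y) (p : Y ⟶ Z) : Prop :=
  ∀ n, IsSplitSeq (i.f n) (p.f n)

namespace IsDegreewiseSplit

variable {X Y Z : CochainComplex A ℤ} {i : X ⟶ Y} {p : Y ⟶ Z}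

lemma zero (h : IsDegreewiseSplit i p) : i ≫ p = 0 := by
  ext n
  exact (h n).zero

lemma of_iso {X' Y' Z' : CochainComplex A ℤ} {i' : X' ⟶ Y'} {p' : Y' ⟶ Z'}
    (h : IsDegreewiseSplit i p) (a : X ≅ X') (b : Y ≅ Y') (c : Z ≅ Z')
    (h₁ : i ≫ b.hom = a.hom ≫ i') (h₂ : p ≫ c.hom = b.hom ≫ p') : IsDegreewiseSplit i' p' :=
  fun n => (h n).of_iso ((eval A _ n).mapIso a) ((eval A _ n).mapIso b) ((eval A _ n).mapIso c)
    (congr_hom h₁ n) (congr_hom h₂ n)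

lemma mono (h : IsDegreewiseSplit i p) : Mono i where
  right_cancellation a b hab := by
    ext n
    obtain ⟨r, s, h₁, -, -⟩ := h n
    have := congrArg (· ≫ r) (congr_hom hab n)
    simpa [h₁] using this

lemma epi (h : IsDegreewiseSplit i p) : Epi p where
  left_cancellation a b hab := by
    ext n
    obtain ⟨r, s, -, h₂, -⟩ := h n
    have := congrArg (s ≫ ·) (congr_hom hab n)
    simpa [reassoc_of% h₂] using this

lemma exists_lift (h : IsDegreewiseSplit i p) {W : CochainComplex A ℤ} (k : W ⟶ Y)
    (hk : k ≫ p = 0) : ∃ l : W ⟶ X, l ≫ i = k := by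
  choose r s h₁ h₂ h₃ using h
  have h₄ (n : ℤ) : (k.f n ≫ r n) ≫ i.f n = k.f n := by
    have := congrArg (k.f n ≫ ·) (h₃ n)
    rw [Category.comp_id, Preadditive.comp_add, ← Category.assoc (k.f n) (p.f n), ← comp_f, hk,
      zero_f, zero_comp, add_zero] at this
    rw [Category.assoc, this]
  refine ⟨{ f := fun n => k.f n ≫ r n, comm' := fun n m _ => ?_ }, ?_⟩
  · have : (k.f n ≫ r n) ≫ X.d n m = ((k.f n ≫ r n) ≫ X.d n m) ≫ i.f m ≫ r m := by
      rw [h₁, Category.comp_id]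
    rw [this, Category.assoc _ (X.d n m), ← i.comm_assoc, ← Category.assoc, h₄, k.comm_assoc]
  · ext n
    exact h₄ n

lemma exists_desc (h : IsDegreewiseSplit i p) {W : CochainComplex A ℤ} (k : Y ⟶ W)
    (hk : i ≫ k = 0) : ∃ l : Z ⟶ W, p ≫ l = k := by
  choose r s h₁ h₂ h₃ using h
  have h₄ (n : ℤ) : p.f n ≫ s n ≫ k.f n = k.f n := by
    have := congrArg (· ≫ k.f n) (h₃ n)
    rw [Category.id_comp, Preadditive.add_comp, Category.assoc (r n), ← comp_f, hk,
      zero_f, comp_zero, zero_add, Category.assoc] at this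
    exact this
  refine ⟨{ f := fun n => s n ≫ k.f n, comm' := fun n m _ => ?_ }, ?_⟩
  · have : Z.d n m ≫ s m ≫ k.f m = s n ≫ p.f n ≫ Z.d n m ≫ s m ≫ k.f m := by
      rw [reassoc_of% (h₂ n)]
    rw [this, p.comm_assoc, h₄, Category.assoc, k.comm]
  · ext n
    exact h₄ n

variable [HasBinaryBiproducts A]

/-- Colimits of complexes are computed degreewise, and in each degree the pushout exists because the
sequence splits there. -/
lemma exists_isPushout (h : IsDegreewiseSplit i p) {X' : CochainComplex A ℤ} (f : X ⟶ X') :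
    ∃ (Y' : CochainComplex A ℤ) (f' : Y ⟶ Y') (i' : X' ⟶ Y'), IsPushout i f f' i' ∧
      ∀ n, IsPushout (i.f n) (f.f n) (f'.f n) (i'.f n) := by
  have (n : ℤ) : HasColimit (span i f ⋙ eval A (ComplexShape.up ℤ) n) :=
    have : HasPushout ((eval A (ComplexShape.up ℤ) n).map i)
      ((eval A (ComplexShape.up ℤ) n).map f) := (h n).hasPushout (f.f n)
    hasColimit_of_iso (spanCompIso (eval A (ComplexShape.up ℤ) n) i f)
  exact ⟨_, _, _, IsPushout.of_hasPushout i f,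
    fun n => (IsPushout.of_hasPushout i f).map (eval A _ n)⟩

lemma exists_isPullback (h : IsDegreewiseSplit i p) {Z' : CochainComplex A ℤ} (f : Z' ⟶ Z) :
    ∃ (Y' : CochainComplex A ℤ) (f' : Y' ⟶ Y) (p' : Y' ⟶ Z'), IsPullback f' p' p f ∧
      ∀ n, IsPullback (f'.f n) (p'.f n) (p.f n) (f.f n) := by
  have (n : ℤ) : HasLimit (cospan p f ⋙ eval A (ComplexShape.up ℤ) n) :=
    have : HasPullback ((eval A (ComplexShape.up ℤ) n).map p)
      ((eval A (ComplexShape.up ℤ) n).map f) := (h n).hasPullback (f.f n)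
    hasLimit_of_iso (cospanCompIso (eval A (ComplexShape.up ℤ) n) p f).symm
  exact ⟨_, _, _, IsPullback.of_hasPullback p f,
    fun n => (IsPullback.of_hasPullback p f).map (eval A _ n)⟩

end IsDegreewiseSplit

end DegreewiseSplit

/-! ### Contractible complexes, and triangles of degreewise split sequences. -/

section ComplexTriangles

open Limits HomologicalComplex Pretriangulated CochainComplex

variable {A : Type u} [Category.{v} A] [Preadditive A]

/-- The family runs over all pairs of degrees, although only its terms lowering the degree by one
matter; this avoids casts. -/
lemma homotopy_zero_iff {X Y : CochainComplex A ℤ} (f : X ⟶ Y) :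
    Nonempty (Homotopy f 0) ↔ ∃ h : ∀ k l : ℤ, X.X k ⟶ Y.X l, ∀ n : ℤ,
      f.f n = X.d n (n + 1) ≫ h (n + 1) n + h n (n - 1) ≫ Y.d (n - 1) n := by
  constructor
  · rintro ⟨H⟩
    refine ⟨H.hom, fun n => ?_⟩
    rw [H.comm n, dNext_eq _ (show (ComplexShape.up ℤ).Rel n (n + 1) from rfl),
      prevD_eq _ (show (ComplexShape.up ℤ).Rel (n - 1) n from sub_add_cancel n 1), zero_f, add_zero]
  · rintro ⟨h, hh⟩
    refine ⟨(Homotopy.ofEq ?_).trans (Homotopy.nullHomotopy' fun k l _ => h k l)⟩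
    ext n
    rw [Homotopy.nullHomotopicMap'_f (c := ComplexShape.up ℤ) (sub_add_cancel n 1 : n - 1 + 1 = n)
      (rfl : n + 1 = n + 1), hh n]

/-- A family of morphisms of degree `-1` gives a nullhomotopic morphism. -/
lemma exists_homotopy_zero {X Y : CochainComplex A ℤ} (h : ∀ k l : ℤ, X.X k ⟶ Y.X l) :
    ∃ f : X ⟶ Y, Nonempty (Homotopy f 0) ∧ ∀ n : ℤ,
      f.f n = X.d n (n + 1) ≫ h (n + 1) n + h n (n - 1) ≫ Y.d (n - 1) n :=
  ⟨_, ⟨Homotopy.nullHomotopy' fun k l _ => h k l⟩, fun n =>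
    Homotopy.nullHomotopicMap'_f (c := ComplexShape.up ℤ) (sub_add_cancel n 1 : n - 1 + 1 = n)
      (rfl : n + 1 = n + 1) _⟩

/-- A complex is contractible if its identity is homotopic to zero. -/
def IsContractible (X : CochainComplex A ℤ) : Prop := Nonempty (Homotopy (𝟙 X) 0)

lemma IsContractible.homotopy_comp {X : CochainComplex A ℤ} (hX : IsContractible X)
    {Y Z : CochainComplex A ℤ} (f : Y ⟶ X) (g : X ⟶ Z) : Nonempty (Homotopy (f ≫ g) 0) := by
  obtain ⟨H⟩ := hX
  exact ⟨(Homotopy.ofEq (by simp)).trans (((H.compRight g).compLeft f).trans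
    (Homotopy.ofEq (by simp)))⟩

namespace IsDegreewiseSplit

variable {X Y Z : CochainComplex A ℤ} {i : X ⟶ Y} {p : Y ⟶ Z}

/-- If `f` is the boundary of a homotopy `t`, the boundary of `r ≫ t`, with `r` a degreewise
retraction of `i`, restricts to `f`. The retraction itself need not commute with the differentials.
-/
lemma exists_extension (h : IsDegreewiseSplit i p) {W : CochainComplex A ℤ} (f : X ⟶ W)
    (hf : Nonempty (Homotopy f 0)) : ∃ g : Y ⟶ W, i ≫ g = f := by
  choose r s h₁ h₂ h₃ using h
  obtain ⟨t, ht⟩ := (homotopy_zero_iff f).1 hf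
  obtain ⟨g, -, hg⟩ := exists_homotopy_zero fun k l => r k ≫ t k l
  refine ⟨g, ?_⟩
  ext n
  rw [comp_f, hg, ht, Preadditive.comp_add, i.comm_assoc, reassoc_of% h₁, Category.assoc,
    reassoc_of% h₁]

lemma exists_lifting (h : IsDegreewiseSplit i p) {W : CochainComplex A ℤ} (f : W ⟶ Z)
    (hf : Nonempty (Homotopy f 0)) : ∃ g : W ⟶ Y, g ≫ p = f := by
  choose r s h₁ h₂ h₃ using h
  obtain ⟨t, ht⟩ := (homotopy_zero_iff f).1 hf
  obtain ⟨g, -, hg⟩ := exists_homotopy_zero fun k l => t k l ≫ s l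
  refine ⟨g, ?_⟩
  ext n
  rw [comp_f, hg, ht, Preadditive.add_comp, Category.assoc, Category.assoc, h₂, Category.comp_id,
    Category.assoc, Category.assoc, ← p.comm, reassoc_of% h₂]

end IsDegreewiseSplit

variable [HasBinaryBiproducts A]

lemma isContractible_mappingCone_id (X : CochainComplex A ℤ) :
    IsContractible (mappingCone (𝟙 X)) := ⟨mappingCone.homotopyToZeroOfId X⟩

lemma coneProj_f {X Y : CochainComplex A ℤ} (φ : X ⟶ Y) (n : ℤ) :
    (coneProj φ).f n = -(mappingCone.fst φ).1.v n (n + 1) rfl := by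
  refine (mappingCone.ext_from_iff φ (n + 1) n rfl _ _).2 ⟨?_, ?_⟩
  · exact (mappingCone.inl_v_triangle_mor₃_f φ (n + 1) n (by lia)).trans
      (((Preadditive.comp_neg _ _).trans
        (congrArg Neg.neg (mappingCone.inl_v_fst_v φ (n + 1) n rfl))).symm)
  · exact (mappingCone.inr_f_triangle_mor₃_f φ n).trans (((Preadditive.comp_neg _ _).trans
      ((congrArg Neg.neg (mappingCone.inr_f_fst_v φ n (n + 1) rfl)).trans neg_zero)).symm)

lemma isDegreewiseSplit_mappingCone {X Y : CochainComplex A ℤ} (φ : X ⟶ Y) :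
    IsDegreewiseSplit (mappingCone.inr φ) (coneProj φ) := fun n => by
  obtain ⟨s, r, h₁, h₂, h₃⟩ := mappingCone.triangleRotateShortComplexSplitting φ n
  exact ⟨s, r, h₁, h₂, h₃⟩

variable [HasZeroObject A]

/-- The triangle attached to a degreewise split exact sequence which maps to the one given by the
cone of the identity. -/
lemma IsDegreewiseSplit.distTriang {X Y Z : CochainComplex A ℤ} {i : X ⟶ Y} {p : Y ⟶ Z}
    (h : IsDegreewiseSplit i p) (b : Y ⟶ mappingCone (𝟙 X)) (e : Z ⟶ X⟦(1 : ℤ)⟧)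
    (hb : i ≫ b = mappingCone.inr (𝟙 X)) (he : p ≫ e = b ≫ coneProj (𝟙 X)) :
    Triangle.mk ((HomotopyCategory.quotient A (ComplexShape.up ℤ)).map i)
      ((HomotopyCategory.quotient A (ComplexShape.up ℤ)).map p)
      ((HomotopyCategory.quotient A (ComplexShape.up ℤ)).map (-e) ≫
        ((HomotopyCategory.quotient A (ComplexShape.up ℤ)).commShiftIso (1 : ℤ)).hom.app X) ∈
      distTriang (HomotopyCategory A (ComplexShape.up ℤ)) := by
  -- The retraction is read off from `b`, so that the connecting morphism of the resulting splitting
  -- can be compared with `e`.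
  let r (n : ℤ) : Y.X n ⟶ X.X n := b.f n ≫ (mappingCone.snd (𝟙 X)).v n n (add_zero n)
  have hr (n : ℤ) : i.f n ≫ r n = 𝟙 _ := by
    have := congr_hom hb n
    dsimp only [r]
    rw [← comp_f_assoc, hb, mappingCone.inr_f_snd_v]
  choose s hs hs' using fun n => (h n).exists_section (r n) (hr n)
  let σ (n : ℤ) : ((ShortComplex.mk i p h.zero).map (eval A _ n)).Splitting :=
    { r := r n, s := s n, f_r := hr n, s_g := hs n, id := hs' n }
  -- The sign arises because `coneProj` is minus the projection `mappingCone.fst`.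
  have hσ : homOfDegreewiseSplit (ShortComplex.mk i p h.zero) σ = -e := by
    have := h.epi
    rw [← cancel_epi p, Preadditive.comp_neg, he]
    ext n
    rw [comp_f]
    erw [homOfDegreewiseSplit_f]
    refine Eq.trans ?_ (((congrArg (fun t => -(b.f n ≫ t)) (coneProj_f (𝟙 X) n)).trans
      (congrArg Neg.neg (Preadditive.comp_neg _ _))).trans (neg_neg _)).symm
    change p.f n ≫ s n ≫ Y.d n (n + 1) ≫ r (n + 1) = _
    have h₄ : p.f n ≫ s n = 𝟙 _ - r n ≫ i.f n := by rw [← hs' n, add_sub_cancel_left]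
    rw [reassoc_of% h₄, Preadditive.sub_comp, Category.id_comp, Category.assoc, i.comm_assoc, hr,
      Category.comp_id]
    refine sub_eq_iff_eq_add.2 ((b.comm_assoc _ _ _).symm.trans ((congrArg (b.f n ≫ ·)
      (mappingCone.d_snd_v (𝟙 X) n (n + 1) rfl)).trans ((Preadditive.comp_add _ _ _ _ _ _).trans
        (congrArg₂ (· + ·) (congrArg (b.f n ≫ ·) (Category.comp_id _))
          (Category.assoc _ _ _).symm))))
  have := (HomotopyCategory.distinguished_iff_iso_trianglehOfDegreewiseSplit _).2
    ⟨_, σ, ⟨Iso.refl _⟩⟩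
  rw [← hσ]
  exact this

end ComplexTriangles

/-! ### The exact category of complexes in a triangulated subcategory of K(A). -/

section FrobeniusComplexes

open Limits HomologicalComplex Pretriangulated CochainComplex TriangleStructure ZeroObject

variable {A : Type u} [Category.{v} A] [Preadditive A] [HasBinaryBiproducts A] [HasZeroObject A]
  {Q : ObjectProperty (HomotopyCategory A (ComplexShape.up ℤ))}

/-- The complexes whose homotopy class satisfies a property. -/
abbrev complexesOf (Q : ObjectProperty (HomotopyCategory A (ComplexShape.up ℤ))) :
    ObjectProperty (CochainComplex A ℤ) :=
  fun X => Q ((HomotopyCategory.quotient A (ComplexShape.up ℤ)).obj X)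

/-- The full subcategory of complexes whose homotopy class satisfies a property. -/
abbrev ComplexesOf (Q : ObjectProperty (HomotopyCategory A (ComplexShape.up ℤ))) : Type max u v :=
  (complexesOf Q).FullSubcategory

lemma IsContractible.isZero {X : CochainComplex A ℤ} (h : IsContractible X) :
    IsZero ((HomotopyCategory.quotient A (ComplexShape.up ℤ)).obj X) := by
  rw [IsZero.iff_id_eq_zero, ← CategoryTheory.Functor.map_id]
  exact (HomotopyCategory.eq_of_homotopy _ _ h.some).trans (CategoryTheory.Functor.map_zero _ _ _)

lemma TriangleStructure.IsTriangulatedSubcategory.of_isZero {S : Type u'} [Category.{v'} S]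
    {𝒮 : TriangleStructure S} {P : ObjectProperty S} (hP : 𝒮.IsTriangulatedSubcategory P) {X : S}
    (hX : IsZero X) : P X := by
  obtain ⟨Z, hZ, h⟩ := hP.exists_zero
  exact hP.of_iso (hZ.iso hX) h

variable [hQ : Fact ((ofPretriangulated
  (HomotopyCategory A (ComplexShape.up ℤ))).IsTriangulatedSubcategory Q)]

namespace ComplexesOf

lemma of_isContractible {X : CochainComplex A ℤ} (h : IsContractible X) : complexesOf Q X :=
  hQ.out.of_isZero h.isZero

lemma of_iso {X Y : CochainComplex A ℤ} (e : X ≅ Y) (h : complexesOf Q X) : complexesOf Q Y :=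
  hQ.out.of_iso ((HomotopyCategory.quotient A _).mapIso e) h

lemma shift_iff (X : CochainComplex A ℤ) : complexesOf Q (X⟦(1 : ℤ)⟧) ↔ complexesOf Q X := by
  let e := ((HomotopyCategory.quotient A (ComplexShape.up ℤ)).commShiftIso (1 : ℤ)).app X
  exact ⟨fun h => (hQ.out.shift_iff _).1 (hQ.out.of_iso e h),
    fun h => hQ.out.of_iso e.symm ((hQ.out.shift_iff _).2 h)⟩

/-- Closure under extensions: rotating the triangle backwards exhibits `Y` as the cone of a morphism
from `Z⟦-1⟧` to `X`. -/
lemma of_isDegreewiseSplit {X Y Z : CochainComplex A ℤ} {i : X ⟶ Y} {p : Y ⟶ Z}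
    (h : IsDegreewiseSplit i p) (hX : complexesOf Q X) (hZ : complexesOf Q Z) :
    complexesOf Q Y := by
  obtain ⟨b, hb⟩ := h.exists_extension (mappingCone.inr (𝟙 X)) (by
    simpa using (isContractible_mappingCone_id X).homotopy_comp (mappingCone.inr (𝟙 X)) (𝟙 _))
  obtain ⟨e, he⟩ := h.exists_desc (b ≫ coneProj (𝟙 X)) (by
    rw [reassoc_of% hb]
    exact mappingCone.inr_triangleδ (𝟙 X))
  have H := inv_rot_of_distTriang _ (h.distTriang b e hb he)
  exact hQ.out.of_distinguished _ _ _ H ((hQ.out.shift_iff _).1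
    (hQ.out.of_iso ((shiftEquiv _ (1 : ℤ)).counitIso.app _).symm hZ)) hX

instance : HasZeroObject (ComplexesOf Q) :=
  ⟨⟨⟨0, of_isContractible ⟨Homotopy.ofEq ((isZero_zero _).eq_of_src _ _)⟩⟩,
    IsZero.of_full_of_faithful_of_isZero (complexesOf Q).ι _ (isZero_zero _)⟩⟩

instance : HasBinaryBiproducts (ComplexesOf Q) where
  has_binary_biproduct X Y := by
    have h : IsDegreewiseSplit (biprod.inl : X.obj ⟶ X.obj ⊞ Y.obj) biprod.snd := fun n =>
      ⟨(biprod.fst : X.obj ⊞ Y.obj ⟶ X.obj).f n, (biprod.inr : Y.obj ⟶ X.obj ⊞ Y.obj).f n,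
        by rw [← comp_f, biprod.inl_fst, id_f], by rw [← comp_f, biprod.inr_snd, id_f],
        by rw [← comp_f, ← comp_f, ← add_f_apply, biprod.total, id_f]⟩
    let S : ComplexesOf Q := ⟨X.obj ⊞ Y.obj, of_isDegreewiseSplit h X.property Y.property⟩
    let b : BinaryBicone X Y :=
      { pt := S
        fst := ObjectProperty.homMk biprod.fst
        snd := ObjectProperty.homMk biprod.snd
        inl := ObjectProperty.homMk biprod.inl
        inr := ObjectProperty.homMk biprod.inr
        inl_fst := ObjectProperty.hom_ext _ biprod.inl_fst
        inl_snd := ObjectProperty.hom_ext _ biprod.inl_snd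
        inr_fst := ObjectProperty.hom_ext _ biprod.inr_fst
        inr_snd := ObjectProperty.hom_ext _ biprod.inr_snd }
    exact hasBinaryBiproduct_of_total b (ObjectProperty.hom_ext _ biprod.total)

/-- The degreewise split exact sequences. -/
abbrev splitSeq (Q : ObjectProperty (HomotopyCategory A (ComplexShape.up ℤ))) :
    ObjectProperty (ShortComplex (ComplexesOf Q)) :=
  fun S => IsDegreewiseSplit S.f.hom S.g.hom

lemma isInflation {X Y Z : ComplexesOf Q} {i : X ⟶ Y} {p : Y ⟶ Z}
    (h : IsDegreewiseSplit i.hom p.hom) : IsInflation (splitSeq Q) i :=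
  ⟨Z, p, ObjectProperty.hom_ext _ h.zero, h⟩

lemma isDeflation {X Y Z : ComplexesOf Q} {i : X ⟶ Y} {p : Y ⟶ Z}
    (h : IsDegreewiseSplit i.hom p.hom) : IsDeflation (splitSeq Q) p :=
  ⟨X, i, ObjectProperty.hom_ext _ h.zero, h⟩

lemma isPushout {X Y Z W : ComplexesOf Q} {f : X ⟶ Y} {g : X ⟶ Z} {h : Y ⟶ W} {k : Z ⟶ W}
    (sq : IsPushout f.hom g.hom h.hom k.hom) : IsPushout f g h k :=
  IsPushout.of_map_of_faithful (complexesOf Q).ι sq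

lemma isPullback {X Y Z W : ComplexesOf Q} {f : X ⟶ Y} {g : X ⟶ Z} {h : Y ⟶ W} {k : Z ⟶ W}
    (sq : IsPullback f.hom g.hom h.hom k.hom) : IsPullback f g h k :=
  IsPullback.of_map_of_faithful (complexesOf Q).ι sq

/-- The pushout formed among all complexes is an extension of `Z` by `X'`, hence stays in the
subcategory. -/
lemma exists_isPushout {X Y Z X' : ComplexesOf Q} {i : X ⟶ Y} {p : Y ⟶ Z}
    (h : IsDegreewiseSplit i.hom p.hom) (f : X ⟶ X') :
    ∃ (Y' : ComplexesOf Q) (f' : Y ⟶ Y') (i' : X' ⟶ Y') (p' : Y' ⟶ Z), IsPushout i f f' i' ∧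
      (∀ n, IsPushout (i.hom.f n) (f.hom.f n) (f'.hom.f n) (i'.hom.f n)) ∧ f' ≫ p' = p ∧
      IsDegreewiseSplit i'.hom p'.hom := by
  obtain ⟨Y', f', i', sq, sq'⟩ := h.exists_isPushout f.hom
  have h₁ : f' ≫ sq.desc p.hom 0 (by rw [h.zero, comp_zero]) = p.hom := sq.inl_desc _ _ _
  have h₂ : i' ≫ sq.desc p.hom 0 (by rw [h.zero, comp_zero]) = 0 := sq.inr_desc _ _ _
  have h' : IsDegreewiseSplit i' (sq.desc p.hom 0 (by rw [h.zero, comp_zero])) := fun n =>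
    (h n).of_isPushout (sq' n) (congr_hom h₁ n) (congr_hom h₂ n)
  exact ⟨⟨Y', of_isDegreewiseSplit h' X'.property Z.property⟩, ObjectProperty.homMk f',
    ObjectProperty.homMk i', ObjectProperty.homMk _, isPushout sq, sq',
    ObjectProperty.hom_ext _ h₁, h'⟩

lemma exists_isPullback {X Y Z Z' : ComplexesOf Q} {i : X ⟶ Y} {p : Y ⟶ Z}
    (h : IsDegreewiseSplit i.hom p.hom) (f : Z' ⟶ Z) :
    ∃ (Y' : ComplexesOf Q) (f' : Y' ⟶ Y) (p' : Y' ⟶ Z') (i' : X ⟶ Y'), IsPullback f' p' p f ∧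
      (∀ n, IsPullback (f'.hom.f n) (p'.hom.f n) (p.hom.f n) (f.hom.f n)) ∧
      IsDegreewiseSplit i'.hom p'.hom := by
  obtain ⟨Y', f', p', sq, sq'⟩ := h.exists_isPullback f.hom
  have h₁ : sq.lift i.hom 0 (by rw [h.zero, zero_comp]) ≫ f' = i.hom := sq.lift_fst _ _ _
  have h₂ : sq.lift i.hom 0 (by rw [h.zero, zero_comp]) ≫ p' = 0 := sq.lift_snd _ _ _
  have h' : IsDegreewiseSplit (sq.lift i.hom 0 (by rw [h.zero, zero_comp])) p' := fun n =>
    (h n).of_isPullback (sq' n) (congr_hom h₁ n) (congr_hom h₂ n)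
  exact ⟨⟨Y', of_isDegreewiseSplit h' X.property Z'.property⟩, ObjectProperty.homMk f',
    ObjectProperty.homMk p', ObjectProperty.homMk _, isPullback sq, sq', h'⟩

variable (Q) in
/-- The exact structure on complexes given by the degreewise split exact sequences. -/
def exactStructure : ExactStructure (ComplexesOf Q) where
  exactSeq := splitSeq Q
  of_iso {S S'} e h := IsDegreewiseSplit.of_iso h
    ((complexesOf Q).ι.mapIso (ShortComplex.π₁.mapIso e))
    ((complexesOf Q).ι.mapIso (ShortComplex.π₂.mapIso e))
    ((complexesOf Q).ι.mapIso (ShortComplex.π₃.mapIso e))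
    (congrArg (complexesOf Q).ι.map e.hom.comm₁₂.symm)
    (congrArg (complexesOf Q).ι.map e.hom.comm₂₃.symm)
  isKernel S h := by
    have : Mono ((complexesOf Q).ι.map S.f) := IsDegreewiseSplit.mono h
    have : Mono S.f := (complexesOf Q).ι.mono_of_mono_map this
    have H {W : ComplexesOf Q} (k : W ⟶ S.X₂) (hk : k ≫ S.g = 0) : ∃ l, l ≫ S.f = k := by
      obtain ⟨l, hl⟩ := IsDegreewiseSplit.exists_lift h k.hom (congrArg (complexesOf Q).ι.map hk)
      exact ⟨ObjectProperty.homMk l, ObjectProperty.hom_ext _ hl⟩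
    exact ⟨KernelFork.IsLimit.ofι' S.f S.zero fun k hk => ⟨(H k hk).choose, (H k hk).choose_spec⟩⟩
  isCokernel S h := by
    have : Epi ((complexesOf Q).ι.map S.g) := IsDegreewiseSplit.epi h
    have : Epi S.g := (complexesOf Q).ι.epi_of_epi_map this
    have H {W : ComplexesOf Q} (k : S.X₂ ⟶ W) (hk : S.f ≫ k = 0) : ∃ l, S.g ≫ l = k := by
      obtain ⟨l, hl⟩ := IsDegreewiseSplit.exists_desc h k.hom (congrArg (complexesOf Q).ι.map hk)
      exact ⟨ObjectProperty.homMk l, ObjectProperty.hom_ext _ hl⟩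
    exact ⟨CokernelCofork.IsColimit.ofπ' S.g S.zero fun k hk =>
      ⟨(H k hk).choose, (H k hk).choose_spec⟩⟩
  inflation_id X := isInflation (Z := (0 : ComplexesOf Q)) (p := 0) fun n =>
      IsSplitSeq.of_isZero_right _
    ((eval A _ n).map_isZero ((complexesOf Q).ι.map_isZero (isZero_zero _))) _
  deflation_id X := isDeflation (X := (0 : ComplexesOf Q)) (i := 0) fun n =>
      IsSplitSeq.of_isZero_left _
    ((eval A _ n).map_isZero ((complexesOf Q).ι.map_isZero (isZero_zero _))) _
  inflation_comp {X Y Z} i j := by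
    rintro ⟨C, p, -, h : IsDegreewiseSplit i.hom p.hom⟩
      ⟨D, q, -, h' : IsDegreewiseSplit j.hom q.hom⟩
    -- The cokernel of the composite is the pushout of `j` along the cokernel of `i`.
    obtain ⟨U, p', j', q', -, sq, -, -⟩ := exists_isPushout h' p
    exact isInflation (p := p') fun n => (h n).comp (h' n) (sq n)
  deflation_comp {X Y Z} q p := by
    rintro ⟨D, j, -, h' : IsDegreewiseSplit j.hom q.hom⟩
      ⟨C, i, -, h : IsDegreewiseSplit i.hom p.hom⟩
    obtain ⟨U, i', q', -, -, sq, -⟩ := exists_isPullback h' i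
    exact isDeflation (i := i') fun n => (h n).comp_of_isPullback (h' n) (sq n)
  inflation_pushout i f := by
    rintro ⟨C, p, -, h : IsDegreewiseSplit i.hom p.hom⟩
    obtain ⟨U, f', i', p', sq, -, -, h'⟩ := exists_isPushout h f
    exact ⟨U, f', i', sq, isInflation h'⟩
  deflation_pullback p f := by
    rintro ⟨C, i, -, h : IsDegreewiseSplit i.hom p.hom⟩
    obtain ⟨U, f', p', i', sq, -, h'⟩ := exists_isPullback h f
    exact ⟨U, f', p', sq, isDeflation h'⟩

end ComplexesOf

end FrobeniusComplexes

/-! ### The stable category of complexes inside the homotopy category. -/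

section StableComplexes

open Limits HomologicalComplex Pretriangulated CochainComplex TriangleStructure ZeroObject

variable {A : Type u} [Category.{v} A] [Preadditive A] [HasBinaryBiproducts A] [HasZeroObject A]

lemma IsDegreewiseSplit.exists_map_mappingCone {X Y Z : CochainComplex A ℤ} {i : X ⟶ Y}
    {p : Y ⟶ Z} (h : IsDegreewiseSplit i p) :
    ∃ (b : Y ⟶ mappingCone (𝟙 X)) (e : Z ⟶ X⟦(1 : ℤ)⟧), i ≫ b = mappingCone.inr (𝟙 X) ∧
      p ≫ e = b ≫ coneProj (𝟙 X) := by
  obtain ⟨b, hb⟩ := h.exists_extension (mappingCone.inr (𝟙 X)) (by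
    simpa using (isContractible_mappingCone_id X).homotopy_comp (mappingCone.inr (𝟙 X)) (𝟙 _))
  obtain ⟨e, he⟩ := h.exists_desc (b ≫ coneProj (𝟙 X)) (by
    rw [reassoc_of% hb]
    exact mappingCone.inr_triangleδ (𝟙 X))
  exact ⟨b, e, hb, he⟩

lemma mappingCone_id_map {X Y : CochainComplex A ℤ} (f : X ⟶ Y) :
    ∃ m : mappingCone (𝟙 X) ⟶ mappingCone (𝟙 Y),
      mappingCone.inr (𝟙 X) ≫ m = f ≫ mappingCone.inr (𝟙 Y) ∧
      m ≫ coneProj (𝟙 Y) = coneProj (𝟙 X) ≫ f⟦(1 : ℤ)⟧' :=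
  let H : Homotopy (𝟙 X ≫ f) (f ≫ 𝟙 Y) := Homotopy.ofEq (by simp)
  ⟨mappingCone.mapOfHomotopy H, mappingCone.triangleMapOfHomotopy_comm₂ H,
    mappingCone.triangleMapOfHomotopy_comm₃ H⟩

variable (Q : ObjectProperty (HomotopyCategory A (ComplexShape.up ℤ))) [hQ : Fact
  ((ofPretriangulated (HomotopyCategory A (ComplexShape.up ℤ))).IsTriangulatedSubcategory Q)]

namespace ComplexesOf

variable {Q}

/-- If `I` is injective, its inflation into the cone of its identity has a retraction, so the
identity of `I` factors through a contractible complex. Conversely, morphisms to a contractible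
complex are nullhomotopic and extend by `IsDegreewiseSplit.exists_extension`. -/
lemma isInjective_iff (I : ComplexesOf Q) :
    (exactStructure Q).IsInjective I ↔ IsContractible I.obj := by
  constructor
  · intro h
    let S : ComplexesOf Q :=
      ⟨mappingCone (𝟙 I.obj), of_isContractible (isContractible_mappingCone_id _)⟩
    let I' : ComplexesOf Q := ⟨I.obj⟦(1 : ℤ)⟧, (shift_iff _).2 I.property⟩
    let i : I ⟶ S := ObjectProperty.homMk (mappingCone.inr (𝟙 I.obj))
    let p : S ⟶ I' := ObjectProperty.homMk (coneProj (𝟙 I.obj))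
    have hi : IsDegreewiseSplit i.hom p.hom := isDegreewiseSplit_mappingCone _
    obtain ⟨g, hg⟩ := h (ShortComplex.mk i p (ObjectProperty.hom_ext _ hi.zero)) hi (𝟙 I)
    obtain ⟨H⟩ := (isContractible_mappingCone_id I.obj).homotopy_comp i.hom g.hom
    exact ⟨(Homotopy.ofEq (congrArg (complexesOf Q).ι.map hg).symm).trans H⟩
  · intro h S hS f
    obtain ⟨g, hg⟩ := IsDegreewiseSplit.exists_extension hS f.hom
      (by simpa using h.homotopy_comp f.hom (𝟙 _))
    exact ⟨ObjectProperty.homMk g, ObjectProperty.hom_ext _ hg⟩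

/-- The cone of the identity of `X⟦-1⟧` projects onto `X⟦-1⟧⟦1⟧`, which is isomorphic to `X`. -/
lemma exists_deflation (X : ComplexesOf Q) : ∃ (W P : ComplexesOf Q) (i : W ⟶ P) (p : P ⟶ X),
    IsDegreewiseSplit i.hom p.hom ∧ IsContractible P.obj := by
  let e : ((X.obj⟦(-1 : ℤ)⟧)⟦(1 : ℤ)⟧ : CochainComplex A ℤ) ≅ X.obj :=
    (shiftEquiv _ (1 : ℤ)).counitIso.app X.obj
  have hi := (isDegreewiseSplit_mappingCone (𝟙 (X.obj⟦(-1 : ℤ)⟧))).of_iso (Iso.refl _)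
    (Iso.refl _) e (i' := mappingCone.inr _) (p' := coneProj _ ≫ e.hom) (by simp) (by simp)
  exact ⟨⟨X.obj⟦(-1 : ℤ)⟧, (shift_iff _).1 (of_iso e.symm X.property)⟩,
    ⟨_, of_isContractible (isContractible_mappingCone_id _)⟩, ObjectProperty.homMk _,
    ObjectProperty.homMk _, hi, isContractible_mappingCone_id _⟩

lemma isProjective_iff (P : ComplexesOf Q) :
    (exactStructure Q).IsProjective P ↔ IsContractible P.obj := by
  constructor
  · intro h
    obtain ⟨W, P', i, p, hi, hP'⟩ := exists_deflation P
    obtain ⟨g, hg⟩ := h (ShortComplex.mk i p (ObjectProperty.hom_ext _ hi.zero)) hi (𝟙 P)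
    obtain ⟨H⟩ := hP'.homotopy_comp g.hom p.hom
    exact ⟨(Homotopy.ofEq (congrArg (complexesOf Q).ι.map hg).symm).trans H⟩
  · intro h S hS f
    obtain ⟨g, hg⟩ := IsDegreewiseSplit.exists_lifting hS f.hom
      (by simpa using h.homotopy_comp (𝟙 _) f.hom)
    exact ⟨ObjectProperty.homMk g, ObjectProperty.hom_ext _ hg⟩

variable (Q) in
lemma isFrobenius : (exactStructure Q).IsFrobenius where
  enoughInjectives X := by
    have hi := isDegreewiseSplit_mappingCone (𝟙 X.obj)
    have hc := isContractible_mappingCone_id X.obj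
    exact ⟨⟨_, of_isContractible hc⟩, ⟨X.obj⟦(1 : ℤ)⟧, (shift_iff _).2 X.property⟩,
      ObjectProperty.homMk _, ObjectProperty.homMk _, ObjectProperty.hom_ext _ hi.zero, hi,
      (isInjective_iff _).2 hc⟩
  enoughProjectives X := by
    obtain ⟨W, P, i, p, hi, hP⟩ := exists_deflation X
    exact ⟨W, P, i, p, ObjectProperty.hom_ext _ hi.zero, hi, (isProjective_iff _).2 hP⟩
  injective_iff_projective X := (isInjective_iff X).trans (isProjective_iff X).symm

/-- A nullhomotopic difference extends along the inclusion of `X` in the cone of its identity, hence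
factors through an injective; the converse holds because injectives are contractible. -/
lemma stableRel_iff {X Y : ComplexesOf Q} (f g : X ⟶ Y) :
    (exactStructure Q).stableRel f g ↔ Nonempty (Homotopy f.hom g.hom) := by
  constructor
  · rintro ⟨I, a, b, hI, h⟩
    obtain ⟨H⟩ := ((isInjective_iff _).1 hI).homotopy_comp a.hom b.hom
    exact ⟨Homotopy.equivSubZero.symm ((Homotopy.ofEq (congrArg (complexesOf Q).ι.map h)).trans H)⟩
  · rintro ⟨H⟩
    obtain ⟨b, hb⟩ := (isDegreewiseSplit_mappingCone (𝟙 X.obj)).exists_extension (f.hom - g.hom)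
      ⟨Homotopy.equivSubZero H⟩
    have hc := isContractible_mappingCone_id X.obj
    exact ⟨⟨_, of_isContractible hc⟩, ObjectProperty.homMk (mappingCone.inr _),
      ObjectProperty.homMk b, (isInjective_iff _).2 hc, ObjectProperty.hom_ext _ hb.symm⟩

variable (Q) in
/-- The functor from the stable category to the homotopy category. -/
def stableFunctor : (exactStructure Q).Stable ⥤ HomotopyCategory A (ComplexShape.up ℤ) :=
  CategoryTheory.Quotient.lift _ ((complexesOf Q).ι ⋙ HomotopyCategory.quotient A _)
    fun _ _ f g h => HomotopyCategory.eq_of_homotopy _ _ ((stableRel_iff f g).1 h).some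

instance : (stableFunctor Q).Full where
  map_surjective f := by
    obtain ⟨f, rfl⟩ := (HomotopyCategory.quotient A _).map_surjective f
    exact ⟨(Quotient.functor _).map (ObjectProperty.homMk f), rfl⟩

instance : (stableFunctor Q).Faithful where
  map_injective {X Y f g} h := by
    obtain ⟨f, rfl⟩ := (Quotient.functor _).map_surjective f
    obtain ⟨g, rfl⟩ := (Quotient.functor _).map_surjective g
    exact CategoryTheory.Quotient.sound _
      ((stableRel_iff f g).2 ⟨HomotopyCategory.homotopyOfEq _ _ h⟩)

instance : (stableFunctor Q).Additive where
  map_add {X Y f g} := by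
    obtain ⟨f, rfl⟩ := (Quotient.functor _).map_surjective f
    obtain ⟨g, rfl⟩ := (Quotient.functor _).map_surjective g
    exact (HomotopyCategory.quotient A _).map_add

instance {K : Type w} [CommRing K] [Linear K A] : (stableFunctor Q).Linear K where
  map_smul {X Y} f a := by
    obtain ⟨f, rfl⟩ := (Quotient.functor _).map_surjective f
    exact (HomotopyCategory.quotient A _).map_smul a f.hom

variable (hE : (exactStructure Q).IsFrobenius)

/-- The comparison of the chosen sequence with the one given by the cone of the identity. -/
noncomputable def shiftComparison (X : ComplexesOf Q) :
    (hE.shiftObj X).obj ⟶ X.obj⟦(1 : ℤ)⟧ :=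
  (IsDegreewiseSplit.exists_map_mappingCone (hE.exactSeq_ι_π X)).choose_spec.choose

lemma shiftComparison_spec (X : ComplexesOf Q) :
    ∃ b : (hE.inj X).obj ⟶ mappingCone (𝟙 X.obj), (hE.ι X).hom ≫ b = mappingCone.inr _ ∧
      (hE.π X).hom ≫ shiftComparison hE X = b ≫ coneProj (𝟙 X.obj) :=
  ⟨_, (IsDegreewiseSplit.exists_map_mappingCone (hE.exactSeq_ι_π X)).choose_spec.choose_spec⟩

/-- The class of `-shiftComparison hE X` in the homotopy category. -/
noncomputable def shiftComparisonQuotient (X : ComplexesOf Q) :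
    (HomotopyCategory.quotient A (ComplexShape.up ℤ)).obj (hE.shiftObj X).obj ⟶
      ((HomotopyCategory.quotient A (ComplexShape.up ℤ)).obj X.obj)⟦(1 : ℤ)⟧ :=
  (HomotopyCategory.quotient A (ComplexShape.up ℤ)).map (-shiftComparison hE X) ≫
    ((HomotopyCategory.quotient A (ComplexShape.up ℤ)).commShiftIso (1 : ℤ)).hom.app X.obj

/-- The minus sign in `shiftComparisonQuotient` is the one of `IsDegreewiseSplit.distTriang`: the
chosen sequence is mapped to the one of the cone of the identity, and `e` is composed with this
comparison. -/
lemma distTriang_of_exactSeq {X Y Z : ComplexesOf Q} {i : X ⟶ Y} {p : Y ⟶ Z}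
    (h : IsDegreewiseSplit i.hom p.hom) (b : Y ⟶ hE.inj X) (e : Z ⟶ hE.shiftObj X)
    (hb : i ≫ b = hE.ι X) (he : p ≫ e = b ≫ hE.π X) :
    Triangle.mk ((HomotopyCategory.quotient A (ComplexShape.up ℤ)).map i.hom)
      ((HomotopyCategory.quotient A (ComplexShape.up ℤ)).map p.hom)
      ((HomotopyCategory.quotient A (ComplexShape.up ℤ)).map e.hom ≫
        shiftComparisonQuotient hE X) ∈ distTriang (HomotopyCategory A (ComplexShape.up ℤ)) := by
  obtain ⟨β, hβ, hβ'⟩ := shiftComparison_spec hE X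
  have hb' : i.hom ≫ b.hom = (hE.ι X).hom := congrArg (complexesOf Q).ι.map hb
  have he' : p.hom ≫ e.hom = b.hom ≫ (hE.π X).hom := congrArg (complexesOf Q).ι.map he
  have := h.distTriang (b.hom ≫ β) (e.hom ≫ shiftComparison hE X) (by rw [reassoc_of% hb', hβ])
    (by rw [reassoc_of% he', hβ', Category.assoc])
  have h₁ : (HomotopyCategory.quotient A (ComplexShape.up ℤ)).map e.hom ≫
      shiftComparisonQuotient hE X = (HomotopyCategory.quotient A (ComplexShape.up ℤ)).map
        (-(e.hom ≫ shiftComparison hE X)) ≫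
      ((HomotopyCategory.quotient A (ComplexShape.up ℤ)).commShiftIso (1 : ℤ)).hom.app X.obj := by
    rw [← Preadditive.comp_neg, CategoryTheory.Functor.map_comp, Category.assoc]
    rfl
  rw [h₁]
  exact this

/-- The preceding triangle for the chosen sequence itself has a contractible middle term, so its
third morphism is invertible. -/
lemma isIso_shiftComparisonQuotient (X : ComplexesOf Q) :
    IsIso (shiftComparisonQuotient hE X) := by
  have H := distTriang_of_exactSeq hE (i := hE.ι X) (p := hE.π X) (hE.exactSeq_ι_π X) (𝟙 _)
    (𝟙 (hE.shiftObj X)) (Category.comp_id _) ((Category.comp_id _).trans (Category.id_comp _).symm)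
  have h : IsIso ((HomotopyCategory.quotient A (ComplexShape.up ℤ)).map
      ((complexesOf Q).ι.map (𝟙 (hE.shiftObj X))) ≫ shiftComparisonQuotient hE X) :=
    (Triangle.isZero₂_iff_isIso₃ _ H).1 ((isInjective_iff _).1 (hE.isInjective_inj X)).isZero
  exact IsIso.of_isIso_comp_left ((HomotopyCategory.quotient A (ComplexShape.up ℤ)).map
    ((complexesOf Q).ι.map (𝟙 (hE.shiftObj X)))) _

/-- The compatibility of the shift functors of the stable category and of the homotopy category,
on objects. -/
noncomputable def shiftComparisonIso (X : ComplexesOf Q) :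
    (HomotopyCategory.quotient A (ComplexShape.up ℤ)).obj (hE.shiftObj X).obj ≅
      ((HomotopyCategory.quotient A (ComplexShape.up ℤ)).obj X.obj)⟦(1 : ℤ)⟧ :=
  have := isIso_shiftComparisonQuotient hE X
  asIso (shiftComparisonQuotient hE X)

/-- Both sides extend `f` to a morphism from the chosen sequence of `X` to the cone sequence of `Y`.
Two such extensions differ on the third terms by a morphism through the cone of the identity of `Y`.
-/
lemma shiftComparison_naturality {X Y : ComplexesOf Q} (f : X ⟶ Y)
    (v : hE.shiftObj X ⟶ hE.shiftObj Y) (hv : hE.Induces f v) :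
    (HomotopyCategory.quotient A (ComplexShape.up ℤ)).map (v.hom ≫ shiftComparison hE Y) =
      (HomotopyCategory.quotient A (ComplexShape.up ℤ)).map
        (shiftComparison hE X ≫ f.hom⟦(1 : ℤ)⟧') := by
  obtain ⟨u, hu, hu'⟩ := hv
  obtain ⟨bX, hX, hX'⟩ := shiftComparison_spec hE X
  obtain ⟨bY, hY, hY'⟩ := shiftComparison_spec hE Y
  obtain ⟨m, hm, hm'⟩ := mappingCone_id_map f.hom
  have h₁ : (hE.ι X).hom ≫ u.hom = f.hom ≫ (hE.ι Y).hom := congrArg (complexesOf Q).ι.map hu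
  have h₂ : (hE.π X).hom ≫ v.hom = u.hom ≫ (hE.π Y).hom := congrArg (complexesOf Q).ι.map hu'
  have hs : IsDegreewiseSplit (hE.ι X).hom (hE.π X).hom := hE.exactSeq_ι_π X
  obtain ⟨t, ht⟩ := hs.exists_desc (u.hom ≫ bY - bX ≫ m) (by
    rw [Preadditive.comp_sub, reassoc_of% h₁, hY, reassoc_of% hX, hm, sub_self])
  have := hs.epi
  have h₃ : v.hom ≫ shiftComparison hE Y - shiftComparison hE X ≫ f.hom⟦(1 : ℤ)⟧' =
      t ≫ coneProj (𝟙 Y.obj) := by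
    rw [← cancel_epi (hE.π X).hom, reassoc_of% ht, Preadditive.comp_sub, reassoc_of% h₂, hY',
      reassoc_of% hX', Preadditive.sub_comp, Category.assoc, Category.assoc, hm']
  obtain ⟨H⟩ := (isContractible_mappingCone_id Y.obj).homotopy_comp t (coneProj (𝟙 Y.obj))
  exact HomotopyCategory.eq_of_homotopy _ _ (Homotopy.equivSubZero.symm
    ((Homotopy.ofEq h₃).trans H))

lemma isExact_stableFunctor : hE.triangles.IsExact
    (ofPretriangulated (HomotopyCategory A (ComplexShape.up ℤ))) (stableFunctor Q) := by
  have nat {X Y : ComplexesOf Q} (f : X ⟶ Y) (v : hE.shiftObj X ⟶ hE.shiftObj Y)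
      (hv : hE.Induces f v) : (HomotopyCategory.quotient A (ComplexShape.up ℤ)).map v.hom ≫
        shiftComparisonQuotient hE Y = shiftComparisonQuotient hE X ≫
          ((HomotopyCategory.quotient A (ComplexShape.up ℤ)).map f.hom)⟦(1 : ℤ)⟧' := by
    have h₁ := shiftComparison_naturality hE f v hv
    have h₂ : (HomotopyCategory.quotient A (ComplexShape.up ℤ)).map (f.hom⟦(1 : ℤ)⟧') ≫
        ((HomotopyCategory.quotient A (ComplexShape.up ℤ)).commShiftIso (1 : ℤ)).hom.app Y.obj =
        ((HomotopyCategory.quotient A (ComplexShape.up ℤ)).commShiftIso (1 : ℤ)).hom.app X.obj ≫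
          ((HomotopyCategory.quotient A (ComplexShape.up ℤ)).map f.hom)⟦(1 : ℤ)⟧' :=
      ((HomotopyCategory.quotient A (ComplexShape.up ℤ)).commShiftIso (1 : ℤ)).hom.naturality f.hom
    rw [CategoryTheory.Functor.map_comp, CategoryTheory.Functor.map_comp] at h₁
    unfold shiftComparisonQuotient
    rw [CategoryTheory.Functor.map_neg, CategoryTheory.Functor.map_neg, Category.assoc, ← h₂,
      Preadditive.neg_comp, Preadditive.neg_comp, Preadditive.comp_neg, reassoc_of% h₁]
  let η : hE.triangles.shift ⋙ stableFunctor Q ≅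
      stableFunctor Q ⋙ CategoryTheory.shiftFunctor _ (1 : ℤ) :=
    NatIso.ofComponents (fun X => shiftComparisonIso hE X.as) (by
      intro X Y f
      obtain ⟨f, rfl⟩ := (Quotient.functor _).map_surjective f
      exact nat f _ (hE.exists_induces f).choose_spec)
  refine ⟨η, ?_⟩
  rintro X Y Z f g h ⟨X', Y', Z', i, p, w, b, e, α, β, γ, hi, hb, he, h₁, h₂, h₃⟩
  let Φ := stableFunctor Q
  refine distTriang_of_iso (distTriang_of_exactSeq hE (i := i) (p := p) hi b e hb he)
    (Φ.mapIso α) (Φ.mapIso β)    (Φ.mapIso γ) ?_ ?_ ?_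
  · exact (Φ.map_comp _ _).symm.trans ((congrArg Φ.map h₁).trans (Φ.map_comp _ _))
  · exact (Φ.map_comp _ _).symm.trans ((congrArg Φ.map h₂).trans (Φ.map_comp _ _))
  · have h₄ := (Φ.map_comp _ _).symm.trans ((congrArg Φ.map h₃).trans (Φ.map_comp _ _))
    have h₅ := η.hom.naturality α.hom
    exact (Category.assoc _ _ _).trans ((congrArg (Φ.map h ≫ ·) h₅.symm).trans
      ((Category.assoc _ _ _).symm.trans ((congrArg (· ≫ shiftComparisonQuotient hE X') h₄).trans
        (Category.assoc _ _ _))))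

end ComplexesOf

end StableComplexes

/-! ### The stable category attached to an embedding in a homotopy category. -/

section

open Limits HomologicalComplex Pretriangulated CochainComplex TriangleStructure

lemma ExactStructure.IsFrobenius.isoClosed_triangles {F : Type u} [Category.{v} F] [Preadditive F]
    [HasBinaryBiproducts F] [HasZeroObject F] {E : ExactStructure F} (hE : E.IsFrobenius) :
    hE.triangles.IsoClosed := by
  rintro X Y Z X' Y' Z' f g h f' g' h' a b c h₁ h₂ h₃
    ⟨A, B, C, i, p, w, b₀, e, α, β, γ, H, hb, he, h₄, h₅, h₆⟩
  refine ⟨A, B, C, i, p, w, b₀, e, a ≪≫ α, b ≪≫ β, c ≪≫ γ, H, hb, he, ?_, ?_, ?_⟩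
  · simp only [Iso.trans_hom, Category.assoc, reassoc_of% h₁, h₄]
  · simp only [Iso.trans_hom, Category.assoc, reassoc_of% h₂, h₅]
  · have h₃' : h ≫ hE.shift.map a.hom = c.hom ≫ h' := h₃
    refine (congrArg (h ≫ ·) (hE.shift.map_comp a.hom α.hom)).trans
      ((Category.assoc _ _ _).symm.trans ((congrArg (· ≫ hE.shift.map α.hom) h₃').trans
      ((Category.assoc _ _ _).trans ((congrArg (c.hom ≫ ·) h₆).trans (Category.assoc _ _ _).symm))))

variable {A : Type u} [Category.{v} A] [Preadditive A] [HasBinaryBiproducts A] [HasZeroObject A]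

namespace ComplexesOf

variable {Q : ObjectProperty (HomotopyCategory A (ComplexShape.up ℤ))} [hQ : Fact
  ((ofPretriangulated (HomotopyCategory A (ComplexShape.up ℤ))).IsTriangulatedSubcategory Q)]
  (hE : (exactStructure Q).IsFrobenius)

lemma isDegreewiseSplit_of_isPushout {X Y Z X' Y' : ComplexesOf Q} {i : X ⟶ Y} {p : Y ⟶ Z}
    (h : IsDegreewiseSplit i.hom p.hom) {f : X ⟶ X'} {f' : Y ⟶ Y'} {i' : X' ⟶ Y'}
    (sq : ∀ n, IsPushout (i.hom.f n) (f.hom.f n) (f'.hom.f n) (i'.hom.f n)) :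
    IsDegreewiseSplit (f ≫ biprod.inl - i ≫ biprod.inr : X ⟶ X' ⊞ Y).hom
      (biprod.fst ≫ i' + biprod.snd ≫ f').hom := fun n =>
  let Φ := (complexesOf Q).ι ⋙ eval A (ComplexShape.up ℤ) n
  (h n).biprod_of_isPushout (sq n)
    (((Φ.map_comp _ _).symm.trans (Φ.congr_map biprod.inl_fst)).trans (Φ.map_id _))
    ((Φ.map_comp _ _).symm.trans (Φ.congr_map biprod.inl_snd))
    ((Φ.map_comp _ _).symm.trans (Φ.congr_map biprod.inr_fst))
    (((Φ.map_comp _ _).symm.trans (Φ.congr_map biprod.inr_snd)).trans (Φ.map_id _))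
    (Φ.congr_map (biprod.total (X := X') (Y := Y)))

/-- Pushing out the inflation of `X` into an injective along `f` gives an exact sequence from `X` to
`Y ⊞ hE.inj X` to the pushout. The injective summand vanishes stably, so the middle term becomes `Y`
and the first morphism becomes `f`. -/
lemma hasCones : hE.triangles.HasCones := by
  rintro ⟨X⟩ ⟨Y⟩ f
  obtain ⟨f, rfl⟩ := (Quotient.functor _).map_surjective f
  have hs : IsDegreewiseSplit (hE.ι X).hom (hE.π X).hom := hE.exactSeq_ι_π X
  obtain ⟨Z, f', i', -, -, sq, -, -⟩ := exists_isPushout hs f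
  have H := isDegreewiseSplit_of_isPushout hs sq
  have w : (f ≫ biprod.inl - hE.ι X ≫ biprod.inr) ≫ (biprod.fst ≫ i' + biprod.snd ≫ f') = 0 :=
    ObjectProperty.hom_ext _ H.zero
  obtain ⟨b, hb⟩ : ∃ b, (f ≫ biprod.inl - hE.ι X ≫ biprod.inr) ≫ b = hE.ι X :=
    hE.isInjective_inj X (ShortComplex.mk _ _ w) H (hE.ι X)
  obtain ⟨e, he⟩ := H.exists_desc (b ≫ hE.π X).hom
    (congrArg (complexesOf Q).ι.map ((Category.assoc _ _ _).symm.trans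
      ((congrArg (· ≫ hE.π X) hb).trans (hE.ι_π X))))
  have rel {V W : ComplexesOf Q} (a a' : V ⟶ W) (k : V ⟶ hE.inj X) (l : hE.inj X ⟶ W)
      (h : a - a' = k ≫ l) : (Quotient.functor (exactStructure Q).stableRel).map a =
        (Quotient.functor (exactStructure Q).stableRel).map a' :=
    CategoryTheory.Quotient.sound _ ⟨_, k, l, hE.isInjective_inj X, h⟩
  let β : (Quotient.functor (exactStructure Q).stableRel).obj Y ≅
      (Quotient.functor (exactStructure Q).stableRel).obj (Y ⊞ hE.inj X) :=
    { hom := (Quotient.functor _).map biprod.inl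
      inv := (Quotient.functor _).map biprod.fst
      hom_inv_id := by
        rw [← CategoryTheory.Functor.map_comp, biprod.inl_fst, CategoryTheory.Functor.map_id]
      inv_hom_id := by
        rw [← CategoryTheory.Functor.map_comp, ← CategoryTheory.Functor.map_id]
        refine rel _ _ biprod.snd (-biprod.inr) ?_
        rw [Preadditive.comp_neg, eq_neg_iff_add_eq_zero, sub_add_eq_add_sub, biprod.total,
          sub_self] }
  refine ⟨_, (Quotient.functor _).map i', (Quotient.functor _).map (ObjectProperty.homMk e), X,
    Y ⊞ hE.inj X, Z, _, _, w, b, ObjectProperty.homMk e, Iso.refl _, β, Iso.refl _, H, hb,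
    ObjectProperty.hom_ext _ he, ?_, ?_, ?_⟩
  · refine Eq.trans ?_ (Category.id_comp _).symm
    refine ((Quotient.functor _).map_comp _ _).symm.trans (rel _ _ (hE.ι X) biprod.inr ?_)
    rw [sub_sub_cancel]
  · refine (Category.comp_id _).trans ?_
    refine Eq.trans ?_ ((Quotient.functor _).map_comp _ _)
    rw [Preadditive.comp_add, biprod.inl_fst_assoc, biprod.inl_snd_assoc, zero_comp, add_zero]
  · exact (congrArg ((Quotient.functor _).map (ObjectProperty.homMk e) ≫ ·)
      (hE.shift.map_id _)).trans
      ((Category.comp_id _).trans (Category.id_comp _).symm)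

end ComplexesOf

/-- A triangulated category which embeds in a homotopy category of complexes is equivalent to the
stable category of a Frobenius category. -/
lemma exists_frobenius_of_homotopyCategory {K : Type w} [CommRing K] [Linear K A]
    {T : Type u'} [Category.{v'} T] [Preadditive T] [Linear K T] [HasZeroObject T] [HasShift T ℤ]
    [∀ n : ℤ, (CategoryTheory.shiftFunctor T n).Additive] [Pretriangulated T]
    (G : T ⥤ HomotopyCategory A (ComplexShape.up ℤ)) [G.Additive] [G.Linear K] [G.Full]
    [G.Faithful] (hG : (ofPretriangulated T).IsExact
      (ofPretriangulated (HomotopyCategory A (ComplexShape.up ℤ))) G) :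
    ∃ (F : Type (max u v)) (_ : Category.{v} F) (_ : Preadditive F) (_ : Linear K F)
      (_ : HasBinaryBiproducts F) (_ : HasZeroObject F) (E : ExactStructure F)
      (hE : E.IsFrobenius) (G : T ⥤ E.Stable), G.Additive ∧ G.Linear K ∧
        (ofPretriangulated T).IsExact hE.triangles G ∧ G.IsEquivalence := by
  have : (ofPretriangulated (HomotopyCategory A (ComplexShape.up ℤ))).shift.Full :=
    inferInstanceAs (CategoryTheory.shiftFunctor _ (1 : ℤ)).Full
  have : (ofPretriangulated (HomotopyCategory A (ComplexShape.up ℤ))).shift.Faithful :=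
    inferInstanceAs (CategoryTheory.shiftFunctor _ (1 : ℤ)).Faithful
  -- The complexes considered are those whose class lies in the essential image of `G`; the stable
  -- functor then has the same essential image as `G`, and `G` lifts through it to an equivalence.
  have hQ : Fact ((ofPretriangulated
      (HomotopyCategory A (ComplexShape.up ℤ))).IsTriangulatedSubcategory G.essImage) :=
    ⟨hG.isTriangulatedSubcategory_essImage (conesUnique_ofPretriangulated _)⟩
  let Φ := ComplexesOf.stableFunctor G.essImage
  have hΦ (X : T) : Φ.essImage (G.obj X) :=
    ⟨⟨⟨(G.obj X).as, G.obj_mem_essImage X⟩⟩, ⟨Iso.refl _⟩⟩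
  let L := Functor.essImage.liftFunctor G Φ hΦ
  let e : L ⋙ Φ ≅ G := Functor.essImage.liftFunctorCompIso G Φ hΦ
  have : (L ⋙ Φ).Full := Functor.Full.of_iso e.symm
  have : (L ⋙ Φ).Faithful := Functor.Faithful.of_iso e.symm
  have : L.Full := Functor.Full.of_comp_faithful L Φ
  have : L.Faithful := Functor.Faithful.of_comp L Φ
  have : (L ⋙ Φ).Additive := Functor.additive_of_iso e.symm
  have hL' : L.Additive := Functor.additive_of_comp_faithful L Φ
  have : (L ⋙ Φ).Linear K := Functor.linear_of_iso K e.symm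
  have hL : L.Linear K := ⟨fun f a => Φ.map_injective
    (((L ⋙ Φ).map_smul a f).trans (Φ.map_smul a (L.map f)).symm)⟩
  have : L.EssSurj := ⟨fun X => by
    obtain ⟨t, ⟨i⟩⟩ := X.as.property
    exact ⟨t, ⟨Φ.preimageIso (e.app t ≪≫ i)⟩⟩⟩
  exact ⟨ComplexesOf G.essImage, inferInstance, inferInstance, inferInstance, inferInstance,
    inferInstance, _,
    ComplexesOf.isFrobenius G.essImage, L, hL', hL,
    IsExact.of_comp (ComplexesOf.isExact_stableFunctor _)
        (ExactStructure.IsFrobenius.isoClosed_triangles _)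
      (ComplexesOf.hasCones _) (conesUnique_ofPretriangulated _)
      (hG.of_iso e.symm (isoClosed_ofPretriangulated _)), { }⟩

end

/-- Sequences indexed by the integers can be constructed inductively in both directions. -/
lemma exists_int_sequence {T : ℤ → Type u} (R : ∀ n, T n → T (n + 1) → Prop)
    (up : ∀ n x, ∃ y, R n x y) (down : ∀ n y, ∃ x, R n x y) (a : T (-1)) (b : T 0)
    (hab : R (-1) a b) : ∃ t : ∀ n, T n, t (-1) = a ∧ t 0 = b ∧ ∀ n, R n (t n) (t (n + 1)) := by
  choose u hu using up
  choose d hd using down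
  let pos : ∀ k : ℕ, T (Int.ofNat k) := fun k => Nat.rec b (fun k x => u (Int.ofNat k) x) k
  let neg : ∀ k : ℕ, T (Int.negSucc k) :=
    fun k => Nat.rec a (fun k x => d (Int.negSucc (k + 1)) x) k
  let t : ∀ n, T n := fun n => match n with
    | Int.ofNat k => pos k
    | Int.negSucc k => neg k
  refine ⟨t, rfl, rfl, fun n => ?_⟩
  match n with
  | Int.ofNat k => exact hu (Int.ofNat k) (pos k)
  | Int.negSucc 0 => exact hab
  | Int.negSucc (k + 1) => exact hd (Int.negSucc (k + 1)) (neg k)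

/-! ### Acyclic complexes of injectives and their objects of cocycles. -/

section AcyclicComplexes

open Limits ZeroObject CochainComplex CochainComplex.HomComplex

namespace ExactStructure

variable {F : Type u} [Category.{v} F] [Preadditive F] (E : ExactStructure F)

section

variable {E}

lemma mono_of_exactSeq {X Y Z : F} {i : X ⟶ Y} {p : Y ⟶ Z} {w : i ≫ p = 0}
    (h : E.exactSeq (ShortComplex.mk i p w)) : Mono i := by
  obtain ⟨l⟩ := E.isKernel _ h
  exact ⟨fun _ _ h => Fork.IsLimit.hom_ext l h⟩

lemma epi_of_exactSeq {X Y Z : F} {i : X ⟶ Y} {p : Y ⟶ Z} {w : i ≫ p = 0}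
    (h : E.exactSeq (ShortComplex.mk i p w)) : Epi p := by
  obtain ⟨l⟩ := E.isCokernel _ h
  exact ⟨fun _ _ h => Cofork.IsColimit.hom_ext l h⟩

lemma exists_lift_of_exactSeq {X Y Z : F} {i : X ⟶ Y} {p : Y ⟶ Z} {w : i ≫ p = 0}
    (h : E.exactSeq (ShortComplex.mk i p w)) {W : F} (k : W ⟶ Y) (hk : k ≫ p = 0) :
    ∃ l : W ⟶ X, l ≫ i = k := by
  obtain ⟨l⟩ := E.isKernel _ h
  exact ⟨l.lift (KernelFork.ofι k hk), l.fac _ WalkingParallelPair.zero⟩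

lemma exists_desc_of_exactSeq {X Y Z : F} {i : X ⟶ Y} {p : Y ⟶ Z} {w : i ≫ p = 0}
    (h : E.exactSeq (ShortComplex.mk i p w)) {W : F} (k : Y ⟶ W) (hk : i ≫ k = 0) :
    ∃ l : Z ⟶ W, p ≫ l = k := by
  obtain ⟨l⟩ := E.isCokernel _ h
  exact ⟨l.desc (CokernelCofork.ofπ k hk), l.fac _ WalkingParallelPair.one⟩

lemma IsInjective.exists_extension {X Y Z : F} {i : X ⟶ Y} {p : Y ⟶ Z} {w : i ≫ p = 0} {I : F}
    (hI : E.IsInjective I) (h : E.exactSeq (ShortComplex.mk i p w)) (f : X ⟶ I) :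
    ∃ g : Y ⟶ I, i ≫ g = f := hI _ h f

lemma IsProjective.exists_lifting {X Y Z : F} {i : X ⟶ Y} {p : Y ⟶ Z} {w : i ≫ p = 0} {P : F}
    (hP : E.IsProjective P) (h : E.exactSeq (ShortComplex.mk i p w)) (f : P ⟶ Z) :
    ∃ g : P ⟶ Y, g ≫ p = f := hP _ h f

/-- Morphisms of exact sequences to an exact sequence with an injective middle term which have
stably equivalent first components have stably equivalent third components. -/
lemma stableRel_of_exactSeq [HasBinaryBiproducts F] {X Y Z X' Y' Z' : F} {i : X ⟶ Y} {p : Y ⟶ Z}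
    {w : i ≫ p = 0} {i' : X' ⟶ Y'} {p' : Y' ⟶ Z'}
    (h : E.exactSeq (ShortComplex.mk i p w)) (w' : i' ≫ p' = 0) (hY' : E.IsInjective Y')
      {f f₁ : X ⟶ X'}
    {u u₁ : Y ⟶ Y'} {v v₁ : Z ⟶ Z'} (hf : i ≫ u = f ≫ i') (hv : p ≫ v = u ≫ p')
    (hf₁ : i ≫ u₁ = f₁ ≫ i') (hv₁ : p ≫ v₁ = u₁ ≫ p') (hff₁ : E.stableRel f f₁) :
    E.stableRel v v₁ := by
  obtain ⟨I, a, b, hI, hab⟩ := hff₁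
  obtain ⟨a', ha'⟩ := hI.exists_extension h a
  -- Extending the factorization of `f - f₁` over `Y` corrects `u - u₁` to a morphism that vanishes
  -- on `X`. The correction dies after `p'`, so `v - v₁` factors through `Y'`.
  obtain ⟨t, ht⟩ := exists_desc_of_exactSeq h (u - u₁ - a' ≫ b ≫ i') (by
    rw [Preadditive.comp_sub, Preadditive.comp_sub, hf, hf₁, reassoc_of% ha', ← Category.assoc a,
      ← hab, Preadditive.sub_comp, sub_self])
  have := epi_of_exactSeq h
  refine ⟨Y', t, p', hY', ?_⟩
  rw [← cancel_epi p, Preadditive.comp_sub, hv, hv₁, reassoc_of% ht]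
  simp [Preadditive.sub_comp, w']

end

/-- The full subcategory of injective objects. -/
abbrev InjObj : Type u := ObjectProperty.FullSubcategory (E.IsInjective : ObjectProperty F)

instance [HasZeroObject F] : HasZeroObject E.InjObj :=
  ⟨⟨⟨0, E.isInjective_of_isZero (isZero_zero F)⟩,
    IsZero.of_full_of_faithful_of_isZero
      (ObjectProperty.ι (E.IsInjective : ObjectProperty F)) _ (isZero_zero F)⟩⟩

instance [HasBinaryBiproducts F] : HasBinaryBiproducts E.InjObj where
  has_binary_biproduct X Y := by
    let S : E.InjObj := ⟨X.obj ⊞ Y.obj, X.property.biprod Y.property⟩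
    let b : BinaryBicone X Y :=
      { pt := S
        fst := ObjectProperty.homMk biprod.fst
        snd := ObjectProperty.homMk biprod.snd
        inl := ObjectProperty.homMk biprod.inl
        inr := ObjectProperty.homMk biprod.inr
        inl_fst := ObjectProperty.hom_ext _ biprod.inl_fst
        inl_snd := ObjectProperty.hom_ext _ biprod.inl_snd
        inr_fst := ObjectProperty.hom_ext _ biprod.inr_fst
        inr_snd := ObjectProperty.hom_ext _ biprod.inr_snd }
    exact hasBinaryBiproduct_of_total b (ObjectProperty.hom_ext _ biprod.total)

variable {E}

/-- The data exhibiting a complex of injective objects as acyclic. -/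
structure AcyclicData (C : CochainComplex E.InjObj ℤ) where
  Z : ℤ → F
  j : ∀ n, Z n ⟶ (C.X n).obj
  q : ∀ n, (C.X n).obj ⟶ Z (n + 1)
  w : ∀ n, j n ≫ q n = 0
  exact : ∀ n, E.exactSeq (ShortComplex.mk (j n) (q n) (w n))
  d_hom : ∀ n, (C.d n (n + 1)).hom = q n ≫ j (n + 1)

namespace AcyclicData

variable {C D : CochainComplex E.InjObj ℤ} (R : AcyclicData C) (S : AcyclicData D)

instance (n : ℤ) : Mono (R.j n) := mono_of_exactSeq (R.exact n)

instance (n : ℤ) : Epi (R.q n) := epi_of_exactSeq (R.exact n)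

/-- The morphism on cocycles propagates upwards because the terms of `D` are injective, and
downwards because those of `C` are also projective. -/
lemma exists_hom (hE : E.IsFrobenius) (z : R.Z 0 ⟶ S.Z 0) :
    ∃ φ : C ⟶ D, R.j 0 ≫ (φ.f 0).hom = z ≫ S.j 0 := by
  let Rel (n : ℤ) (z : R.Z n ⟶ S.Z n) (z' : R.Z (n + 1) ⟶ S.Z (n + 1)) : Prop :=
    ∃ φ : (C.X n).obj ⟶ (D.X n).obj, R.j n ≫ φ = z ≫ S.j n ∧ φ ≫ S.q n = R.q n ≫ z'
  have up (n : ℤ) (z : R.Z n ⟶ S.Z n) : ∃ z', Rel n z z' := by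
    obtain ⟨φ, hφ⟩ := (D.X n).property.exists_extension (R.exact n) (z ≫ S.j n)
    obtain ⟨z', hz'⟩ := exists_desc_of_exactSeq (R.exact n) (φ ≫ S.q n) (by
      rw [reassoc_of% hφ, S.w, comp_zero])
    exact ⟨z', φ, hφ, hz'.symm⟩
  have down (n : ℤ) (z' : R.Z (n + 1) ⟶ S.Z (n + 1)) : ∃ z, Rel n z z' := by
    obtain ⟨φ, hφ⟩ := ((hE.injective_iff_projective _).1 (C.X n).property).exists_lifting
      (S.exact n) (R.q n ≫ z')
    obtain ⟨z, hz⟩ := exists_lift_of_exactSeq (S.exact n) (R.j n ≫ φ) (by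
      rw [Category.assoc, hφ, reassoc_of% R.w, zero_comp])
    exact ⟨z, φ, hz.symm, hφ⟩
  -- A two-sided sequence starts from two consecutive values, so one step down is taken first.
  obtain ⟨a, ha⟩ := down (-1) (show R.Z (-1 + 1) ⟶ S.Z (-1 + 1) from z)
  obtain ⟨t, -, rfl, ht⟩ := exists_int_sequence Rel up down a z ha
  choose φ h₁ h₂ using ht
  refine ⟨{ f := fun n => ObjectProperty.homMk (φ n), comm' := ?_ }, h₁ 0⟩
  rintro n _ rfl
  refine ObjectProperty.hom_ext _ ?_
  change φ n ≫ (D.d n (n + 1)).hom = (C.d n (n + 1)).hom ≫ φ (n + 1)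
  rw [R.d_hom, S.d_hom, reassoc_of% h₂, Category.assoc, h₁]

lemma exists_cocycle_hom (φ : C ⟶ D) : ∃ z : R.Z 0 ⟶ S.Z 0, R.j 0 ≫ (φ.f 0).hom = z ≫ S.j 0 := by
  have h₁ : (φ.f 0).hom ≫ (D.d 0 (0 + 1)).hom = (C.d 0 (0 + 1)).hom ≫ (φ.f (0 + 1)).hom :=
    congrArg (ObjectProperty.ι (E.IsInjective : ObjectProperty F)).map (φ.comm 0 (0 + 1))
  obtain ⟨z, hz⟩ := exists_lift_of_exactSeq (S.exact 0) (R.j 0 ≫ (φ.f 0).hom) (by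
    rw [R.d_hom, S.d_hom] at h₁
    rw [← cancel_mono (S.j (0 + 1)), Category.assoc, Category.assoc, h₁, zero_comp,
      Category.assoc, reassoc_of% R.w, zero_comp])
  exact ⟨z, hz.symm⟩

/-- One term that satisfies the homotopy equation on cocycles extends to a whole nullhomotopy,
upwards by injectivity and downwards by projectivity. Prescribing this term is what later permits
the computation of a composite of homotopies on cocycles. -/
lemma exists_cochain (S : AcyclicData D) (hE : E.IsFrobenius) (φ : C ⟶ D) (h₀ : C.X 0 ⟶ D.X (-1))
    (hh : R.j 0 ≫ (h₀ ≫ D.d (-1) 0).hom = R.j 0 ≫ (φ.f 0).hom) :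
    ∃ κ : Cochain C D (-1), δ (-1) 0 κ = Cochain.ofHom φ ∧ κ.v 0 (-1) rfl = h₀ := by
  -- The index is the degree of the target, so the given term `h₀` has index `-1`.
  let T (n : ℤ) : Type v := { h : C.X (n + 1) ⟶ D.X n //
    R.j (n + 1) ≫ (h ≫ D.d n (n + 1)).hom = R.j (n + 1) ≫ (φ.f (n + 1)).hom }
  let Rel (n : ℤ) (h : T n) (h' : T (n + 1)) : Prop :=
    φ.f (n + 1) = C.d (n + 1) (n + 1 + 1) ≫ h'.1 + h.1 ≫ D.d n (n + 1)
  have comm (n : ℤ) : (φ.f n).hom ≫ (D.d n (n + 1)).hom = R.q n ≫ R.j (n + 1) ≫ (φ.f (n + 1)).hom :=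
      by
    rw [← Category.assoc, ← R.d_hom]
    exact congrArg (ObjectProperty.ι (E.IsInjective : ObjectProperty F)).map (φ.comm n (n + 1))
  have dd (n : ℤ) : (D.d n (n + 1)).hom ≫ (D.d (n + 1) (n + 1 + 1)).hom = 0 :=
    congrArg (ObjectProperty.ι (E.IsInjective : ObjectProperty F)).map (D.d_comp_d _ _ _)
  have up (n : ℤ) (h : T n) : ∃ h', Rel n h h' := by
    obtain ⟨h, hh⟩ := h
    change R.j (n + 1) ≫ h.hom ≫ (D.d n (n + 1)).hom = _ at hh
    obtain ⟨g, hg⟩ := exists_desc_of_exactSeq (R.exact (n + 1))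
      ((φ.f (n + 1)).hom - h.hom ≫ (D.d n (n + 1)).hom) (by
        rw [Preadditive.comp_sub, hh, sub_self])
    obtain ⟨h', hh'⟩ := (D.X (n + 1)).property.exists_extension (R.exact (n + 1 + 1)) g
    refine ⟨⟨ObjectProperty.homMk h', ?_⟩, ObjectProperty.hom_ext _ ?_⟩
    · change R.j (n + 1 + 1) ≫ h' ≫ (D.d (n + 1) (n + 1 + 1)).hom = _
      rw [reassoc_of% hh', ← cancel_epi (R.q (n + 1)), reassoc_of% hg, Preadditive.sub_comp, comm,
        Category.assoc, dd, comp_zero, sub_zero]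
    · change (φ.f (n + 1)).hom = (C.d (n + 1) (n + 1 + 1)).hom ≫ h' + h.hom ≫ (D.d n (n + 1)).hom
      rw [R.d_hom, Category.assoc, hh', hg, sub_add_cancel]
  have down (n : ℤ) (h' : T (n + 1)) : ∃ h, Rel n h h' := by
    obtain ⟨h', hh'⟩ := h'
    change R.j (n + 1 + 1) ≫ h'.hom ≫ (D.d (n + 1) (n + 1 + 1)).hom = _ at hh'
    obtain ⟨g, hg⟩ := exists_lift_of_exactSeq (S.exact (n + 1))
      ((φ.f (n + 1)).hom - R.q (n + 1) ≫ R.j (n + 1 + 1) ≫ h'.hom) (by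
        rw [← cancel_mono (S.j (n + 1 + 1)), Category.assoc, ← S.d_hom, zero_comp,
          Preadditive.sub_comp, comm, Category.assoc, Category.assoc, hh', sub_self])
    obtain ⟨h, hh⟩ := ((hE.injective_iff_projective _).1 (C.X (n + 1)).property).exists_lifting
      (S.exact n) g
    have h₁ : h ≫ (D.d n (n + 1)).hom = g ≫ S.j (n + 1) := by
      rw [S.d_hom, reassoc_of% hh]
    refine ⟨⟨ObjectProperty.homMk h, ?_⟩, ObjectProperty.hom_ext _ ?_⟩
    · change R.j (n + 1) ≫ h ≫ (D.d n (n + 1)).hom = _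
      rw [h₁, hg, Preadditive.comp_sub, reassoc_of% R.w, zero_comp, sub_zero]
    · change (φ.f (n + 1)).hom = (C.d (n + 1) (n + 1 + 1)).hom ≫ h'.hom +
        h ≫ (D.d n (n + 1)).hom
      rw [h₁, hg, R.d_hom, Category.assoc, add_sub_cancel]
  obtain ⟨b, hb⟩ := up (-1) (show T (-1) from ⟨h₀, hh⟩)
  obtain ⟨t, h₁, -, ht⟩ := exists_int_sequence Rel up down (show T (-1) from ⟨h₀, hh⟩) b hb
  refine ⟨Cochain.mk fun p q hpq => eqToHom (by rw [← hpq, neg_add_cancel_right]) ≫ (t q).1, ?_, ?_⟩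
  · refine Cochain.ext₀ _ _ fun p => ?_
    obtain ⟨n, rfl⟩ : ∃ n, p = n + 1 := ⟨p - 1, by simp⟩
    rw [δ_v (-1) 0 (neg_add_cancel 1) _ (n + 1) (n + 1) (add_zero _) n (n + 1 + 1) (by simp) rfl,
      Cochain.mk_v, Cochain.mk_v, Cochain.ofHom_v]
    refine Eq.trans ?_ (ht n).symm
    simp [add_comm]
  · rw [Cochain.mk_v, h₁]
    simp

/-- On cocycles the differential of `C` vanishes, so only the term of the nullhomotopy through the
injective object `D.X (-1)` survives. -/
lemma stableRel_zero_of_δ_eq {φ : C ⟶ D} {κ : Cochain C D (-1)} (hκ : δ (-1) 0 κ = Cochain.ofHom φ)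
    {z : R.Z 0 ⟶ S.Z 0} (hz : R.j 0 ≫ (φ.f 0).hom = z ≫ S.j 0) : E.stableRel z 0 := by
  have h := Cochain.congr_v hκ 0 0 (add_zero 0)
  rw [δ_v (-1) 0 (neg_add_cancel 1) _ 0 0 (add_zero _) (-1) (0 + 1) (by simp) (by simp),
    Cochain.ofHom_v, Int.negOnePow_zero, one_smul] at h
  have hd : (D.d (-1) 0).hom = S.q (-1) ≫ S.j 0 := S.d_hom (-1)
  have h' : (κ.v 0 (-1) rfl).hom ≫ (D.d (-1) 0).hom + (C.d 0 (0 + 1)).hom ≫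
      (κ.v (0 + 1) 0 rfl).hom = (φ.f 0).hom :=
    congrArg (ObjectProperty.ι (E.IsInjective : ObjectProperty F)).map h
  rw [← h', hd, R.d_hom, Preadditive.comp_add, Category.assoc, reassoc_of% R.w, zero_comp,
    add_zero] at hz
  refine ⟨_, R.j 0 ≫ (κ.v 0 (-1) rfl).hom, S.q (-1), (D.X (-1)).property, ?_⟩
  rw [sub_zero, ← cancel_mono (S.j 0), ← hz]
  exact ((Category.assoc (R.j 0 ≫ (κ.v 0 (-1) rfl).hom) (S.q (-1)) (S.j 0)).trans
    (Category.assoc (R.j 0) (κ.v 0 (-1) rfl).hom (S.q (-1) ≫ S.j 0))).symm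

end AcyclicData

/-- Sequences with injective middle terms are spliced to the right by enough injectives and to the
left by enough projectives. The cocycles in degree `0` are equal to `X`, not merely isomorphic, so
`X` can be substituted. -/
lemma IsFrobenius.exists_acyclicData [HasZeroObject F] (hE : E.IsFrobenius) (X : F) :
    ∃ (C : CochainComplex E.InjObj ℤ) (R : AcyclicData C), R.Z 0 = X := by
  let Rel (n : ℤ) (Z Z' : F) : Prop := ∃ (P : F) (i : Z ⟶ P) (p : P ⟶ Z') (w : i ≫ p = 0),
    E.exactSeq (ShortComplex.mk i p w) ∧ E.IsInjective P
  have up (n : ℤ) (Z : F) : ∃ Z', Rel n Z Z' := by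
    obtain ⟨I, Z', i, p, w, h⟩ := hE.enoughInjectives Z
    exact ⟨Z', I, i, p, w, h⟩
  have down (n : ℤ) (Z' : F) : ∃ Z, Rel n Z Z' := by
    obtain ⟨Z, P, i, p, w, h, hP⟩ := hE.enoughProjectives Z'
    exact ⟨Z, P, i, p, w, h, (hE.injective_iff_projective _).2 hP⟩
  obtain ⟨Y, hY⟩ := down (-1) X
  obtain ⟨Z, -, h₀, hZ⟩ := exists_int_sequence Rel up down Y X hY
  choose P i p w h hP using hZ
  exact ⟨CochainComplex.of (fun n => (⟨P n, hP n⟩ : E.InjObj))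
    (fun n => ObjectProperty.homMk (p n ≫ i (n + 1)))
    (fun n => ObjectProperty.hom_ext _ (by
      change (p n ≫ i (n + 1)) ≫ p (n + 1) ≫ i (n + 1 + 1) = 0
      rw [Category.assoc, reassoc_of% w, zero_comp, comp_zero])),
    { Z := Z, j := i, q := p, w := w, exact := h
      d_hom := fun n => congrArg (ObjectProperty.ι (E.IsInjective : ObjectProperty F)).map
        (CochainComplex.of_d (fun n => (⟨P n, hP n⟩ : E.InjObj))
          (fun n => ObjectProperty.homMk (p n ≫ i (n + 1))) n) }, h₀⟩

end ExactStructure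

end AcyclicComplexes

lemma HomotopyCategory.quotient_map_eq_iff {A : Type u} [Category.{v} A] [Preadditive A]
    {C D : CochainComplex A ℤ} (f g : C ⟶ D) :
    (HomotopyCategory.quotient A (ComplexShape.up ℤ)).map f =
      (HomotopyCategory.quotient A (ComplexShape.up ℤ)).map g ↔
    ∃ κ : CochainComplex.HomComplex.Cochain C D (-1), CochainComplex.HomComplex.δ (-1) 0 κ =
      CochainComplex.HomComplex.Cochain.ofHom (f - g) := by
  constructor
  · intro h
    obtain ⟨κ, hκ⟩ := CochainComplex.HomComplex.Cochain.equivHomotopy f g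
      (HomotopyCategory.homotopyOfEq f g h)
    exact ⟨κ, by rw [CochainComplex.HomComplex.Cochain.ofHom_sub, hκ, add_sub_cancel_right]⟩
  · rintro ⟨κ, hκ⟩
    exact HomotopyCategory.eq_of_homotopy f g
      ((CochainComplex.HomComplex.Cochain.equivHomotopy f g).symm
        ⟨κ, by rw [hκ, CochainComplex.HomComplex.Cochain.ofHom_sub, sub_add_cancel]⟩)

/-! ### Stable morphisms as homotopy classes of morphisms of acyclic complexes. -/

section AcyclicComplexes

open Limits ZeroObject CochainComplex CochainComplex.HomComplex

namespace ExactStructure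

variable {F : Type u} [Category.{v} F] [Preadditive F] [HasBinaryBiproducts F] [HasZeroObject F]
  {E : ExactStructure F}

namespace AcyclicData

variable {C D B : CochainComplex E.InjObj ℤ} {R : AcyclicData C} {S : AcyclicData D}
  {P : AcyclicData B}

/-- A morphism of homotopy categories of acyclic complexes represents the induced
morphism between the objects of cocycles. -/
def Represents (R : AcyclicData C) (S : AcyclicData D)
    (φ : (HomotopyCategory.quotient E.InjObj (ComplexShape.up ℤ)).obj C ⟶
      (HomotopyCategory.quotient E.InjObj (ComplexShape.up ℤ)).obj D)
    (z : (Quotient.functor E.stableRel).obj (R.Z 0) ⟶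
      (Quotient.functor E.stableRel).obj (S.Z 0)) : Prop :=
  ∃ (φ' : C ⟶ D) (z' : R.Z 0 ⟶ S.Z 0), R.j 0 ≫ (φ'.f 0).hom = z' ≫ S.j 0 ∧
    (HomotopyCategory.quotient E.InjObj (ComplexShape.up ℤ)).map φ' = φ ∧
      (Quotient.functor E.stableRel).map z' = z

variable {φ ψ : (HomotopyCategory.quotient E.InjObj (ComplexShape.up ℤ)).obj C ⟶
      (HomotopyCategory.quotient E.InjObj (ComplexShape.up ℤ)).obj D}
  {z y : (Quotient.functor E.stableRel).obj (R.Z 0) ⟶ (Quotient.functor E.stableRel).obj (S.Z 0)}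

lemma represents_id (R : AcyclicData C) : R.Represents R (𝟙 _) (𝟙 _) :=
  ⟨𝟙 C, 𝟙 _, (Category.comp_id _).trans (Category.id_comp _).symm,
    CategoryTheory.Functor.map_id _ _, CategoryTheory.Functor.map_id _ _⟩

lemma Represents.comp {χ : (HomotopyCategory.quotient E.InjObj (ComplexShape.up ℤ)).obj D ⟶
      (HomotopyCategory.quotient E.InjObj (ComplexShape.up ℤ)).obj B}
    {x : (Quotient.functor E.stableRel).obj (S.Z 0) ⟶ (Quotient.functor E.stableRel).obj (P.Z 0)}
    (h : R.Represents S φ z) (h' : S.Represents P χ x) : R.Represents P (φ ≫ χ) (z ≫ x) := by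
  obtain ⟨φ, z, h, rfl, rfl⟩ := h
  obtain ⟨χ, x, h', rfl, rfl⟩ := h'
  refine ⟨φ ≫ χ, z ≫ x, ?_, CategoryTheory.Functor.map_comp _ _ _,
    CategoryTheory.Functor.map_comp _ _ _⟩
  change R.j 0 ≫ (φ.f 0).hom ≫ (χ.f 0).hom = _
  rw [reassoc_of% h, h', Category.assoc]

lemma Represents.add (h : R.Represents S φ z) (h' : R.Represents S ψ y) :
    R.Represents S (φ + ψ) (z + y) := by
  obtain ⟨φ, z, h, rfl, rfl⟩ := h
  obtain ⟨ψ, y, h', rfl, rfl⟩ := h'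
  refine ⟨φ + ψ, z + y, ?_, Functor.map_add _, Functor.map_add _⟩
  change R.j 0 ≫ ((φ.f 0).hom + (ψ.f 0).hom) = _
  rw [Preadditive.comp_add, h, h', Preadditive.add_comp]

lemma Represents.smul {K : Type w} [CommRing K] [Linear K F] (a : K) (h : R.Represents S φ z) :
    R.Represents S (a • φ) (a • z) := by
  obtain ⟨φ, z, h, rfl, rfl⟩ := h
  refine ⟨a • φ, a • z, ?_, Functor.map_smul _ _ _, rfl⟩
  change R.j 0 ≫ (a • (φ.f 0).hom) = _
  rw [Linear.comp_smul, h, Linear.smul_comp]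

lemma exists_represents (R : AcyclicData C) (S : AcyclicData D) (hE : E.IsFrobenius)
    (z : (Quotient.functor E.stableRel).obj (R.Z 0) ⟶
      (Quotient.functor E.stableRel).obj (S.Z 0)) : ∃ φ, R.Represents S φ z := by
  obtain ⟨z, rfl⟩ := (Quotient.functor E.stableRel).map_surjective z
  obtain ⟨φ, h⟩ := exists_hom R S hE z
  exact ⟨_, φ, z, h, rfl, rfl⟩

lemma exists_represented (R : AcyclicData C) (S : AcyclicData D)
    (φ : (HomotopyCategory.quotient E.InjObj (ComplexShape.up ℤ)).obj C ⟶
      (HomotopyCategory.quotient E.InjObj (ComplexShape.up ℤ)).obj D) :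
    ∃ z, R.Represents S φ z := by
  obtain ⟨φ, rfl⟩ := (HomotopyCategory.quotient E.InjObj (ComplexShape.up ℤ)).map_surjective φ
  obtain ⟨z, h⟩ := exists_cocycle_hom R S φ
  exact ⟨_, φ, z, h, rfl, rfl⟩

/-- Well-definedness and injectivity of the passage to cocycles at once. Identities in the homotopy
category of injectives are afterwards proved by comparing the stable morphisms they represent. -/
lemma Represents.eq_iff (hE : E.IsFrobenius) (h : R.Represents S φ z) (h' : R.Represents S ψ y) :
    φ = ψ ↔ z = y := by
  obtain ⟨φ, z, h, rfl, rfl⟩ := h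
  obtain ⟨ψ, y, h', rfl, rfl⟩ := h'
  have hs : R.j 0 ≫ ((φ - ψ).f 0).hom = (z - y) ≫ S.j 0 := by
    change R.j 0 ≫ ((φ.f 0).hom - (ψ.f 0).hom) = _
    rw [Preadditive.comp_sub, h, h', Preadditive.sub_comp]
  rw [HomotopyCategory.quotient_map_eq_iff]
  constructor
  · rintro ⟨κ, hκ⟩
    obtain ⟨I, a, b, hI, hab⟩ := stableRel_zero_of_δ_eq R S hκ hs
    exact CategoryTheory.Quotient.sound _ ⟨I, a, b, hI, by rw [← hab, sub_zero]⟩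
  · intro hzy
    obtain ⟨I, a, b, hI, hab⟩ := (Quotient.functor_map_eq_iff E.stableRel z y).1 hzy
    -- The factorization through `I` is extended to `C.X 0` on one side and lifted to `D.X (-1)` on
    -- the other. The composite is the starting term of a nullhomotopy.
    obtain ⟨a', ha'⟩ := hI.exists_extension (R.exact 0) a
    obtain ⟨b', hb'⟩ := ((hE.injective_iff_projective _).1 hI).exists_lifting (S.exact (-1))
      (show I ⟶ S.Z (-1 + 1) from b)
    have hd : (D.d (-1) 0).hom = S.q (-1) ≫ S.j 0 := S.d_hom (-1)
    obtain ⟨κ, hκ, -⟩ := exists_cochain R S hE (φ - ψ) (ObjectProperty.homMk (a' ≫ b')) (by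
      change R.j 0 ≫ (a' ≫ b') ≫ (D.d (-1) 0).hom = _
      rw [hd, hs, hab, Category.assoc, reassoc_of% ha']
      exact (congrArg (a ≫ ·) ((Category.assoc b' (S.q (-1)) (S.j 0)).symm.trans
        (congrArg (· ≫ S.j 0) hb'))).trans (Category.assoc a b (S.j 0)).symm)
    exact ⟨κ, hκ⟩

lemma Represents.exists_iso (hE : E.IsFrobenius) (R : AcyclicData C) (S : AcyclicData D)
    (e : (Quotient.functor E.stableRel).obj (R.Z 0) ≅
      (Quotient.functor E.stableRel).obj (S.Z 0)) :
    ∃ φ : (HomotopyCategory.quotient E.InjObj (ComplexShape.up ℤ)).obj C ≅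
      (HomotopyCategory.quotient E.InjObj (ComplexShape.up ℤ)).obj D,
      R.Represents S φ.hom e.hom ∧ S.Represents R φ.inv e.inv := by
  obtain ⟨φ, hφ⟩ := exists_represents R S hE e.hom
  obtain ⟨ψ, hψ⟩ := exists_represents S R hE e.inv
  exact ⟨⟨φ, ψ, ((hφ.comp hψ).eq_iff hE R.represents_id).2 e.hom_inv_id,
    ((hψ.comp hφ).eq_iff hE S.represents_id).2 e.inv_hom_id⟩, hφ, hψ⟩

end AcyclicData

namespace IsFrobenius

variable (hE : E.IsFrobenius)

/-- A chosen acyclic complex of injectives with a given object of cocycles in degree zero. -/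
noncomputable def resolution (X : F) : CochainComplex E.InjObj ℤ :=
  (hE.exists_acyclicData X).choose

/-- The exact sequences exhibiting the chosen complex as acyclic. -/
noncomputable def resolutionData (X : F) : AcyclicData (hE.resolution X) :=
  (hE.exists_acyclicData X).choose_spec.choose

/-- The object of cocycles in degree zero of the chosen complex. -/
noncomputable def resolutionIso (X : E.Stable) :
    (Quotient.functor E.stableRel).obj ((hE.resolutionData X.as).Z 0) ≅ X :=
  eqToIso (congrArg (Quotient.functor E.stableRel).obj
    (hE.exists_acyclicData X.as).choose_spec.choose_spec)

/-- The morphism of complexes which represents a morphism of the stable category. -/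
noncomputable def resolutionMap {X Y : E.Stable} (f : X ⟶ Y) :
    (HomotopyCategory.quotient E.InjObj (ComplexShape.up ℤ)).obj (hE.resolution X.as) ⟶
      (HomotopyCategory.quotient E.InjObj (ComplexShape.up ℤ)).obj (hE.resolution Y.as) :=
  (AcyclicData.exists_represents (hE.resolutionData X.as) (hE.resolutionData Y.as) hE
    ((hE.resolutionIso X).hom ≫ f ≫ (hE.resolutionIso Y).inv)).choose

lemma represents_resolutionMap {X Y : E.Stable} (f : X ⟶ Y) :
    (hE.resolutionData X.as).Represents (hE.resolutionData Y.as) (hE.resolutionMap f)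
      ((hE.resolutionIso X).hom ≫ f ≫ (hE.resolutionIso Y).inv) :=
  (AcyclicData.exists_represents (hE.resolutionData X.as) (hE.resolutionData Y.as) hE
    ((hE.resolutionIso X).hom ≫ f ≫ (hE.resolutionIso Y).inv)).choose_spec

/-- The embedding of the stable category in the homotopy category of complexes of injectives. -/
noncomputable def resolutionFunctor :
    E.Stable ⥤ HomotopyCategory E.InjObj (ComplexShape.up ℤ) where
  obj X := (HomotopyCategory.quotient E.InjObj (ComplexShape.up ℤ)).obj (hE.resolution X.as)
  map f := hE.resolutionMap f
  map_id X := ((hE.represents_resolutionMap _).eq_iff hE (AcyclicData.represents_id _)).2 (by simp)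
  map_comp f g := ((hE.represents_resolutionMap _).eq_iff hE
    ((hE.represents_resolutionMap f).comp (hE.represents_resolutionMap g))).2 (by simp)

instance : hE.resolutionFunctor.Additive where
  map_add {X Y f g} := ((hE.represents_resolutionMap (f + g)).eq_iff hE
    ((hE.represents_resolutionMap f).add (hE.represents_resolutionMap g))).2
      (by rw [Preadditive.add_comp, Preadditive.comp_add])

instance {K : Type w} [CommRing K] [Linear K F] : hE.resolutionFunctor.Linear K where
  map_smul f a := ((hE.represents_resolutionMap (a • f)).eq_iff hE
    ((hE.represents_resolutionMap f).smul a)).2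
      (by rw [Linear.smul_comp, Linear.comp_smul])

instance : hE.resolutionFunctor.Faithful where
  map_injective {X Y f g} h := by
    have := ((hE.represents_resolutionMap f).eq_iff hE (hE.represents_resolutionMap g)).1 h
    rwa [cancel_epi, cancel_mono] at this

instance : hE.resolutionFunctor.Full where
  map_surjective {X Y} φ := by
    obtain ⟨z, hz⟩ := AcyclicData.exists_represented (hE.resolutionData X.as)
      (hE.resolutionData Y.as) φ
    exact ⟨(hE.resolutionIso X).inv ≫ z ≫ (hE.resolutionIso Y).hom,
      ((hE.represents_resolutionMap _).eq_iff hE hz).2 (by simp)⟩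

end IsFrobenius

end ExactStructure

end AcyclicComplexes

/-! ### Shifts of acyclic complexes and the shift of the stable category. -/

section AcyclicComplexes

open Limits ZeroObject CochainComplex CochainComplex.HomComplex

namespace ExactStructure

variable {F : Type u} [Category.{v} F] [Preadditive F] {E : ExactStructure F}

lemma exactSeq_neg {X Y Z : F} {i : X ⟶ Y} {p : Y ⟶ Z} {w : i ≫ p = 0}
    (h : E.exactSeq (ShortComplex.mk i p w)) :
    E.exactSeq (ShortComplex.mk (-i) p (by rw [Preadditive.neg_comp, w, neg_zero])) :=
  E.of_iso (ShortComplex.isoMk (S₁ := ShortComplex.mk i p w)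
    (S₂ := ShortComplex.mk (-i) p (by rw [Preadditive.neg_comp, w, neg_zero]))
    ⟨-𝟙 X, -𝟙 X, by simp, by simp⟩ (Iso.refl Y) (Iso.refl Z) (by simp) (by simp)) h

lemma exists_map_of_exactSeq {X Y Z X' Y' Z' : F} {i : X ⟶ Y} {p : Y ⟶ Z} {w : i ≫ p = 0}
    {i' : X' ⟶ Y'} {p' : Y' ⟶ Z'} (h : E.exactSeq (ShortComplex.mk i p w)) (w' : i' ≫ p' = 0)
    (hY' : E.IsInjective Y') (f : X ⟶ X') :
    ∃ (u : Y ⟶ Y') (v : Z ⟶ Z'), i ≫ u = f ≫ i' ∧ p ≫ v = u ≫ p' := by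
  obtain ⟨u, hu⟩ := hY'.exists_extension h (f ≫ i')
  obtain ⟨v, hv⟩ := exists_desc_of_exactSeq h (u ≫ p') (by
    rw [reassoc_of% hu, w', comp_zero])
  exact ⟨u, v, hu, hv⟩

section

variable [HasBinaryBiproducts F] [HasZeroObject F] {X Y Z Y' Z' : F} {i : X ⟶ Y} {p : Y ⟶ Z}
  {w : i ≫ p = 0} {i' : X ⟶ Y'} {p' : Y' ⟶ Z'} {w' : i' ≫ p' = 0}
  (h : E.exactSeq (ShortComplex.mk i p w)) (hY : E.IsInjective Y)
  (h' : E.exactSeq (ShortComplex.mk i' p' w')) (hY' : E.IsInjective Y')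

lemma map_comp_map_eq_id (h : E.exactSeq (ShortComplex.mk i p w)) (hY : E.IsInjective Y)
    {u : Y ⟶ Y'} {v : Z ⟶ Z'} {u' : Y' ⟶ Y} {v' : Z' ⟶ Z} (hu : i ≫ u = 𝟙 X ≫ i')
    (hv : p ≫ v = u ≫ p') (hu' : i' ≫ u' = 𝟙 X ≫ i) (hv' : p' ≫ v' = u' ≫ p) :
    (Quotient.functor E.stableRel).map v ≫ (Quotient.functor E.stableRel).map v' = 𝟙 _ := by
  rw [← CategoryTheory.Functor.map_comp, ← CategoryTheory.Functor.map_id]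
  refine CategoryTheory.Quotient.sound _ (stableRel_of_exactSeq (f := 𝟙 _) (f₁ := 𝟙 _)
    (u := u ≫ u') (u₁ := 𝟙 _) h w hY ?_ ?_ (by simp) (by simp)
    (Congruence.equivalence.refl _))
  · rw [reassoc_of% hu, hu']
  · rw [reassoc_of% hv, hv', Category.assoc]

/-- The cokernels of two embeddings of an object in injective objects are stably isomorphic. -/
noncomputable def cokernelIso :
    (Quotient.functor E.stableRel).obj Z ≅ (Quotient.functor E.stableRel).obj Z' where
  hom := (Quotient.functor E.stableRel).map
    (exists_map_of_exactSeq h w' hY' (𝟙 X)).choose_spec.choose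
  inv := (Quotient.functor E.stableRel).map
    (exists_map_of_exactSeq h' w hY (𝟙 X)).choose_spec.choose
  hom_inv_id :=
    have hv := (exists_map_of_exactSeq h w' hY' (𝟙 X)).choose_spec.choose_spec
    have hv' := (exists_map_of_exactSeq h' w hY (𝟙 X)).choose_spec.choose_spec
    map_comp_map_eq_id h hY hv.1 hv.2 hv'.1 hv'.2
  inv_hom_id :=
    have hv := (exists_map_of_exactSeq h w' hY' (𝟙 X)).choose_spec.choose_spec
    have hv' := (exists_map_of_exactSeq h' w hY (𝟙 X)).choose_spec.choose_spec
    map_comp_map_eq_id h' hY' hv'.1 hv'.2 hv.1 hv.2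

lemma exists_cokernelIso_hom : ∃ (u : Y ⟶ Y') (v : Z ⟶ Z'), i ≫ u = i' ∧ p ≫ v = u ≫ p' ∧
    (cokernelIso h hY h' hY').hom = (Quotient.functor E.stableRel).map v := by
  obtain ⟨h₁, h₂⟩ := (exists_map_of_exactSeq h w' hY' (𝟙 X)).choose_spec.choose_spec
  exact ⟨_, _, h₁.trans (Category.id_comp _), h₂, rfl⟩

end

namespace AcyclicData

variable {C D : CochainComplex E.InjObj ℤ}

/-- The exact sequences exhibiting the shift of an acyclic complex as acyclic. -/
def shift (R : AcyclicData C) :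
    AcyclicData ((CategoryTheory.shiftFunctor (CochainComplex E.InjObj ℤ) (1 : ℤ)).obj C) where
  Z n := R.Z (n + 1)
  -- The sign accounts for the differential of the shifted complex, which is the negative of the
  -- original one.
  j n := -R.j (n + 1)
  q n := R.q (n + 1)
  w n := (Preadditive.neg_comp _ _).trans ((congrArg _ (R.w (n + 1))).trans neg_zero)
  exact n := exactSeq_neg (R.exact (n + 1))
  d_hom n := by
    have h : ((1 : ℤ).negOnePow • C.d (n + 1) (n + 1 + 1)).hom = R.q (n + 1) ≫
        (-R.j (n + 1 + 1)) := by
      rw [Int.negOnePow_one, Units.neg_smul, one_smul, Preadditive.comp_neg, ← R.d_hom]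
      rfl
    exact h

variable (R : AcyclicData C) (S : AcyclicData D) (hE : E.IsFrobenius)

variable [HasBinaryBiproducts F] [HasZeroObject F]

/-- The cocycles of degree one of an acyclic complex of injectives are the shift of the
cocycles of degree zero. -/
noncomputable def shiftIso : (Quotient.functor E.stableRel).obj (R.shift.Z 0) ≅
    hE.shift.obj ((Quotient.functor E.stableRel).obj (R.Z 0)) :=
  cokernelIso (R.exact 0) (C.X 0).property (hE.exactSeq_ι_π (R.Z 0)) (hE.isInjective_inj (R.Z 0))

lemma exists_shiftIso_hom : ∃ (u : (C.X 0).obj ⟶ hE.inj (R.Z 0))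
    (v : R.Z (0 + 1) ⟶ hE.shiftObj (R.Z 0)), R.j 0 ≫ u = hE.ι (R.Z 0) ∧
      R.q 0 ≫ v = u ≫ hE.π (R.Z 0) ∧
        (R.shiftIso hE).hom = (Quotient.functor E.stableRel).map v :=
  exists_cokernelIso_hom _ _ _ _

variable {R S}

/-- The shifted chain map acts on the cocycles of degree one. This action and the shift of `z` both
complete `z` to a morphism of exact sequences into the chosen one for `S.Z 0`, hence they agree
stably by `stableRel_of_exactSeq`. -/
lemma Represents.shift {φ : (HomotopyCategory.quotient E.InjObj (ComplexShape.up ℤ)).obj C ⟶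
      (HomotopyCategory.quotient E.InjObj (ComplexShape.up ℤ)).obj D}
    {z : (Quotient.functor E.stableRel).obj (R.Z 0) ⟶ (Quotient.functor E.stableRel).obj (S.Z 0)}
    (h : R.Represents S φ z) : R.shift.Represents S.shift
      (((HomotopyCategory.quotient E.InjObj (ComplexShape.up ℤ)).commShiftIso (1 : ℤ)).hom.app C ≫
        (CategoryTheory.shiftFunctor _ (1 : ℤ)).map φ ≫
        ((HomotopyCategory.quotient E.InjObj (ComplexShape.up ℤ)).commShiftIso (1 : ℤ)).inv.app D)
      ((R.shiftIso hE).hom ≫ hE.shift.map z ≫ (S.shiftIso hE).inv) := by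
  obtain ⟨φ, z, h, rfl, rfl⟩ := h
  have hd : (φ.f 0).hom ≫ (D.d 0 (0 + 1)).hom = (C.d 0 (0 + 1)).hom ≫ (φ.f (0 + 1)).hom :=
    congrArg (ObjectProperty.ι (E.IsInjective : ObjectProperty F)).map (φ.comm 0 (0 + 1))
  obtain ⟨y, hy⟩ := exists_desc_of_exactSeq (R.exact 0) ((φ.f 0).hom ≫ S.q 0) (by
    rw [reassoc_of% h, S.w, comp_zero])
  have hy' : R.j (0 + 1) ≫ (φ.f (0 + 1)).hom = y ≫ S.j (0 + 1) := by
    rw [← cancel_epi (R.q 0), reassoc_of% hy, ← S.d_hom, hd, R.d_hom, Category.assoc]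
  refine ⟨(CategoryTheory.shiftFunctor _ (1 : ℤ)).map φ, y, ?_, ?_, ?_⟩
  · change (-R.j (0 + 1)) ≫ (φ.f (0 + 1)).hom = y ≫ (-S.j (0 + 1))
    rw [Preadditive.neg_comp, hy', Preadditive.comp_neg]
  · exact ((Iso.eq_comp_inv (((HomotopyCategory.quotient E.InjObj
      (ComplexShape.up ℤ)).commShiftIso (1 : ℤ)).app D)).2 (((HomotopyCategory.quotient E.InjObj
        (ComplexShape.up ℤ)).commShiftIso (1 : ℤ)).hom.naturality φ)).trans (Category.assoc _ _ _)
  · rw [← Category.assoc, Iso.eq_comp_inv]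
    obtain ⟨u₁, v₁, h₁, h₂, h₃⟩ := exists_shiftIso_hom R hE
    obtain ⟨u₂, v₂, h₄, h₅, h₆⟩ := exists_shiftIso_hom S hE
    obtain ⟨t, h₇, h₈⟩ := (hE.exists_induces z).choose_spec
    rw [h₃, h₆]
    refine ((Quotient.functor E.stableRel).map_comp y v₂).symm.trans (Eq.trans ?_
      ((Quotient.functor E.stableRel).map_comp v₁ _))
    exact CategoryTheory.Quotient.sound _ (stableRel_of_exactSeq (f := z) (f₁ := z)
      (R.exact 0) (hE.ι_π (S.Z 0)) (hE.isInjective_inj (S.Z 0))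
      (by rw [reassoc_of% h, h₄]) (by rw [reassoc_of% hy, h₅, Category.assoc])
      (by rw [reassoc_of% h₁, h₇]) (by rw [reassoc_of% h₂, h₈, Category.assoc])
      (Congruence.equivalence.refl _))

end AcyclicData

end ExactStructure

end AcyclicComplexes

/-! ### The resolution functor, its shifts and its mapping cones. -/

section AcyclicComplexes

open Limits ZeroObject CochainComplex CochainComplex.HomComplex

namespace ExactStructure

variable {F : Type u} [Category.{v} F] [Preadditive F] [HasBinaryBiproducts F] [HasZeroObject F]
  {E : ExactStructure F} (hE : E.IsFrobenius)

namespace IsFrobenius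

/-- The stable isomorphism underlying the compatibility of resolutions with shifts. -/
noncomputable def resolutionShiftIso (X : E.Stable) :
    (Quotient.functor E.stableRel).obj ((hE.resolutionData (hE.shift.obj X).as).Z 0) ≅
      (Quotient.functor E.stableRel).obj ((hE.resolutionData X.as).shift.Z 0) :=
  hE.resolutionIso (hE.shift.obj X) ≪≫ hE.shift.mapIso (hE.resolutionIso X).symm ≪≫
    ((hE.resolutionData X.as).shiftIso hE).symm

/-- The shift of the chosen complex of an object, as the chosen complex of the shift. -/
noncomputable def resolutionObjShiftIso (X : E.Stable) :
    hE.resolutionFunctor.obj (hE.shift.obj X) ≅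
      (HomotopyCategory.quotient E.InjObj (ComplexShape.up ℤ)).obj
        ((CategoryTheory.shiftFunctor (CochainComplex E.InjObj ℤ) (1 : ℤ)).obj
          (hE.resolution X.as)) :=
  (AcyclicData.Represents.exists_iso hE (hE.resolutionData (hE.shift.obj X).as)
    (hE.resolutionData X.as).shift (hE.resolutionShiftIso X)).choose

lemma represents_resolutionObjShiftIso (X : E.Stable) :
    (hE.resolutionData (hE.shift.obj X).as).Represents (hE.resolutionData X.as).shift
      (hE.resolutionObjShiftIso X).hom (hE.resolutionShiftIso X).hom :=
  (AcyclicData.Represents.exists_iso hE (hE.resolutionData (hE.shift.obj X).as)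
    (hE.resolutionData X.as).shift (hE.resolutionShiftIso X)).choose_spec.1

lemma resolutionFunctor_map_shift {X Y : E.Stable} (f : X ⟶ Y) :
    hE.resolutionFunctor.map (hE.shift.map f) ≫ (hE.resolutionObjShiftIso Y).hom =
      (hE.resolutionObjShiftIso X).hom ≫
        ((HomotopyCategory.quotient E.InjObj (ComplexShape.up ℤ)).commShiftIso (1 : ℤ)).hom.app _ ≫
        (CategoryTheory.shiftFunctor _ (1 : ℤ)).map (hE.resolutionFunctor.map f) ≫
        ((HomotopyCategory.quotient E.InjObj (ComplexShape.up ℤ)).commShiftIso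
          (1 : ℤ)).inv.app _ := by
  refine (((hE.represents_resolutionMap (hE.shift.map f)).comp
    (hE.represents_resolutionObjShiftIso Y)).eq_iff hE
    ((hE.represents_resolutionObjShiftIso X).comp
      ((hE.represents_resolutionMap f).shift hE))).2 ?_
  simp [resolutionShiftIso]

/-- The embedding of the stable category in the homotopy category of complexes of injectives
commutes with the shifts. -/
noncomputable def resolutionFunctorShiftIso :
    hE.shift ⋙ hE.resolutionFunctor ≅ hE.resolutionFunctor ⋙
      CategoryTheory.shiftFunctor (HomotopyCategory E.InjObj (ComplexShape.up ℤ)) (1 : ℤ) :=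
  NatIso.ofComponents (fun X => hE.resolutionObjShiftIso X ≪≫
    ((HomotopyCategory.quotient E.InjObj (ComplexShape.up ℤ)).commShiftIso (1 : ℤ)).app _)
    (fun {X Y} f => by
      have h := congrArg (· ≫ ((HomotopyCategory.quotient E.InjObj (ComplexShape.up ℤ)).commShiftIso
        (1 : ℤ)).hom.app _) (hE.resolutionFunctor_map_shift f)
      simp only [Category.assoc] at h
      exact h.trans ((congrArg (_ ≫ ·) (congrArg (_ ≫ ·) ((Category.assoc _ _ _).trans
        ((congrArg (_ ≫ ·) (Iso.inv_hom_id_app _ _)).trans (Category.comp_id _))))).trans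
          (Category.assoc _ _ _).symm))

end IsFrobenius

namespace AcyclicData

variable {C D B : CochainComplex E.InjObj ℤ} (R : AcyclicData C) (S : AcyclicData D)
  (P : AcyclicData B)

/-- Chain maps lifting `i`, `p` and `e` have nullhomotopic consecutive composites. A nullhomotopy of
the first composite defines `c`, and the last relation amounts to a Toda bracket computation: the
two nullhomotopies combine to a self-map of `C` that induces `-1` on cocycles, hence is homotopic to
`-1`. It is not necessary to know here that `c` is a homotopy equivalence. -/
lemma exists_mappingCone_hom {i : R.Z 0 ⟶ S.Z 0} {p : S.Z 0 ⟶ P.Z 0} {w : i ≫ p = 0}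
    (h : E.exactSeq (ShortComplex.mk i p w)) {b : S.Z 0 ⟶ hE.inj (R.Z 0)}
    {e : P.Z 0 ⟶ hE.shiftObj (R.Z 0)} (hb : i ≫ b = hE.ι (R.Z 0))
    (he : p ≫ e = b ≫ hE.π (R.Z 0)) :
    ∃ (φ : C ⟶ D) (c : mappingCone φ ⟶ B)
      (ψ : B ⟶ (CategoryTheory.shiftFunctor (CochainComplex E.InjObj ℤ) (1 : ℤ)).obj C),
      R.Represents S ((HomotopyCategory.quotient E.InjObj (ComplexShape.up ℤ)).map φ)
        ((Quotient.functor E.stableRel).map i) ∧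
      S.Represents P ((HomotopyCategory.quotient E.InjObj (ComplexShape.up ℤ)).map
        (mappingCone.inr φ ≫ c)) ((Quotient.functor E.stableRel).map p) ∧
      P.Represents R.shift ((HomotopyCategory.quotient E.InjObj (ComplexShape.up ℤ)).map ψ)
        ((Quotient.functor E.stableRel).map e ≫ (R.shiftIso hE).inv) ∧
      (HomotopyCategory.quotient E.InjObj (ComplexShape.up ℤ)).map (c ≫ ψ) =
        (HomotopyCategory.quotient E.InjObj (ComplexShape.up ℤ)).map (coneProj φ) := by
  -- The connecting morphism is rebuilt with `C.X 0` in place of the chosen injective, so that it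
  -- takes values in the cocycles of degree one; stably it is still `e`.
  obtain ⟨b', hb'⟩ := (C.X 0).property.exists_extension h (R.j 0)
  obtain ⟨ε, hε⟩ := exists_desc_of_exactSeq h (b' ≫ R.q 0) (by rw [reassoc_of% hb', R.w])
  have hε' : (Quotient.functor E.stableRel).map ε =
      (Quotient.functor E.stableRel).map e ≫ (R.shiftIso hE).inv := by
    obtain ⟨u, v, h₁, h₂, h₃⟩ := exists_shiftIso_hom R hE
    refine (Iso.eq_comp_inv (R.shiftIso hE)).2 ((congrArg (_ ≫ ·) h₃).trans ?_)
    refine ((Quotient.functor E.stableRel).map_comp ε v).symm.trans ?_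
    exact CategoryTheory.Quotient.sound _ (stableRel_of_exactSeq (f := 𝟙 _) (f₁ := 𝟙 _)
      h (hE.ι_π _) (hE.isInjective_inj _) (by rw [reassoc_of% hb', h₁, Category.id_comp])
      (by rw [reassoc_of% hε, h₂, Category.assoc]) (by rw [hb, Category.id_comp]) he
      (Congruence.equivalence.refl _))
  obtain ⟨φ, hφ⟩ := exists_hom R S hE i
  obtain ⟨φ', hφ'⟩ := exists_hom S P hE p
  obtain ⟨ψ, hψ⟩ := exists_hom P R.shift hE ε
  -- Since `i ≫ p` is zero on the nose, the nullhomotopy can be taken to vanish out of degree `0`.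
  obtain ⟨κ, hκ, hκ₀⟩ := exists_cochain R P hE (φ ≫ φ') 0 (by
    change R.j 0 ≫ ((0 : (C.X 0).obj ⟶ (B.X (-1)).obj) ≫ (B.d (-1) 0).hom) =
      R.j 0 ≫ (φ.f 0).hom ≫ (φ'.f 0).hom
    rw [reassoc_of% hφ, hφ', reassoc_of% w, zero_comp, zero_comp, comp_zero])
  obtain ⟨b₀, hb₀⟩ := (C.X 0).property.exists_extension (S.exact 0) b'
  have hd : (((CategoryTheory.shiftFunctor (CochainComplex E.InjObj ℤ) (1 : ℤ)).obj C).d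
      (-1) 0).hom = R.q 0 ≫ R.shift.j 0 := R.shift.d_hom (-1)
  -- The term out of degree `0` goes to degree `-1` of the shift, which is `C.X 0`. It is chosen to
  -- extend `b'`, so that on `R.Z 0` it composes with `φ` to `R.j 0`.
  obtain ⟨k, hk, hk₀⟩ := exists_cochain S R.shift hE (φ' ≫ ψ) (ObjectProperty.homMk b₀) (by
    have h₁ {W : F} (x : R.Z (0 + 1) ⟶ W) (y : (B.X 0).obj ⟶ W) (hxy : P.j 0 ≫ y = ε ≫ x) :
        S.j 0 ≫ b₀ ≫ R.q 0 ≫ x = S.j 0 ≫ (φ'.f 0).hom ≫ y := by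
      rw [reassoc_of% hφ', hxy, reassoc_of% hε, reassoc_of% hb₀]
    exact (congrArg (fun x => S.j 0 ≫ b₀ ≫ x) hd).trans (h₁ _ _ hψ))
  let θ : Cochain C ((CategoryTheory.shiftFunctor (CochainComplex E.InjObj ℤ) (1 : ℤ)).obj C)
      (-1) :=
    κ.comp (Cochain.ofHom ψ) (add_zero (-1)) - (Cochain.ofHom φ).comp k (zero_add (-1))
  have hθ : δ (-1) 0 θ = 0 := by
    rw [δ_sub, δ_comp_ofHom, δ_ofHom_comp, hκ, hk, ← Cochain.ofHom_comp, ← Cochain.ofHom_comp,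
      Category.assoc, sub_self]
  have hθ₀ : R.j 0 ≫ (θ.v 0 (-1) rfl).hom = -R.j 0 := by
    have h₁ : θ.v 0 (-1) rfl = -(φ.f 0 ≫ ObjectProperty.homMk b₀) := by
      rw [Cochain.sub_v, Cochain.comp_zero_cochain_v, Cochain.zero_cochain_comp_v, hκ₀, hk₀,
        zero_comp, zero_sub, Cochain.ofHom_v]
      rfl
    rw [h₁]
    change R.j 0 ≫ (-((φ.f 0).hom ≫ b₀)) = -R.j 0
    rw [Preadditive.comp_neg, reassoc_of% hφ, hb₀, hb']
  -- `θ` is a cocycle, so its unshift is a chain map from `C` to itself. By the choice of `κ` and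
  -- `k` it is `-1` on cocycles, so its sum with the identity vanishes there and is nullhomotopic.
  obtain ⟨ω, hω⟩ : ∃ ω : Cochain C C (-1), δ (-1) 0 ω =
      θ.rightUnshift 0 (neg_add_cancel 1) + Cochain.ofHom (𝟙 C) := by
    let t : C ⟶ C := Cocycle.homOf (Cocycle.rightUnshift ⟨θ, hθ⟩ 0 (neg_add_cancel 1))
    obtain ⟨ω, hω, -⟩ := exists_cochain R R hE (t + 𝟙 C) 0 (by
      change R.j 0 ≫ ((0 : (C.X 0).obj ⟶ (C.X (-1)).obj) ≫ (C.d (-1) 0).hom) =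
        R.j 0 ≫ ((t.f 0).hom + 𝟙 _)
      have ht : t.f 0 = θ.v 0 (-1) rfl := (Cocycle.homOf_f _ 0).trans
        ((Cochain.rightUnshift_v θ 0 (neg_add_cancel 1) 0 0 (add_zero 0) (-1) rfl).trans
          (Category.comp_id _))
      have h₁ : R.j 0 ≫ ((t.f 0).hom + 𝟙 _) = 0 := by
        rw [ht, Preadditive.comp_add]
        exact (congrArg₂ (fun x y : R.Z 0 ⟶ (C.X 0).obj => x + y) hθ₀ (Category.comp_id _)).trans
            (neg_add_cancel _)
      exact ((congrArg (R.j 0 ≫ ·) zero_comp).trans comp_zero).trans h₁.symm)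
    exact ⟨ω, by rw [hω, Cochain.ofHom_add, Cocycle.cochain_ofHom_homOf_eq_coe]; rfl⟩
  have hω' : -δ (-2) (-1) (ω.rightShift 1 (-2) (by lia)) =
      θ + (Cochain.ofHom (𝟙 C)).rightShift 1 (-1) (neg_add_cancel 1) := by
    rw [Cochain.δ_rightShift ω 1 (-2) (-1) (by lia) 0 (by lia), hω, Cochain.rightShift_add,
      Cochain.rightShift_rightUnshift, Int.negOnePow_one, Units.neg_smul, one_smul, neg_neg]
  have hκ' : δ (-1) 0 κ = Cochain.ofHom (φ ≫ φ') := hκ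
  refine ⟨φ, mappingCone.desc φ κ φ' hκ', ψ, ⟨φ, i, hφ, rfl, rfl⟩,
    ⟨φ', p, hφ', by rw [mappingCone.inr_desc], rfl⟩, ⟨ψ, ε, hψ, rfl, hε'⟩, ?_⟩
  rw [HomotopyCategory.quotient_map_eq_iff]
  -- The homotopy on the cone is `k` on the summand `D` and the correction `ω` on the shifted
  -- summand `C`.
  refine ⟨mappingCone.descCochain φ (-ω.rightShift 1 (-2) (by lia)) k (by lia), ?_⟩
  rw [mappingCone.δ_descCochain _ _ _ _ 0 (by lia), Cochain.ofHom_sub, Cochain.ofHom_comp]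
  refine (mappingCone.ext_cochain_from_iff φ (-1) 0 (neg_add_cancel 1)).2 ⟨?_, ?_⟩
  · rw [Cochain.comp_add, mappingCone.inl_fst_assoc, mappingCone.inl_snd_assoc, Cochain.comp_sub,
      inl_coneProj, δ_neg, hω', ← Cochain.comp_assoc_of_third_is_zero_cochain,
      mappingCone.inl_desc, Int.negOnePow_zero, one_smul, add_zero]
    dsimp only [θ]
    abel
  · rw [Cochain.comp_add, mappingCone.inr_fst_assoc, mappingCone.inr_snd_assoc, Cochain.comp_sub,
      inr_coneProj, hk, ← Cochain.comp_assoc_of_third_is_zero_cochain, ← Cochain.ofHom_comp,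
      mappingCone.inr_desc, Cochain.ofHom_comp, zero_add, sub_zero]

end AcyclicData

end ExactStructure

end AcyclicComplexes

/-! ### Exactness of the embedding in complexes of injectives, and the main theorem. -/

section AcyclicComplexes

open Limits ZeroObject Pretriangulated CochainComplex TriangleStructure

namespace ExactStructure.IsFrobenius

variable {F : Type u} [Category.{v} F] [Preadditive F] [HasBinaryBiproducts F] [HasZeroObject F]
  {E : ExactStructure F} (hE : E.IsFrobenius)

lemma exists_resolutionFunctor_iso {C : CochainComplex E.InjObj ℤ} (R : AcyclicData C)
    {X : E.Stable} (α : X ≅ (Quotient.functor E.stableRel).obj (R.Z 0)) :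
    ∃ a : hE.resolutionFunctor.obj X ≅
      (HomotopyCategory.quotient E.InjObj (ComplexShape.up ℤ)).obj C,
      (hE.resolutionData X.as).Represents R a.hom ((hE.resolutionIso X).hom ≫ α.hom) := by
  obtain ⟨a, ha, -⟩ := AcyclicData.Represents.exists_iso hE (hE.resolutionData X.as) R
    (hE.resolutionIso X ≪≫ α)
  exact ⟨a, ha⟩

variable {T : Type u'} [Category.{v'} T] [Preadditive T] [HasZeroObject T] [HasShift T ℤ]
  [∀ n : ℤ, (CategoryTheory.shiftFunctor T n).Additive] [Pretriangulated T]

/-- Working with the composite from `T` supplies a triangulated source for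
`distTriang_map_of_fullyFaithful`, so that the stable category of an arbitrary Frobenius category
need not be shown to be triangulated. -/
lemma isExact_comp_resolutionFunctor (L : T ⥤ E.Stable) [L.Additive] [L.Full] [L.Faithful]
    (h : (ofPretriangulated T).IsExact hE.triangles L) :
    (ofPretriangulated T).IsExact
      (ofPretriangulated (HomotopyCategory E.InjObj (ComplexShape.up ℤ)))
      (L ⋙ hE.resolutionFunctor) := by
  obtain ⟨η, hη⟩ := h
  let η' : CategoryTheory.shiftFunctor T (1 : ℤ) ⋙ L ⋙ hE.resolutionFunctor ≅
      (L ⋙ hE.resolutionFunctor) ⋙ CategoryTheory.shiftFunctor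
        (HomotopyCategory E.InjObj (ComplexShape.up ℤ)) (1 : ℤ) :=
    Functor.isoWhiskerRight η hE.resolutionFunctor ≪≫
      Functor.isoWhiskerLeft L hE.resolutionFunctorShiftIso
  refine ⟨η', fun {X Y Z} f g k hT => ?_⟩
  obtain ⟨A, B, C, i, p, w, b₀, e, α, β, γ, H, hb, he, h₁, h₂, h₃⟩ := hη f g k hT
  -- The objects of the exact sequence are replaced by cocycles of acyclic complexes; the complexes
  -- attached by the functor agree with these only up to the isomorphisms `a`, `b`, `c`.
  obtain ⟨CA, RA, rfl⟩ := hE.exists_acyclicData A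
  obtain ⟨CB, RB, rfl⟩ := hE.exists_acyclicData B
  obtain ⟨CC, RC, rfl⟩ := hE.exists_acyclicData C
  obtain ⟨φ, c₀, ψ, hφ, hc₀, hψ, hc⟩ := AcyclicData.exists_mappingCone_hom hE RA RB RC H hb he
  obtain ⟨a, ha⟩ := hE.exists_resolutionFunctor_iso RA α
  obtain ⟨b, hb⟩ := hE.exists_resolutionFunctor_iso RB β
  obtain ⟨c, hc'⟩ := hE.exists_resolutionFunctor_iso RC γ
  let q := HomotopyCategory.quotient E.InjObj (ComplexShape.up ℤ)
  have hf : hE.resolutionFunctor.map (L.map f) ≫ b.hom = a.hom ≫ q.map φ :=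
    (((hE.represents_resolutionMap (L.map f)).comp hb).eq_iff hE (ha.comp hφ)).2 (by
      simp only [Category.assoc, Iso.inv_hom_id_assoc, h₁])
  have hg : hE.resolutionFunctor.map (L.map g) ≫ c.hom =
      b.hom ≫ q.map (mappingCone.inr φ ≫ c₀) :=
    (((hE.represents_resolutionMap (L.map g)).comp hc').eq_iff hE (hb.comp hc₀)).2 (by
      simp only [Category.assoc, Iso.inv_hom_id_assoc, h₂])
  change Z ⟶ (CategoryTheory.shiftFunctor T (1 : ℤ)).obj X at k
  obtain ⟨ηX, hηX⟩ : ∃ ηX : L.obj ((CategoryTheory.shiftFunctor T (1 : ℤ)).obj X) ⟶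
    hE.shift.obj (L.obj X), ηX = η.hom.app X := ⟨_, rfl⟩
  have h₄ : L.map k ≫ ηX ≫ hE.shift.map α.hom =
      γ.hom ≫ (Quotient.functor E.stableRel).map e := by
    rw [hηX]
    exact (Category.assoc _ _ _).symm.trans h₃
  have hη' : η'.hom.app X = hE.resolutionFunctor.map ηX ≫
      (hE.resolutionObjShiftIso (L.obj X)).hom ≫ (q.commShiftIso (1 : ℤ)).hom.app _ := by
    rw [hηX]
    rfl
  -- The comparison of shifts is inverted at the end so that both sides are morphisms between
  -- classes of acyclic complexes, to which `Represents.eq_iff` applies.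
  have hk : hE.resolutionFunctor.map (L.map k) ≫ hE.resolutionFunctor.map ηX ≫
      (hE.resolutionObjShiftIso (L.obj X)).hom ≫ (q.commShiftIso (1 : ℤ)).hom.app _ ≫
        (CategoryTheory.shiftFunctor _ (1 : ℤ)).map a.hom ≫
          (q.commShiftIso (1 : ℤ)).inv.app _ = c.hom ≫ q.map ψ := by
    refine (((hE.represents_resolutionMap (L.map k)).comp
      ((hE.represents_resolutionMap ηX).comp
        ((hE.represents_resolutionObjShiftIso (L.obj X)).comp (ha.shift hE)))).eq_iff hE
          (hc'.comp hψ)).2 ?_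
    simp only [resolutionShiftIso, Category.assoc, Iso.trans_hom, Iso.inv_hom_id_assoc,
      Functor.mapIso_hom, Iso.symm_hom, Functor.map_comp, Iso.map_inv_hom_id_assoc]
    rw [reassoc_of% h₄]
    exact congrArg (_ ≫ ·) (Category.assoc _ _ _)
  have hk' : hE.resolutionFunctor.map (L.map k) ≫ η'.hom.app X = c.hom ≫ q.map ψ ≫
      (q.commShiftIso (1 : ℤ)).hom.app _ ≫
        (CategoryTheory.shiftFunctor _ (1 : ℤ)).map a.inv := by
    have h₅ : (CategoryTheory.shiftFunctor (HomotopyCategory E.InjObj (ComplexShape.up ℤ))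
        (1 : ℤ)).map a.hom ≫ (q.commShiftIso (1 : ℤ)).inv.app _ ≫
          (q.commShiftIso (1 : ℤ)).hom.app _ ≫
            (CategoryTheory.shiftFunctor _ (1 : ℤ)).map a.inv = 𝟙 _ := by
      rw [Iso.inv_hom_id_app_assoc, ← Functor.map_comp, a.hom_inv_id,
        CategoryTheory.Functor.map_id]
    rw [hη', ← reassoc_of% hk]
    exact (congrArg (_ ≫ ·) (congrArg (_ ≫ ·) (congrArg (_ ≫ ·)
      ((congrArg (_ ≫ ·) h₅).trans (Category.comp_id _))))).symm
  -- The test object `V` is the mapping cone of `φ`, with its triangle transported along `a` and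
  -- `b`; the comparison is `c₀` followed by the inverse of `c`.
  refine distTriang_map_of_fullyFaithful (L ⋙ hE.resolutionFunctor) η' (f := f) (g := g) (h := k)
    hT (u := b.hom ≫ q.map (mappingCone.inr φ)) (d := q.map (coneProj φ) ≫
      (q.commShiftIso (1 : ℤ)).hom.app _ ≫ (CategoryTheory.shiftFunctor _ (1 : ℤ)).map a.inv)
    (isomorphic_distinguished _ (distTriang_mappingCone φ) _
      (Triangle.isoMk _ _ a b (Iso.refl _) hf ?_ ?_)) (q.map c₀ ≫ c.inv) ?_ ?_
  · exact Category.comp_id _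
  · have h₅ : (CategoryTheory.shiftFunctor (HomotopyCategory E.InjObj (ComplexShape.up ℤ))
        (1 : ℤ)).map a.inv ≫ (CategoryTheory.shiftFunctor _ (1 : ℤ)).map a.hom = 𝟙 _ := by
      rw [← Functor.map_comp, a.inv_hom_id, CategoryTheory.Functor.map_id]
    refine (Category.assoc _ _ _).trans (Eq.trans ?_ (Category.id_comp _).symm)
    exact congrArg (_ ≫ ·) ((Category.assoc _ _ _).trans ((congrArg (_ ≫ ·) h₅).trans
      (Category.comp_id _)))
  · rw [Category.assoc, ← Functor.map_comp_assoc, ← reassoc_of% hg, Iso.hom_inv_id,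
      Category.comp_id]
    rfl
  · refine (Category.assoc _ _ _).trans ?_
    refine (congrArg (fun x => q.map c₀ ≫ c.inv ≫ x) hk').trans ?_
    rw [Iso.inv_hom_id_assoc, ← Functor.map_comp_assoc, hc]

end ExactStructure.IsFrobenius

end AcyclicComplexes

/-- Equivalent conditions for a `K`-linear triangulated category `T` to be algebraic. All
categories and functors are `K`-linear; additive categories are preadditive categories with a zero
object and binary biproducts. The universe `v'` of morphisms and the universe parameter `u'` of the
objects of the auxiliary categories are arbitrary. -/
theorem mainTheorem1 {K : Type w} [CommRing K] {T : Type u} [Category.{v} T] [Preadditive T]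
    [Linear K T] [Limits.HasZeroObject T] [HasShift T ℤ] [∀ n : ℤ, (shiftFunctor T n).Additive]
    [∀ n : ℤ, (shiftFunctor T n).Linear K] [Pretriangulated T] [IsTriangulated T] :
    List.TFAE [
      ∃ (F : Type (max u u' v')) (_ : Category.{v'} F) (_ : Preadditive F) (_ : Linear K F)
        (_ : Limits.HasBinaryBiproducts F) (_ : Limits.HasZeroObject F)
        (E : ExactStructure F) (hE : E.IsFrobenius) (G : T ⥤ E.Stable),
        G.Additive ∧ G.Linear K ∧ (TriangleStructure.ofPretriangulated T).IsExact hE.triangles G ∧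
          G.Full ∧ G.Faithful,
      ∃ (F : Type (max u u' v')) (_ : Category.{v'} F) (_ : Preadditive F) (_ : Linear K F)
        (_ : Limits.HasBinaryBiproducts F) (_ : Limits.HasZeroObject F)
        (E : ExactStructure F) (hE : E.IsFrobenius) (G : T ⥤ E.Stable),
        G.Additive ∧ G.Linear K ∧ (TriangleStructure.ofPretriangulated T).IsExact hE.triangles G ∧
          G.IsEquivalence,
      ∃ (A : Type (max u u' v')) (_ : Category.{v'} A) (_ : Preadditive A) (_ : Linear K A)
        (_ : Limits.HasBinaryBiproducts A) (_ : Limits.HasZeroObject A)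
        (G : T ⥤ HomotopyCategory A (ComplexShape.up ℤ)),
        G.Additive ∧ G.Linear K ∧ (TriangleStructure.ofPretriangulated T).IsExact
          (TriangleStructure.ofPretriangulated (HomotopyCategory A (ComplexShape.up ℤ))) G ∧
          G.Full ∧ G.Faithful,
      Nonempty (DGEnhancement.{w, v', v, max u u' v', u} K T
        (TriangleStructure.ofPretriangulated T))] := by
  tfae_have 2 → 1 := by
    rintro ⟨F, _, _, _, _, _, E, hE, G, h₁, h₂, h₃, h₄⟩
    exact ⟨F, _, _, _, _, _, E, hE, G, h₁, h₂, h₃, inferInstance, inferInstance⟩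
  tfae_have 3 → 2 := by
    rintro ⟨A, _, _, _, _, _, G, _, _, h, _, _⟩
    exact exists_frobenius_of_homotopyCategory G h
  tfae_have 3 → 4 := by
    rintro ⟨A, _, _, _, _, _, G, _, _, h, _, _⟩
    -- The last universe argument lifts the objects of `T`, which index the dg category, to the
    -- universe required of its objects.
    exact ⟨ImageDG.enhancement.{w, v', v, max u u' v', u, max u u' v'} G h⟩
  tfae_have 4 → 3 := by
    rintro ⟨e⟩
    exact e.exists_functor_homotopyCategory
  tfae_have 1 → 3 := by
    rintro ⟨F, _, _, _, _, _, E, hE, L, _, _, h, _, _⟩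
    exact ⟨E.InjObj, inferInstance, inferInstance, inferInstance, inferInstance, inferInstance,
      L ⋙ hE.resolutionFunctor, inferInstance, inferInstance,
      hE.isExact_comp_resolutionFunctor L h, inferInstance, inferInstance⟩
  tfae_finish
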